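/- Let $d\ge 1$. Write $\mathbb H^{d+1}$ for hyperbolic space and $\mathrm{SO}_\circ(d+1,1)$ for its group of orientation preserving isometries. *Definitions.* Let $M$ be an oriented Lipschitz $d$-manifold. A map $\phi:M\to\mathbb H^{d+1}$ is a *Lipschitz embedding* if it is a topological embedding and $(x,y)\mapsto d_{\mathbb H^{d+1}}(\phi(x),\phi(y))$ is locally bi-Lipschitz to the Euclidean distance in the charts of $M$. It is *convex* if there is an open convex set $V\subset\mathbb H^{d+1}$ such that $\phi(M)$ is an open subset of $\partial V$ and the orientation of $M$ is the boundary orientation of $\partial V$; it is *locally convex* if every point of $M$ has an open neighbourhood on which $\phi$ is a convex Lipschitz embedding. It is *ruled* if for every $x\in M$ there is an injective continuous curve $\gamma:(-\varepsilon,\varepsilon)\to M$ with $\gamma(0)=x$ such that $\phi\circ\gamma$ is a geodesic segment. A *hyperbolic embedding structure* on $M$ is a maximal family $(U_i,\phi_i)$, with $(U_i)$ an open cover of $M$ and $\phi_i:U_i\to\mathbb H^{d+1}$ Lipschitz embeddings, such that for all $i,j$ and $x\in U_i\cap U_j$ there is $g\in\mathrm{SO}_\circ(d+1,1)$ with $\phi_j=g\circ\phi_i$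 near $x$. It is *convex ruled* if all the $\phi_i$ are locally convex and ruled. The *concave development* $\mathcal W(\psi)$ of a convex Lipschitz embedding $\psi:\mathcal H\to\mathbb H^{d+1}$ with open convex set $V$ is the set of the points $\exp_{\psi(x)}(tv)$, where $t\ge 0$, $x\in\mathcal H$, and $v$ is a unit tangent vector at $\psi(x)$ pointing outside of $V$ such that $v^\perp$ is a support hyperplane of $V$. A *concave hyperbolic manifold* of dimension $d+1$ is a connected Hausdorff second countable space $X$ with a maximal family $(U_i,\phi_i)$, where $(U_i)$ is an open cover of $X$ and each $\phi_i$ is a homeomorphism from $U_i$ onto a concave development $\mathcal W(\psi_i)\subset\mathbb H^{d+1}$, such that for all $i,j$ there is $g_{ij}\in\mathrm{SO}_\circ(d+1,1)$ with $\phi_j=g_{ij}\circ\phi_i$ on $U_i\cap U_j$. Its boundary, as a manifold with boundary, is the set of the points $x$ such that, for a chart $\phi_i$ defined at $x$, $\phi_i(x)$ is not interior to $\phi_i(U_i)$ in $\mathbb H^{d+1}$. A *hyperbolic end* $E$ is a concave hyperbolic manifold with nonempty compact boundary which is maximal among those for inclusion: every topological embedding of $E$ into a concave hyperbolic manifold of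 the same dimension with nonempty compact boundary, given in charts locally by elements of $\mathrm{SO}_\circ(d+1,1)$, is surjective. The boundary $\partial_0E$ is called the *pleated boundary* of $E$. **Lemma.** Let $E$ be a hyperbolic end of dimension $d+1$. Then the pleated boundary $\partial_0 E$ carries a convex ruled hyperbolic embedding structure. More precisely, there are an oriented Lipschitz $d$-manifold structure on $\partial_0E$ and a convex ruled hyperbolic embedding structure on it whose charts include the restrictions to $\partial_0E$ of all the charts of $E$. -/

import Mathlib

open Set Filter Topology MeasureTheory

universe u

noncomputable section

/-! ### Hyperbolic space (hyperboloid model) -/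

/-- The Lorentzian form of signature `(n, 1)` on `ℝ^{n+1}`; the coordinate `0` is the time one. -/
def lorentz {n : ℕ} (x y : Fin (n + 1) → ℝ) : ℝ :=
  -(x 0 * y 0) + ∑ i : Fin n, x i.succ * y i.succ

/-- Hyperbolic space `ℍⁿ`, the upper sheet of the hyperboloid `⟨x, x⟩ = -1` in `ℝ^{n+1}`. -/
def HypSpace (n : ℕ) : Type :=
  {x : Fin (n + 1) → ℝ // lorentz x x = -1 ∧ 0 < x 0}

namespace HypSpace

variable {n : ℕ}

/-- The position vector in `ℝ^{n+1}` of a point of `ℍⁿ`. -/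
def vec (p : HypSpace n) : Fin (n + 1) → ℝ := p.1

/-- The topology induced from `ℝ^{n+1}`, which is that of the hyperbolic distance. -/
instance : TopologicalSpace (HypSpace n) :=
  inferInstanceAs (TopologicalSpace {x : Fin (n + 1) → ℝ // lorentz x x = -1 ∧ 0 < x 0})

/-- The hyperbolic distance. -/
def hdist (p q : HypSpace n) : ℝ := Real.arcosh (-lorentz p.vec q.vec)

/-- `v` is a unit vector of the tangent space `T_p ℍⁿ = p^⊥`. -/
def IsUnitTangent (p : HypSpace n) (v : Fin (n + 1) → ℝ) : Prop :=
  lorentz p.vec v = 0 ∧ lorentz v v = 1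

/-- `z = exp_p (t v)`, where `v` is a unit tangent vector at `p`. -/
def IsExp (p : HypSpace n) (v : Fin (n + 1) → ℝ) (t : ℝ) (z : HypSpace n) : Prop :=
  z.vec = Real.cosh t • p.vec + Real.sinh t • v

/-- Geodesic convexity: `V` contains the geodesic segment between any two of its points. -/
def GeodConvex (V : Set (HypSpace n)) : Prop :=
  ∀ p ∈ V, ∀ v, IsUnitTangent p v → ∀ t : ℝ, 0 ≤ t → ∀ q ∈ V, IsExp p v t q →
    ∀ s ∈ Icc 0 t, ∀ z, IsExp p v s z → z ∈ V

/-- `g` is an orientation preserving isometry of `ℍⁿ`, that is, the action of an element of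
`SO_∘(n, 1)`: a linear map of determinant `1` which preserves the Lorentzian form and the upper
sheet of the hyperboloid. -/
def IsOrientedIsometry (g : HypSpace n → HypSpace n) : Prop :=
  ∃ A : Matrix (Fin (n + 1)) (Fin (n + 1)) ℝ,
    (∀ x y, lorentz (A.mulVec x) (A.mulVec y) = lorentz x y) ∧ A.det = 1 ∧
      ∀ p, (g p).vec = A.mulVec p.vec

end HypSpace

open HypSpace

/-! ### Oriented Lipschitz manifolds and Lipschitz embeddings -/

/-- An oriented Lipschitz structure of dimension `d` on `M`: an atlas whose changes of charts are
locally Lipschitz (hence locally bi-Lipschitz, by exchanging the charts) and have positive Jacobian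
determinant almost everywhere. -/
structure OrientedLipschitzAtlas (M : Type u) [TopologicalSpace M] (d : ℕ) where
  charts : Set (OpenPartialHomeomorph M (EuclideanSpace ℝ (Fin d)))
  cover : ∀ x : M, ∃ κ ∈ charts, x ∈ κ.source
  locallyLipschitz : ∀ κ ∈ charts, ∀ κ' ∈ charts,
    LocallyLipschitzOn (κ.symm.trans κ').source (fun z => κ' (κ.symm z))
  oriented : ∀ κ ∈ charts, ∀ κ' ∈ charts, ∀ᵐ z ∂(volume : Measure (EuclideanSpace ℝ (Fin d))),
    z ∈ (κ.symm.trans κ').source → 0 < (fderiv ℝ (fun w => κ' (κ.symm w)) z).det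

section Embeddings

variable {M : Type u} [TopologicalSpace M] {d : ℕ}

/-- The restriction of `φ` to the open set `U` is a Lipschitz embedding: it is a topological
embedding, and the distance `(y, z) ↦ hdist (φ y) (φ z)` is locally bi-Lipschitz to the Euclidean
distance in the charts. The values of `φ` outside `U` play no role. -/
structure IsLipschitzEmbeddingOn (O : OrientedLipschitzAtlas M d) (φ : M → HypSpace (d + 1))
    (U : Set M) : Prop where
  isOpen : IsOpen U
  embedding : IsEmbedding (U.domRestrict φ)
  biLipschitz : ∀ κ ∈ O.charts, ∀ x ∈ U ∩ κ.source, ∃ C : ℝ, 0 < C ∧ ∃ N ∈ 𝓝 x,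
    ∀ y ∈ N ∩ (U ∩ κ.source), ∀ z ∈ N ∩ (U ∩ κ.source),
      hdist (φ y) (φ z) ≤ C * dist (κ y) (κ z) ∧ dist (κ y) (κ z) ≤ C * hdist (φ y) (φ z)

/-- The restriction of `φ` to `U` is a convex Lipschitz embedding, with `V` as the open convex set:
`φ(U)` is an open subset of `∂V`, and the orientation of `U` is the boundary orientation of `∂V`
(outward normal first). For the last condition, note that at a point `p` of `∂V` a point `y` of `V`
represents an inward direction, and that a basis `b` of `T_p ℍ` is positive when `(p, b)` has
positive determinant. -/
structure IsConvexEmbeddingOn (O : OrientedLipschitzAtlas M d) (φ : M → HypSpace (d + 1))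
    (U : Set M) (V : Set (HypSpace (d + 1))) : Prop where
  lipschitz : IsLipschitzEmbeddingOn O φ U
  isOpen : IsOpen V
  convex : GeodConvex V
  image_open : ∃ G : Set (HypSpace (d + 1)), IsOpen G ∧ φ '' U = G ∩ frontier V
  oriented : ∀ κ ∈ O.charts, ∀ᵐ z ∂(volume : Measure (EuclideanSpace ℝ (Fin d))),
    z ∈ κ.target → κ.symm z ∈ U → ∀ y ∈ V,
      (Matrix.of (Matrix.vecCons (φ (κ.symm z)).vec (Matrix.vecCons y.vec
        (fun i : Fin d =>
          fderiv ℝ (fun w => (φ (κ.symm w)).vec) z (EuclideanSpace.single i (1 : ℝ)))))).det < 0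

/-- The restriction of `φ` to `U` is locally convex. -/
def IsLocallyConvexOn (O : OrientedLipschitzAtlas M d) (φ : M → HypSpace (d + 1))
    (U : Set M) : Prop :=
  ∀ x ∈ U, ∃ N ⊆ U, x ∈ N ∧ ∃ V, IsConvexEmbeddingOn O φ N V

/-- The restriction of `φ` to `U` is ruled: through every point of `U` passes an injective
continuous curve `γ : (-ε, ε) → U` such that `φ ∘ γ` is a (unit speed) geodesic segment. -/
def IsRuledOn (φ : M → HypSpace (d + 1)) (U : Set M) : Prop :=
  ∀ x ∈ U, ∃ (ε : ℝ) (γ : ℝ → M), 0 < ε ∧ ContinuousOn γ (Ioo (-ε) ε) ∧ InjOn γ (Ioo (-ε) ε) ∧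
    MapsTo γ (Ioo (-ε) ε) U ∧ γ 0 = x ∧
    ∃ v, IsUnitTangent (φ x) v ∧ ∀ t ∈ Ioo (-ε) ε, IsExp (φ x) v t (φ (γ t))

/-- The normal vectors at `φ x` to the convex set `V`: unit tangent vectors `v` at `φ x`, pointing
outside of `V`, whose orthogonal is a support hyperplane of `V`. -/
def IsNormalVector (φ : M → HypSpace (d + 1)) (V : Set (HypSpace (d + 1))) (x : M)
    (v : Fin (d + 2) → ℝ) : Prop :=
  IsUnitTangent (φ x) v ∧ ∀ y ∈ V, lorentz v y.vec ≤ 0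

/-- The concave development `𝓦(φ)` of a convex Lipschitz embedding `φ` with open convex set `V`. -/
def concaveDevelopment (φ : M → HypSpace (d + 1)) (V : Set (HypSpace (d + 1))) :
    Set (HypSpace (d + 1)) :=
  {z | ∃ x v, IsNormalVector φ V x v ∧ ∃ t : ℝ, 0 ≤ t ∧ IsExp (φ x) v t z}

end Embeddings

/-! ### Atlases -/

/-- A map from an open subset `source` of `X` to `ℍ^{d+1}` (values outside `source` are
irrelevant). -/
structure HypChart (X : Type u) [TopologicalSpace X] (d : ℕ) where
  source : Set X
  isOpen_source : IsOpen source
  toFun : X → HypSpace (d + 1)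

/-- Restriction of a chart to a subspace. -/
def HypChart.restrictTo {X : Type u} [TopologicalSpace X] {d : ℕ} (c : HypChart X d) (S : Set X) :
    HypChart S d where
  source := Subtype.val ⁻¹' c.source
  isOpen_source := c.isOpen_source.preimage continuous_subtype_val
  toFun := fun x => c.toFun x.1

section Structures

variable {M : Type u} [TopologicalSpace M] {d : ℕ}

/-- Hyperbolic embedding atlases on an oriented Lipschitz manifold. -/
structure IsHypEmbeddingAtlas (O : OrientedLipschitzAtlas M d) (B : Set (HypChart M d)) :
    Prop where
  cover : ∀ x : M, ∃ c ∈ B, x ∈ c.source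
  embedding : ∀ c ∈ B, IsLipschitzEmbeddingOn O c.toFun c.source
  compatible : ∀ c ∈ B, ∀ c' ∈ B, ∀ x ∈ c.source ∩ c'.source, ∃ g, IsOrientedIsometry g ∧
    ∀ᶠ y in 𝓝 x, c'.toFun y = g (c.toFun y)

/-- A hyperbolic embedding structure is a maximal hyperbolic embedding atlas. -/
def IsHypEmbeddingStructure (O : OrientedLipschitzAtlas M d) (B : Set (HypChart M d)) : Prop :=
  Maximal (IsHypEmbeddingAtlas O) B

/-- The charts of the structure are locally convex and ruled. -/
def IsConvexRuled (O : OrientedLipschitzAtlas M d) (B : Set (HypChart M d)) : Prop :=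
  ∀ c ∈ B, IsLocallyConvexOn O c.toFun c.source ∧ IsRuledOn c.toFun c.source

end Structures

section Ends

variable {X : Type u} [TopologicalSpace X] {d : ℕ}

/-- Concave hyperbolic atlases on a topological space. -/
structure IsConcaveAtlas (A : Set (HypChart X d)) : Prop where
  cover : ∀ x : X, ∃ c ∈ A, x ∈ c.source
  embedding : ∀ c ∈ A, IsEmbedding (c.source.domRestrict c.toFun)
  image : ∀ c ∈ A, ∃ (H : Type) (_ : TopologicalSpace H) (O : OrientedLipschitzAtlas H d)
    (ψ : H → HypSpace (d + 1)) (V : Set (HypSpace (d + 1))),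
    IsConvexEmbeddingOn O ψ univ V ∧ c.toFun '' c.source = concaveDevelopment ψ V
  compatible : ∀ c ∈ A, ∀ c' ∈ A, ∃ g, IsOrientedIsometry g ∧
    ∀ x ∈ c.source ∩ c'.source, c'.toFun x = g (c.toFun x)

/-- `X`, with the maximal concave hyperbolic atlas `A`, is a concave hyperbolic manifold. -/
structure IsConcaveHypManifold (A : Set (HypChart X d)) : Prop where
  connected : ConnectedSpace X
  t2 : T2Space X
  secondCountable : SecondCountableTopology X
  maximal_atlas : Maximal IsConcaveAtlas A

/-- The boundary of `X` as a manifold with boundary: the points at which (in a chart) the image of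
the chart is not a neighbourhood. The charts being local homeomorphisms onto concave developments,
these are the points which are sent to the image of the convex embedding. -/
def pleatedBoundary (A : Set (HypChart X d)) : Set X :=
  {x | ∃ c ∈ A, x ∈ c.source ∧ c.toFun x ∉ interior (c.toFun '' c.source)}

/-- `ι` identifies `X` with a subset of `X'`, with its topology and hyperbolic structure. -/
structure IsHypInclusion {X' : Type u} [TopologicalSpace X'] (A : Set (HypChart X d))
    (A' : Set (HypChart X' d)) (ι : X → X') : Prop where
  embedding : IsEmbedding ι
  isometric : ∀ c ∈ A, ∀ c' ∈ A', ∀ x ∈ c.source, ι x ∈ c'.source →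
    ∃ g, IsOrientedIsometry g ∧ ∀ᶠ y in 𝓝 x, c'.toFun (ι y) = g (c.toFun y)

/-- Concave hyperbolic manifolds with nonempty compact boundary. -/
structure IsCompactlyBounded (A : Set (HypChart X d)) : Prop where
  manifold : IsConcaveHypManifold A
  nonempty : (pleatedBoundary A).Nonempty
  compact : IsCompact (pleatedBoundary A)

/-- Hyperbolic ends: concave hyperbolic manifolds with nonempty compact boundary which are maximal,
for inclusion, among those. -/
structure IsHypEnd (A : Set (HypChart X d)) : Prop where
  bounded : IsCompactlyBounded A
  maximal : ∀ (X' : Type u) [TopologicalSpace X'] (A' : Set (HypChart X' d)),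
    IsCompactlyBounded A' → ∀ ι : X → X', IsHypInclusion A A' ι → Function.Surjective ι

end Ends

end

/-! In a chart the end is the set `development V G` of points outside an open convex set `V` whose
nearest point on the closure of `V` lies in an open set `G` (`concaveDevelopment_eq`), and the
pleated boundary is `G ∩ frontier V`. Convexity is handled linearly throughout: `V` is geodesically
convex exactly when the cone over it in Minkowski space is stable under addition (`geodConvex_iff`).

Structure. In suitable linear coordinates the boundary of the cone over `V` is the graph of a convex
function. Such a function is locally Lipschitz, hence differentiable almost everywhere, and a
support hyperplane decides the sign of the orientation determinant (`volForm_lift_neg`). A change of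
charts of the end is an isometry which also carries `V` to `V'` locally, because the charts are
locally onto the complements of these sets (`eventually_mem_iff`). So the graph charts coming from
all charts of the end have Lipschitz transitions of positive Jacobian
(`ae_det_fderiv_transition_pos`), and the charts of the end restrict to convex embeddings. Zorn's
lemma gives the maximal structure, each chart of which is locally an isometry composed with one of
these.

Ruling. Suppose that a boundary point `p` is not inside any geodesic segment of the closure of `V`.
Then it is an extreme point of a compact convex slice of the closed cone
(`vec_mem_extremePoints_slice`), and a half space cuts off an arbitrarily small cap around it
(`exists_cap`). With the cap `V \ V'` removed, the development of the remaining set `V'` is the old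
one together with the cap (`isCap_cut`). Gluing it to the end along the chart gives a strictly
larger concave manifold with compact nonempty boundary, against maximality
(`IsHypEnd.isInnerPoint`). The delicate point is that the glued space has concave charts at the
points outside the modified chart: a normal ray which starts in a chart domain never leaves it
(`mem_source_of_isProj`), so the other charts can be shrunk away from the removed part of the
boundary. Hence each boundary point is inside a segment of the closure of `V`; such a segment stays
in the frontier (`expMap_mem_frontier`) and lifts to the required curve. -/

noncomputable section

open HypSpace

/-! ### The Lorentzian form and the future cone -/

section Lorentz

variable {n : ℕ}

lemma lorentz_comm (x y : Fin (n + 1) → ℝ) : lorentz x y = lorentz y x := by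
  simp only [lorentz, mul_comm]

lemma lorentz_add_left (x y z : Fin (n + 1) → ℝ) :
    lorentz (x + y) z = lorentz x z + lorentz y z := by
  simp only [lorentz, Pi.add_apply, add_mul, Finset.sum_add_distrib]; ring

lemma lorentz_smul_left (c : ℝ) (x y : Fin (n + 1) → ℝ) :
    lorentz (c • x) y = c * lorentz x y := by
  simp only [lorentz, Pi.smul_apply, smul_eq_mul, mul_add, Finset.mul_sum, mul_assoc, mul_neg]

lemma lorentz_add_right (x y z : Fin (n + 1) → ℝ) :
    lorentz x (y + z) = lorentz x y + lorentz x z := by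
  rw [lorentz_comm, lorentz_add_left, lorentz_comm y, lorentz_comm z]

lemma lorentz_smul_right (c : ℝ) (x y : Fin (n + 1) → ℝ) :
    lorentz x (c • y) = c * lorentz x y := by
  rw [lorentz_comm, lorentz_smul_left, lorentz_comm]

lemma lorentz_sub_left (x y z : Fin (n + 1) → ℝ) :
    lorentz (x - y) z = lorentz x z - lorentz y z := by
  rw [sub_eq_add_neg, ← neg_one_smul ℝ y, lorentz_add_left, lorentz_smul_left]; ring

lemma lorentz_sub_right (x y z : Fin (n + 1) → ℝ) :
    lorentz x (y - z) = lorentz x y - lorentz x z := by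
  rw [lorentz_comm, lorentz_sub_left, lorentz_comm y, lorentz_comm z]

@[fun_prop]
lemma Continuous.lorentz {α : Type*} [TopologicalSpace α] {f g : α → Fin (n + 1) → ℝ}
    (hf : Continuous f) (hg : Continuous g) : Continuous fun a => lorentz (f a) (g a) := by
  unfold _root_.lorentz; fun_prop

/-- The open future cone. -/
def futureCone (n : ℕ) : Set (Fin (n + 1) → ℝ) := {x | lorentz x x < 0 ∧ 0 < x 0}

lemma isOpen_futureCone : IsOpen (futureCone n) :=
  (isOpen_lt (f := fun x => lorentz x x) (by fun_prop) continuous_const).inter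
    (isOpen_lt (g := fun x : Fin (n + 1) → ℝ => x 0) continuous_const (by fun_prop))

/-- Reversed Cauchy–Schwarz: the space parts have norms smaller than the time parts, so their scalar
product cannot compensate the product of the times. -/
lemma lorentz_neg_of_mem_futureCone {x y : Fin (n + 1) → ℝ} (hx : x ∈ futureCone n)
    (hy : y ∈ futureCone n) : lorentz x y < 0 := by
  obtain ⟨hx1, hx0⟩ := hx
  obtain ⟨hy1, hy0⟩ := hy
  have cs := Finset.sum_mul_sq_le_sq_mul_sq Finset.univ (fun i : Fin n => x i.succ)
    (fun i => y i.succ)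
  simp only [lorentz, ← sq] at *
  set P := ∑ i : Fin n, x i.succ ^ 2
  set Q := ∑ i : Fin n, y i.succ ^ 2
  set s := ∑ i : Fin n, x i.succ * y i.succ
  have hP : 0 ≤ P := Finset.sum_nonneg fun i _ => sq_nonneg _
  have hQ : 0 ≤ Q := Finset.sum_nonneg fun i _ => sq_nonneg _
  have h1 : P * Q < (x 0 * y 0) ^ 2 := by
    rw [mul_pow]
    exact mul_lt_mul'' (by linarith) (by linarith) hP hQ
  have : |s| < x 0 * y 0 := by
    apply abs_lt_of_sq_lt_sq _ (by positivity)
    linarith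
  linarith [le_abs_self s]

lemma add_mem_futureCone {x y : Fin (n + 1) → ℝ} (hx : x ∈ futureCone n)
    (hy : y ∈ futureCone n) : x + y ∈ futureCone n := by
  have h := lorentz_neg_of_mem_futureCone hx hy
  refine ⟨?_, add_pos hx.2 hy.2⟩
  simp only [lorentz_add_left, lorentz_add_right, lorentz_comm y x]
  linarith [hx.1, hy.1]

lemma smul_mem_futureCone {x : Fin (n + 1) → ℝ} (hx : x ∈ futureCone n) {c : ℝ} (hc : 0 < c) :
    c • x ∈ futureCone n := by
  refine ⟨?_, mul_pos hc hx.2⟩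
  rw [lorentz_smul_left, lorentz_smul_right]
  have := hx.1
  exact mul_neg_of_pos_of_neg hc (mul_neg_of_pos_of_neg hc this)

end Lorentz

namespace HypSpace

variable {n : ℕ}

lemma vec_injective : Function.Injective (vec : HypSpace n → Fin (n + 1) → ℝ) :=
  Subtype.val_injective

lemma isEmbedding_vec : IsEmbedding (vec : HypSpace n → Fin (n + 1) → ℝ) :=
  IsEmbedding.subtypeVal

@[fun_prop]
lemma continuous_vec : Continuous (vec : HypSpace n → Fin (n + 1) → ℝ) :=
  isEmbedding_vec.continuous

lemma lorentz_vec_self (p : HypSpace n) : lorentz p.vec p.vec = -1 := p.2.1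

lemma vec_zero_pos (p : HypSpace n) : 0 < p.vec 0 := p.2.2

lemma vec_mem_futureCone (p : HypSpace n) : p.vec ∈ futureCone n :=
  ⟨by rw [lorentz_vec_self]; norm_num, p.vec_zero_pos⟩

instance : T2Space (HypSpace n) := isEmbedding_vec.t2Space

instance : SecondCountableTopology (HypSpace n) := isEmbedding_vec.secondCountableTopology

/-- The squared Euclidean distance of the space components, compared with the distance. -/
lemma sum_sq_sub_le (p q : HypSpace n) :
    (p.vec 0 - q.vec 0) ^ 2 ≤ ∑ i : Fin n, (p.vec i.succ - q.vec i.succ) ^ 2 ∧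
    ∑ i : Fin n, (p.vec i.succ - q.vec i.succ) ^ 2
      ≤ 2 * (p.vec 0 * q.vec 0) * (-lorentz p.vec q.vec - 1) ∧
    -lorentz p.vec q.vec - 1 ≤ (∑ i : Fin n, (p.vec i.succ - q.vec i.succ) ^ 2) / 2 := by
  have cs := Finset.sum_mul_sq_le_sq_mul_sq Finset.univ (fun i : Fin n => p.vec i.succ)
    (fun i => q.vec i.succ)
  have hp := p.lorentz_vec_self
  have hq := q.lorentz_vec_self
  have hp0 := p.vec_zero_pos
  have hq0 := q.vec_zero_pos
  have hD : ∑ i : Fin n, (p.vec i.succ - q.vec i.succ) ^ 2 =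
      (∑ i : Fin n, p.vec i.succ ^ 2) + (∑ i : Fin n, q.vec i.succ ^ 2)
      - 2 * ∑ i : Fin n, p.vec i.succ * q.vec i.succ := by
    rw [Finset.mul_sum, ← Finset.sum_add_distrib, ← Finset.sum_sub_distrib]
    exact Finset.sum_congr rfl fun i _ => by ring
  have hD0 : 0 ≤ ∑ i : Fin n, (p.vec i.succ - q.vec i.succ) ^ 2 :=
    Finset.sum_nonneg fun i _ => sq_nonneg _
  rw [hD] at hD0 ⊢
  simp only [lorentz, ← sq] at *
  set P := ∑ i : Fin n, p.vec i.succ ^ 2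
  set Q := ∑ i : Fin n, q.vec i.succ ^ 2
  set s := ∑ i : Fin n, p.vec i.succ * q.vec i.succ
  set a := p.vec 0
  set b := q.vec 0
  have hab : 0 < a * b := mul_pos hp0 hq0
  have hP : P = a ^ 2 - 1 := by linarith
  have hQ : Q = b ^ 2 - 1 := by linarith
  -- Since `(a * b) ^ 2 = 1 + P + Q + P * Q`, this is Cauchy–Schwarz `s ^ 2 ≤ P * Q`; the first
  -- factor on the right is `cosh d(p, q) - 1`.
  have key : P + Q - 2 * s ≤ (a * b - 1 - s) * (a * b + 1 + s) := by
    have : (a * b) ^ 2 = (1 + P) * (1 + Q) := by rw [hP, hQ]; ring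
    nlinarith
  have hs : 1 + s ≤ a * b := by
    refine le_of_sq_le_sq ?_ hab.le
    nlinarith
  refine ⟨by nlinarith, ?_, ?_⟩
  · refine key.trans ?_
    have : 0 ≤ a * b - 1 - s := by linarith
    nlinarith
  · nlinarith [sq_nonneg (a - b)]

lemma one_le_neg_lorentz (p q : HypSpace n) : 1 ≤ -lorentz p.vec q.vec := by
  obtain ⟨-, h2, -⟩ := sum_sq_sub_le p q
  have hD0 : 0 ≤ ∑ i : Fin n, (p.vec i.succ - q.vec i.succ) ^ 2 :=
    Finset.sum_nonneg fun i _ => sq_nonneg _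
  have := mul_pos p.vec_zero_pos q.vec_zero_pos
  by_contra! h
  nlinarith

lemma eq_of_neg_lorentz_le_one {p q : HypSpace n} (h : -lorentz p.vec q.vec ≤ 1) : p = q := by
  obtain ⟨h1, h2, -⟩ := sum_sq_sub_le p q
  have hpq := mul_pos p.vec_zero_pos q.vec_zero_pos
  have hD0 : ∑ i : Fin n, (p.vec i.succ - q.vec i.succ) ^ 2 ≤ 0 := by nlinarith
  have hD1 : ∑ i : Fin n, (p.vec i.succ - q.vec i.succ) ^ 2 = 0 :=
    le_antisymm hD0 (Finset.sum_nonneg fun i _ => sq_nonneg _)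
  rw [Finset.sum_eq_zero_iff_of_nonneg fun i _ => sq_nonneg _] at hD1
  apply vec_injective
  funext i
  refine Fin.cases ?_ (fun i => ?_) i
  · nlinarith
  · have := hD1 i (Finset.mem_univ _)
    nlinarith

/-- A base point of `ℍⁿ`. -/
def basePoint : HypSpace n :=
  ⟨Pi.single 0 1, by simp [lorentz], by simp⟩

/-- The point of `ℍⁿ` with given position vector. -/
def ofVec (x : Fin (n + 1) → ℝ) (h : lorentz x x = -1) (h0 : 0 < x 0) : HypSpace n := ⟨x, h, h0⟩

lemma ofVec_vec (x : Fin (n + 1) → ℝ) (h : lorentz x x = -1) (h0 : 0 < x 0) :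
    (ofVec x h h0).vec = x := rfl

open Classical in
/-- The radial projection of the future cone onto `ℍⁿ`. -/
def normalize (x : Fin (n + 1) → ℝ) : HypSpace n :=
  if h : x ∈ futureCone n then
    ofVec ((√(-lorentz x x))⁻¹ • x) (by
      have h1 : 0 < -lorentz x x := by linarith [h.1]
      rw [lorentz_smul_left, lorentz_smul_right, ← mul_assoc, ← mul_inv,
        Real.mul_self_sqrt h1.le, inv_neg, neg_mul, inv_mul_cancel₀ h.1.ne])
      (mul_pos (inv_pos.2 (Real.sqrt_pos.2 (by linarith [h.1]))) h.2)
  else basePoint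

lemma normalize_vec {x : Fin (n + 1) → ℝ} (h : x ∈ futureCone n) :
    (normalize x).vec = (√(-lorentz x x))⁻¹ • x := by
  rw [normalize, dif_pos h, ofVec_vec]

lemma exists_normalize {x : Fin (n + 1) → ℝ} (h : x ∈ futureCone n) :
    ∃ c : ℝ, 0 < c ∧ (normalize x).vec = c • x :=
  ⟨_, inv_pos.2 (Real.sqrt_pos.2 (by linarith [h.1])), normalize_vec h⟩

lemma smul_normalize {x : Fin (n + 1) → ℝ} (h : x ∈ futureCone n) :
    √(-lorentz x x) • (normalize x).vec = x := by
  rw [normalize_vec h, smul_smul, mul_inv_cancel₀, one_smul]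
  exact (Real.sqrt_pos.2 (by linarith [h.1])).ne'

lemma normalize_smul_vec (q : HypSpace n) {c : ℝ} (hc : 0 < c) : normalize (c • q.vec) = q := by
  apply vec_injective
  rw [normalize_vec (smul_mem_futureCone q.vec_mem_futureCone hc), smul_smul,
    lorentz_smul_left, lorentz_smul_right, lorentz_vec_self,
    show -(c * (c * -1)) = c * c by ring, Real.sqrt_mul_self hc.le, inv_mul_cancel₀ hc.ne',
    one_smul]

lemma normalize_vec_self (q : HypSpace n) : normalize q.vec = q := by
  simpa using normalize_smul_vec q one_pos

lemma normalize_smul {x : Fin (n + 1) → ℝ} (h : x ∈ futureCone n) {c : ℝ} (hc : 0 < c) :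
    normalize (c • x) = normalize x := by
  conv_lhs => rw [← smul_normalize h, smul_smul]
  exact normalize_smul_vec _ (mul_pos hc (Real.sqrt_pos.2 (by linarith [h.1])))

lemma continuousOn_normalize : ContinuousOn (normalize (n := n)) (futureCone n) := by
  rw [isEmbedding_vec.isInducing.continuousOn_iff]
  have : ContinuousOn (fun x : Fin (n + 1) → ℝ => (√(-lorentz x x))⁻¹ • x) (futureCone n) := by
    refine ContinuousOn.smul (ContinuousOn.inv₀ (f := fun x => √(-lorentz x x))
      (Continuous.continuousOn (by fun_prop)) fun x hx => ?_) continuousOn_id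
    exact (Real.sqrt_pos.2 (by linarith [hx.1])).ne'
  exact this.congr fun x hx => normalize_vec hx

lemma continuousAt_normalize {x : Fin (n + 1) → ℝ} (h : x ∈ futureCone n) :
    ContinuousAt normalize x :=
  continuousOn_normalize.continuousAt (isOpen_futureCone.mem_nhds h)

/-! ### Cones over subsets of hyperbolic space -/

/-- The open cone over a subset of `ℍⁿ`. -/
def cone (V : Set (HypSpace n)) : Set (Fin (n + 1) → ℝ) :=
  {x | x ∈ futureCone n ∧ normalize x ∈ V}

lemma smul_vec_mem_cone {V : Set (HypSpace n)} {q : HypSpace n} (hq : q ∈ V) {c : ℝ}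
    (hc : 0 < c) : c • q.vec ∈ cone V :=
  ⟨smul_mem_futureCone q.vec_mem_futureCone hc, by rwa [normalize_smul_vec q hc]⟩

@[simp]
lemma vec_mem_cone {V : Set (HypSpace n)} {q : HypSpace n} : q.vec ∈ cone V ↔ q ∈ V := by
  simp [cone, normalize_vec_self, q.vec_mem_futureCone]

lemma smul_mem_cone {V : Set (HypSpace n)} {x : Fin (n + 1) → ℝ} (hx : x ∈ cone V) {c : ℝ}
    (hc : 0 < c) : c • x ∈ cone V :=
  ⟨smul_mem_futureCone hx.1 hc, by rw [normalize_smul hx.1 hc]; exact hx.2⟩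

lemma smul_mem_cone_iff {V : Set (HypSpace n)} {x : Fin (n + 1) → ℝ} {c : ℝ}
    (hc : 0 < c) : c • x ∈ cone V ↔ x ∈ cone V := by
  refine ⟨fun h => ?_, fun h => smul_mem_cone h hc⟩
  have := smul_mem_cone h (inv_pos.2 hc)
  rwa [smul_smul, inv_mul_cancel₀ hc.ne', one_smul] at this

lemma isOpen_cone {V : Set (HypSpace n)} (hV : IsOpen V) : IsOpen (cone V) :=
  continuousOn_normalize.isOpen_inter_preimage isOpen_futureCone hV

lemma cosh_sq_sub_sinh_sq' (t : ℝ) : Real.cosh t * Real.cosh t - Real.sinh t * Real.sinh t = 1 := by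
  have := Real.cosh_sq_sub_sinh_sq t
  nlinarith

lemma exists_isUnitTangent {p q : HypSpace n} (h : p ≠ q) :
    ∃ v t, 0 < t ∧ IsUnitTangent p v ∧ IsExp p v t q := by
  have hm : 1 < -lorentz p.vec q.vec :=
    lt_of_not_ge fun h' => h (eq_of_neg_lorentz_le_one h')
  set m := -lorentz p.vec q.vec with hm'
  have ht := Real.arcosh_pos hm
  set t := Real.arcosh m
  have hc : Real.cosh t = m := Real.cosh_arcosh hm.le
  have hs : 0 < Real.sinh t := Real.sinh_pos_iff.2 ht
  have hcs := cosh_sq_sub_sinh_sq' t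
  refine ⟨(Real.sinh t)⁻¹ • (q.vec - m • p.vec), t, ht, ⟨?_, ?_⟩, ?_⟩
  · rw [lorentz_smul_right, lorentz_sub_right, lorentz_smul_right, lorentz_vec_self]
    rw [show lorentz p.vec q.vec = -m by rw [hm', neg_neg]]
    ring
  · rw [lorentz_smul_right, lorentz_smul_left, lorentz_sub_right, lorentz_sub_left,
      lorentz_sub_left, lorentz_smul_right, lorentz_smul_left, lorentz_smul_right,
      lorentz_smul_left, lorentz_comm q.vec p.vec, lorentz_vec_self, lorentz_vec_self,
      show lorentz p.vec q.vec = -m by rw [hm', neg_neg]]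
    rw [hc] at hcs
    field_simp
    nlinarith
  · rw [IsExp, smul_smul, mul_inv_cancel₀ hs.ne', one_smul, hc]
    abel

lemma lorentz_exp_self {p : HypSpace n} {v : Fin (n + 1) → ℝ} (hv : IsUnitTangent p v) (t : ℝ) :
    lorentz (Real.cosh t • p.vec + Real.sinh t • v) (Real.cosh t • p.vec + Real.sinh t • v) =
      -1 := by
  simp only [lorentz_add_left, lorentz_add_right, lorentz_smul_left, lorentz_smul_right,
    lorentz_comm v p.vec, hv.1, hv.2, lorentz_vec_self]
  have := cosh_sq_sub_sinh_sq' t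
  linarith

/-- A vector of norm `-1` has nonzero time coordinate, so along the curve this coordinate keeps the
sign that it has at time `0`. -/
lemma exp_zero_pos {p : HypSpace n} {v : Fin (n + 1) → ℝ} (hv : IsUnitTangent p v) (t : ℝ) :
    0 < (Real.cosh t • p.vec + Real.sinh t • v) 0 := by
  by_contra! hneg
  have hne : ∀ s, (Real.cosh s • p.vec + Real.sinh s • v) 0 ≠ 0 := by
    intro s h0
    have h1 := lorentz_exp_self hv s
    have : 0 ≤ lorentz (Real.cosh s • p.vec + Real.sinh s • v)
        (Real.cosh s • p.vec + Real.sinh s • v) := by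
      rw [lorentz, h0]
      simp only [mul_zero, neg_zero, zero_add]
      exact Finset.sum_nonneg fun i _ => mul_self_nonneg _
    linarith
  have hcont : Continuous fun s : ℝ => (Real.cosh s • p.vec + Real.sinh s • v) 0 := by
    simp only [Pi.add_apply, Pi.smul_apply]
    fun_prop
  obtain ⟨s, -, hs⟩ := intermediate_value_uIcc (a := t) (b := 0) hcont.continuousOn
    (show (0 : ℝ) ∈ _ from by
      rw [mem_uIcc]; left
      exact ⟨hneg, by simpa using p.vec_zero_pos.le⟩)
  exact hne s hs

/-- The exponential map. -/
def expMap (p : HypSpace n) (v : Fin (n + 1) → ℝ) (t : ℝ) : HypSpace n :=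
  normalize (Real.cosh t • p.vec + Real.sinh t • v)

lemma isExp_iff {p : HypSpace n} {v : Fin (n + 1) → ℝ} (hv : IsUnitTangent p v) {t : ℝ}
    {z : HypSpace n} : IsExp p v t z ↔ z = expMap p v t := by
  have h : (expMap p v t).vec = Real.cosh t • p.vec + Real.sinh t • v := by
    rw [expMap, normalize_vec ⟨by rw [lorentz_exp_self hv]; norm_num, exp_zero_pos hv t⟩,
      lorentz_exp_self hv]
    simp
  rw [IsExp, ← h]
  exact vec_injective.eq_iff

lemma expMap_vec {p : HypSpace n} {v : Fin (n + 1) → ℝ} (hv : IsUnitTangent p v) (t : ℝ) :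
    (expMap p v t).vec = Real.cosh t • p.vec + Real.sinh t • v :=
  (isExp_iff hv).2 rfl

lemma expMap_zero {p : HypSpace n} {v : Fin (n + 1) → ℝ} : expMap p v 0 = p := by
  simp [expMap, normalize_vec_self]

lemma continuous_expMap {p : HypSpace n} {v : Fin (n + 1) → ℝ} (hv : IsUnitTangent p v) :
    Continuous (expMap p v) := by
  rw [isEmbedding_vec.isInducing.continuous_iff]
  have : vec ∘ expMap p v = fun t => Real.cosh t • p.vec + Real.sinh t • v :=
    funext fun t => expMap_vec hv t
  rw [this]
  fun_prop

lemma expMap_injective {p : HypSpace n} {v : Fin (n + 1) → ℝ} (hv : IsUnitTangent p v) :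
    Function.Injective (expMap p v) := by
  intro s t h
  have h1 := congrArg (fun z => lorentz v z.vec) h
  simp only [expMap_vec hv, lorentz_add_right, lorentz_smul_right, lorentz_comm v p.vec, hv.1,
    hv.2, mul_zero, mul_one, zero_add] at h1
  exact Real.sinh_injective h1

/-- Positive combinations of two position vectors project radially onto the open geodesic segment
between the points. This is the bridge to linear convexity used everywhere below. -/
lemma geodConvex_iff {V : Set (HypSpace n)} :
    GeodConvex V ↔ ∀ x ∈ cone V, ∀ y ∈ cone V, x + y ∈ cone V := by
  constructor
  · intro h x hx y hy
    have hxy := add_mem_futureCone hx.1 hy.1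
    refine ⟨hxy, ?_⟩
    by_cases hne : normalize x = normalize y
    · have : x + y = (√(-lorentz x x) + √(-lorentz y y)) • (normalize x).vec := by
        conv_lhs => rw [← smul_normalize hx.1, ← smul_normalize hy.1, ← hne, ← add_smul]
      rw [this, normalize_smul_vec]
      · exact hx.2
      · exact add_pos (Real.sqrt_pos.2 (by linarith [hx.1.1]))
          (Real.sqrt_pos.2 (by linarith [hy.1.1]))
    obtain ⟨v, t, ht, hv, hq⟩ := exists_isUnitTangent hne
    obtain ⟨c, hc, hz⟩ := exists_normalize hxy
    set p := normalize x
    set q := normalize y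
    set z := normalize (x + y)
    set α := c * √(-lorentz x x)
    set β := c * √(-lorentz y y)
    have hα : 0 < α := mul_pos hc (Real.sqrt_pos.2 (by linarith [hx.1.1]))
    have hβ : 0 < β := mul_pos hc (Real.sqrt_pos.2 (by linarith [hy.1.1]))
    have hzv : z.vec = α • p.vec + β • q.vec := by
      rw [hz, mul_smul, mul_smul, smul_normalize hx.1, smul_normalize hy.1, smul_add]
    have hsinh := Real.sinh_pos_iff.2 ht
    rw [IsExp] at hq
    have hzv2 : z.vec = (α + β * Real.cosh t) • p.vec + (β * Real.sinh t) • v := by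
      rw [hzv, hq]; module
    have hz1 := lorentz_vec_self z
    rw [hzv2] at hz1
    simp only [lorentz_add_left, lorentz_add_right, lorentz_smul_left, lorentz_smul_right,
      lorentz_comm v p.vec, hv.1, hv.2, lorentz_vec_self] at hz1
    have hcosh := Real.one_le_cosh t
    have hcs := cosh_sq_sub_sinh_sq' t
    -- The unit norm of `z`, in terms of `α` and `β`; it forces `β ≤ 1`, so that the time `arsinh (β
    -- sinh t)` at which the geodesic passes through `z` is at most `t`.
    have hβ2 : α * α + 2 * (α * β) * Real.cosh t + β * β = 1 := by
      linear_combination -hz1 - β * β * hcs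
    have hβ1 : β ≤ 1 := by
      have : 0 < (α * β) * Real.cosh t := by positivity
      nlinarith [mul_pos hα hα]
    have hs1 : Real.sinh (Real.arsinh (β * Real.sinh t)) = β * Real.sinh t := Real.sinh_arsinh _
    have hs2 : Real.cosh (Real.arsinh (β * Real.sinh t)) = α + β * Real.cosh t := by
      have h1 := cosh_sq_sub_sinh_sq' (Real.arsinh (β * Real.sinh t))
      rw [hs1] at h1
      have h2 := Real.cosh_pos (Real.arsinh (β * Real.sinh t))
      have h3 : 0 < α + β * Real.cosh t := by positivity
      nlinarith
    refine h p hx.2 v hv t ht.le q hy.2 hq (Real.arsinh (β * Real.sinh t)) ⟨?_, ?_⟩ z ?_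
    · rw [Real.arsinh_nonneg_iff]; positivity
    · rw [← Real.sinh_le_sinh, hs1]
      nlinarith
    · rw [IsExp, hs1, hs2, hzv2]
  · intro h p hp v hv t ht q hq hpq s hs z hz
    rcases eq_or_lt_of_le hs.1 with h0 | h0
    · rw [← h0, isExp_iff hv, expMap_zero] at hz
      rwa [hz]
    rcases eq_or_lt_of_le hs.2 with h1 | h1
    · rw [h1, isExp_iff hv, ← (isExp_iff hv).1 hpq] at hz
      rwa [hz]
    have hst := Real.sinh_pos_iff.2 (h0.trans h1)
    -- Spherical interpolation in its hyperbolic form: both weights are positive because `0 < s <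
    -- t`.
    have hzv : Real.sinh t • z.vec = Real.sinh (t - s) • p.vec + Real.sinh s • q.vec := by
      rw [hz, hpq, Real.sinh_sub]
      module
    have := h _ (smul_vec_mem_cone hp (Real.sinh_pos_iff.2 (sub_pos.2 h1))) _
      (smul_vec_mem_cone hq (Real.sinh_pos_iff.2 h0))
    rw [← hzv, smul_mem_cone_iff hst] at this
    exact vec_mem_cone.1 this

lemma mem_closure_cone {V : Set (HypSpace n)} {x : Fin (n + 1) → ℝ} (hx : x ∈ futureCone n) :
    x ∈ closure (cone V) ↔ normalize x ∈ closure V := by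
  constructor
  · intro h
    rw [mem_closure_iff_frequently] at h ⊢
    intro h'
    have := (continuousAt_normalize hx).eventually h'
    exact h (this.mono fun y hy hy' => hy hy'.2)
  · intro h
    have hc : Continuous fun q : HypSpace n => √(-lorentz x x) • q.vec := by fun_prop
    have := map_mem_closure (t := cone V) hc h fun q hq =>
      smul_vec_mem_cone hq (Real.sqrt_pos.2 (by linarith [hx.1]))
    rwa [smul_normalize hx] at this

lemma vec_mem_closure_cone {V : Set (HypSpace n)} {q : HypSpace n} :
    q.vec ∈ closure (cone V) ↔ q ∈ closure V := by
  rw [mem_closure_cone q.vec_mem_futureCone, normalize_vec_self]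

/-- The error `x - z` made in approximating `x` by a point `z` of the cone is transferred to `y`,
around which the open cone has room. -/
lemma add_mem_cone_of_mem_closure {V : Set (HypSpace n)} (hV : IsOpen V) (hc : GeodConvex V)
    {x y : Fin (n + 1) → ℝ} (hx : x ∈ closure (cone V)) (hy : y ∈ cone V) : x + y ∈ cone V := by
  have ho : IsOpen {z | y + (x - z) ∈ cone V} :=
    (isOpen_cone hV).preimage (by fun_prop : Continuous fun z => y + (x - z))
  obtain ⟨z, hz, hz'⟩ := mem_closure_iff.1 hx _ ho (by simpa using hy)
  have := geodConvex_iff.1 hc z hz' _ hz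
  convert this using 1
  abel

lemma smul_mem_closure_cone {V : Set (HypSpace n)} {x : Fin (n + 1) → ℝ}
    (hx : x ∈ closure (cone V)) {c : ℝ} (hc : 0 < c) : c • x ∈ closure (cone V) :=
  map_mem_closure (by fun_prop : Continuous fun z : Fin (n + 1) → ℝ => c • z) hx
    fun _ hz => smul_mem_cone hz hc

lemma add_mem_closure_cone {V : Set (HypSpace n)} (hc : GeodConvex V)
    {x y : Fin (n + 1) → ℝ} (hx : x ∈ closure (cone V)) (hy : y ∈ closure (cone V)) :
    x + y ∈ closure (cone V) :=
  map_mem_closure₂ continuous_add hx hy fun a ha b hb => geodConvex_iff.1 hc a ha b hb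

end HypSpace

/-! ### Comparison of the hyperbolic distance with the distance of position vectors. -/

namespace HypSpace

variable {n : ℕ}

lemma cosh_hdist (p q : HypSpace n) : Real.cosh (hdist p q) = -lorentz p.vec q.vec :=
  Real.cosh_arcosh (one_le_neg_lorentz p q)

lemma hdist_nonneg (p q : HypSpace n) : 0 ≤ hdist p q := Real.arcosh_nonneg (one_le_neg_lorentz p q)

/-- Combines `1 + r ^ 2 / 2 ≤ cosh r` with the upper bound of `sum_sq_sub_le`; the factor `√n`
appears because `dist` is the sup distance. -/
lemma hdist_le_dist_vec (p q : HypSpace n) : hdist p q ≤ √n * dist p.vec q.vec := by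
  obtain ⟨-, -, h3⟩ := sum_sq_sub_le p q
  have h1 : 1 + hdist p q ^ 2 / 2 ≤ -lorentz p.vec q.vec := by
    rw [← cosh_hdist]
    have h1 := Real.cosh_sq (hdist p q / 2)
    have h2 := Real.cosh_two_mul (hdist p q / 2)
    rw [mul_div_cancel₀ _ two_ne_zero] at h2
    have := hdist_nonneg p q
    have h3 : hdist p q / 2 ≤ Real.sinh (hdist p q / 2) :=
      Real.self_le_sinh_iff.2 (by positivity)
    nlinarith
  have h2 : ∑ i : Fin n, (p.vec i.succ - q.vec i.succ) ^ 2 ≤ n * dist p.vec q.vec ^ 2 := by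
    calc _ ≤ ∑ i : Fin n, dist p.vec q.vec ^ 2 := by
          refine Finset.sum_le_sum fun i _ => ?_
          rw [← sq_abs]
          gcongr
          exact dist_le_pi_dist p.vec q.vec i.succ
      _ = _ := by simp
  refine le_of_sq_le_sq ?_ (by positivity)
  rw [mul_pow, Real.sq_sqrt (Nat.cast_nonneg n)]
  linarith

/-- For `r ≤ 1` one has `cosh r - 1 ≤ exp (r ^ 2 / 2) - 1 ≤ r ^ 2`; the factor `M` bounds the times
in `sum_sq_sub_le`. -/
lemma dist_vec_le {p q : HypSpace n} {M : ℝ} (hp : p.vec 0 ≤ M) (hq : q.vec 0 ≤ M)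
    (h : hdist p q ≤ 1) : dist p.vec q.vec ≤ 2 * M * hdist p q := by
  obtain ⟨h1, h2, -⟩ := sum_sq_sub_le p q
  have hp0 := p.vec_zero_pos
  have hq0 := q.vec_zero_pos
  have hd := hdist_nonneg p q
  have h4 : -lorentz p.vec q.vec - 1 ≤ hdist p q ^ 2 := by
    rw [← cosh_hdist]
    have h5 := Real.cosh_le_exp_half_sq (hdist p q)
    have h6 := Real.abs_exp_sub_one_le (x := hdist p q ^ 2 / 2) (by
      rw [abs_of_nonneg (by positivity)]; nlinarith)
    rw [abs_of_nonneg (a := hdist p q ^ 2 / 2) (by positivity)] at h6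
    linarith [le_abs_self (Real.exp (hdist p q ^ 2 / 2) - 1)]
  have h5 : ∑ i : Fin n, (p.vec i.succ - q.vec i.succ) ^ 2 ≤ (2 * M * hdist p q) ^ 2 := by
    have : p.vec 0 * q.vec 0 ≤ M * M := mul_le_mul hp hq hq0.le (hp0.le.trans hp)
    have h6 := one_le_neg_lorentz p q
    have h7 : 2 * (p.vec 0 * q.vec 0) * (-lorentz p.vec q.vec - 1) ≤
        2 * (M * M) * hdist p q ^ 2 := by
      apply mul_le_mul (by linarith) h4 (by linarith)
      nlinarith
    nlinarith [sq_nonneg (M * hdist p q)]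
  have hM : 0 ≤ 2 * M * hdist p q := by
    have : 0 < M := hp0.trans_le hp
    positivity
  refine (dist_pi_le_iff hM).2 fun i => ?_
  rw [Real.dist_eq]
  refine abs_le_of_sq_le_sq ?_ hM
  refine Fin.cases (h1.trans h5) (fun i => ?_) i
  exact (Finset.single_le_sum (f := fun i : Fin n => (p.vec i.succ - q.vec i.succ) ^ 2)
    (fun i _ => sq_nonneg _) (Finset.mem_univ i)).trans h5

/-- The hyperbolic distance is locally bi-Lipschitz to the distance of the position vectors. -/
lemma exists_hdist_bounds (p : HypSpace n) : ∃ C : ℝ, 0 < C ∧ ∃ N ∈ 𝓝 p, ∀ q ∈ N, ∀ r ∈ N,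
    hdist q r ≤ C * dist q.vec r.vec ∧ dist q.vec r.vec ≤ C * hdist q r := by
  have h1 : ∀ᶠ q : HypSpace n in 𝓝 p, q.vec 0 < p.vec 0 + 1 :=
    ((by fun_prop : Continuous fun q : HypSpace n => q.vec 0).tendsto p).eventually_lt_const
      (by linarith)
  -- The radius makes any two points of the neighbourhood be at hyperbolic distance at most `1`, as
  -- `dist_vec_le` requires.
  have h2 : ∀ᶠ q : HypSpace n in 𝓝 p, dist q.vec p.vec < 1 / (2 * (√n + 1)) :=
    ((by fun_prop : Continuous fun q : HypSpace n => dist q.vec p.vec).tendsto p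
      ).eventually_lt_const (by simp only [dist_self]; positivity)
  have hp := p.vec_zero_pos
  have hn := Real.sqrt_nonneg n
  refine ⟨√n + 2 * (p.vec 0 + 1), by positivity, _, h1.and h2, fun q hq r hr => ⟨?_, ?_⟩⟩
  · refine (hdist_le_dist_vec q r).trans ?_
    gcongr
    linarith
  · have h3 : hdist q r ≤ 1 := by
      refine (hdist_le_dist_vec q r).trans ?_
      have h4 : dist q.vec r.vec ≤ 1 / (√n + 1) := by
        refine (dist_triangle_right q.vec r.vec p.vec).trans ((add_le_add hq.2.le hr.2.le).trans ?_)
        apply le_of_eq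
        field_simp
        norm_num
      calc √n * dist q.vec r.vec ≤ √n * (1 / (√n + 1)) := by gcongr
        _ ≤ 1 := by rw [mul_one_div, div_le_one (by positivity)]; linarith
    refine (dist_vec_le hq.1.le hr.1.le h3).trans ?_
    have := hdist_nonneg q r
    gcongr
    linarith

/-! ### Oriented isometries -/

namespace IsOrientedIsometry

variable {g h : HypSpace n → HypSpace n}

lemma lorentz_map (hg : IsOrientedIsometry g) (p q : HypSpace n) :
    lorentz (g p).vec (g q).vec = lorentz p.vec q.vec := by
  obtain ⟨A, hA, -, hgA⟩ := hg
  rw [hgA, hgA, hA]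

lemma hdist_map (hg : IsOrientedIsometry g) (p q : HypSpace n) :
    hdist (g p) (g q) = hdist p q := by
  rw [hdist, hg.lorentz_map, hdist]

lemma continuous (hg : IsOrientedIsometry g) : Continuous g := by
  obtain ⟨A, -, -, hgA⟩ := hg
  rw [isEmbedding_vec.isInducing.continuous_iff, show vec ∘ g = fun p => A.mulVec p.vec from
    funext hgA]
  fun_prop

protected lemma id : IsOrientedIsometry (id : HypSpace n → HypSpace n) :=
  ⟨1, by simp, by simp, by simp⟩

lemma comp (hg : IsOrientedIsometry g) (hh : IsOrientedIsometry h) :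
    IsOrientedIsometry (g ∘ h) := by
  obtain ⟨A, hA, hA1, hgA⟩ := hg
  obtain ⟨B, hB, hB1, hhB⟩ := hh
  refine ⟨A * B, fun x y => ?_, by rw [Matrix.det_mul, hA1, hB1, one_mul], fun p => ?_⟩
  · rw [← Matrix.mulVec_mulVec, ← Matrix.mulVec_mulVec, hA, hB]
  · rw [← Matrix.mulVec_mulVec, ← hhB, ← hgA, Function.comp_apply]

lemma exists_inverse (hg : IsOrientedIsometry g) :
    ∃ h, IsOrientedIsometry h ∧ Function.LeftInverse h g ∧ Function.RightInverse h g := by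
  obtain ⟨A, hA, hA1, hgA⟩ := hg
  have hu : IsUnit A.det := by rw [hA1]; exact isUnit_one
  have h1 : ∀ x, A.mulVec (A⁻¹.mulVec x) = x := fun x => by
    rw [Matrix.mulVec_mulVec, Matrix.mul_nonsing_inv _ hu, Matrix.one_mulVec]
  have h2 : ∀ x, A⁻¹.mulVec (A.mulVec x) = x := fun x => by
    rw [Matrix.mulVec_mulVec, Matrix.nonsing_inv_mul _ hu, Matrix.one_mulVec]
  have h3 : ∀ x y, lorentz (A⁻¹.mulVec x) (A⁻¹.mulVec y) = lorentz x y := fun x y => by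
    rw [← hA, h1, h1]
  -- If the inverse matrix sent `p` to the lower sheet, the opposite vector would be a point of the
  -- upper sheet sent by `g` to `-p`, which is impossible.
  have h4 : ∀ p : HypSpace n, 0 < (A⁻¹.mulVec p.vec) 0 := by
    intro p
    have hl : lorentz (A⁻¹.mulVec p.vec) (A⁻¹.mulVec p.vec) = -1 := by
      rw [h3, lorentz_vec_self]
    by_contra! hneg
    have hne : (A⁻¹.mulVec p.vec) 0 ≠ 0 := by
      intro h0
      rw [lorentz, h0] at hl
      have : 0 ≤ ∑ i : Fin n, (A⁻¹.mulVec p.vec) i.succ * (A⁻¹.mulVec p.vec) i.succ :=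
        Finset.sum_nonneg fun i _ => mul_self_nonneg _
      linarith
    have hq := hgA (ofVec (-(A⁻¹.mulVec p.vec))
      (by rw [← neg_one_smul ℝ, lorentz_smul_left, lorentz_smul_right, hl]; norm_num)
      (by simpa using lt_of_le_of_ne hneg hne))
    rw [ofVec_vec, Matrix.mulVec_neg, h1] at hq
    have := vec_zero_pos (g (ofVec (-(A⁻¹.mulVec p.vec))
      (by rw [← neg_one_smul ℝ, lorentz_smul_left, lorentz_smul_right, hl]; norm_num)
      (by simpa using lt_of_le_of_ne hneg hne)))
    rw [hq, Pi.neg_apply] at this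
    linarith [p.vec_zero_pos]
  refine ⟨fun p => ofVec (A⁻¹.mulVec p.vec) (by rw [h3, lorentz_vec_self]) (h4 p),
    ⟨A⁻¹, h3, by rw [Matrix.det_nonsing_inv, hA1, Ring.inverse_one], fun p => rfl⟩,
    fun p => ?_, fun p => ?_⟩
  · apply vec_injective
    rw [ofVec_vec, hgA, h2]
  · apply vec_injective
    rw [hgA, ofVec_vec, h1]

lemma injective (hg : IsOrientedIsometry g) : Function.Injective g := by
  obtain ⟨h, -, hl, -⟩ := hg.exists_inverse
  exact hl.injective

lemma geodConvex_preimage (hg : IsOrientedIsometry g) {V : Set (HypSpace n)}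
    (hV : GeodConvex V) : GeodConvex (g ⁻¹' V) := by
  obtain ⟨A, hA, hA1, hgA⟩ := hg
  intro p hp v hv t ht q hq hpq s hs z hz
  refine hV (g p) hp (A.mulVec v) ⟨?_, ?_⟩ t ht (g q) hq ?_ s hs (g z) ?_
  · rw [hgA, hA, hv.1]
  · rw [hA, hv.2]
  · rw [IsExp, hgA, hgA, hpq, Matrix.mulVec_add, Matrix.mulVec_smul, Matrix.mulVec_smul]
  · rw [IsExp, hgA, hgA, hz, Matrix.mulVec_add, Matrix.mulVec_smul, Matrix.mulVec_smul]

lemma isExp_map (hg : IsOrientedIsometry g) {p : HypSpace n} {v : Fin (n + 1) → ℝ}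
    (hv : IsUnitTangent p v) : ∃ w, IsUnitTangent (g p) w ∧
      ∀ t, g (expMap p v t) = expMap (g p) w t := by
  obtain ⟨A, hA, hA1, hgA⟩ := hg
  have hw : IsUnitTangent (g p) (A.mulVec v) := ⟨by rw [hgA, hA, hv.1], by rw [hA, hv.2]⟩
  refine ⟨A.mulVec v, hw, fun t => ?_⟩
  rw [← isExp_iff hw, IsExp, hgA, hgA, expMap_vec hv, Matrix.mulVec_add, Matrix.mulVec_smul,
    Matrix.mulVec_smul]

end IsOrientedIsometry

/-! ### Projection to a convex set -/

lemma isClosedEmbedding_vec : IsClosedEmbedding (vec : HypSpace n → Fin (n + 1) → ℝ) := by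
  refine ⟨isEmbedding_vec, ?_⟩
  have : range (vec : HypSpace n → Fin (n + 1) → ℝ) = {x | lorentz x x = -1 ∧ 0 ≤ x 0} := by
    ext x
    constructor
    · rintro ⟨p, rfl⟩
      exact ⟨p.lorentz_vec_self, p.vec_zero_pos.le⟩
    · rintro ⟨h, h0⟩
      refine ⟨ofVec x h (lt_of_le_of_ne h0 fun h1 => ?_), rfl⟩
      rw [lorentz, ← h1] at h
      have : 0 ≤ ∑ i : Fin n, x i.succ * x i.succ :=
        Finset.sum_nonneg fun i _ => mul_self_nonneg _
      linarith
  rw [this]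
  exact (isClosed_eq (f := fun x => lorentz x x) (by fun_prop) continuous_const).inter
    (isClosed_le (g := fun x : Fin (n + 1) → ℝ => x 0) continuous_const (by fun_prop))

instance : LocallyCompactSpace (HypSpace n) := isClosedEmbedding_vec.locallyCompactSpace

lemma isCompact_setOf_le (z : HypSpace n) (C : ℝ) :
    IsCompact {q : HypSpace n | -lorentz z.vec q.vec ≤ C} := by
  have hc : IsClosed {q : HypSpace n | -lorentz z.vec q.vec ≤ C} :=
    isClosed_le (by fun_prop) continuous_const
  refine (isClosedEmbedding_vec.isCompact_preimage
    (isCompact_closedBall (0 : Fin (n + 1) → ℝ) (2 * z.vec 0 * C))).of_isClosed_subset hc ?_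
  intro q (hq : -lorentz z.vec q.vec ≤ C)
  obtain ⟨h1, h2, -⟩ := sum_sq_sub_le z q
  have hz0 := z.vec_zero_pos
  have hq0 := q.vec_zero_pos
  have h3 : q.vec 0 ≤ 2 * z.vec 0 * C := by
    have : 2 * (z.vec 0 * q.vec 0) * (-lorentz z.vec q.vec - 1) ≤
      2 * (z.vec 0 * q.vec 0) * (C - 1) := by gcongr
    by_contra! h4
    nlinarith
  rw [mem_preimage, mem_closedBall_zero_iff, pi_norm_le_iff_of_nonneg (hq0.le.trans h3)]
  intro i
  refine le_trans ?_ h3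
  rw [Real.norm_eq_abs]
  refine abs_le_of_sq_le_sq ?_ hq0.le
  refine Fin.cases le_rfl (fun i => ?_) i
  have h4 := q.lorentz_vec_self
  have h5 := Finset.single_le_sum (f := fun i : Fin n => q.vec i.succ * q.vec i.succ)
    (fun i _ => mul_self_nonneg _) (Finset.mem_univ i)
  rw [lorentz] at h4
  nlinarith

/-- `p` is the orthogonal projection of `z` to the closure of the convex set `V`. -/
def IsProj (V : Set (HypSpace n)) (p z : HypSpace n) : Prop :=
  p ∈ closure V ∧ ∀ q ∈ V, lorentz z.vec p.vec * lorentz p.vec q.vec ≤ -lorentz z.vec q.vec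

lemma isProj_self {V : Set (HypSpace n)} {p : HypSpace n} (hp : p ∈ closure V) : IsProj V p p :=
  ⟨hp, fun q _ => by rw [lorentz_vec_self]; linarith⟩

variable {V : Set (HypSpace n)} {p q z : HypSpace n}

lemma IsProj.le (h : IsProj V p z) {x : Fin (n + 1) → ℝ} (hx : x ∈ closure (cone V)) :
    lorentz z.vec p.vec * lorentz p.vec x ≤ -lorentz z.vec x := by
  have hc : IsClosed {x | lorentz z.vec p.vec * lorentz p.vec x ≤ -lorentz z.vec x} :=
    isClosed_le (by fun_prop) (by fun_prop)
  refine closure_minimal (fun x hx => ?_) hc hx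
  obtain ⟨c, hc, hn⟩ := exists_normalize hx.1
  have := h.2 _ hx.2
  rw [hn, lorentz_smul_right, lorentz_smul_right] at this
  change lorentz z.vec p.vec * lorentz p.vec x ≤ -lorentz z.vec x
  nlinarith

/-- The inequality in `IsProj` reads `cosh d(z, p) cosh d(p, q) ≤ cosh d(z, q)`, that is, the
triangle is obtuse at `p`. Applied to both projections, it leaves no room for `cosh d(p, q) > 1`. -/
lemma IsProj.unique (hp : IsProj V p z) (hq : IsProj V q z) : p = q := by
  have h1 := hp.le (vec_mem_closure_cone.2 hq.1)
  have h2 := hq.le (vec_mem_closure_cone.2 hp.1)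
  rw [lorentz_comm q.vec] at h2
  have h3 := one_le_neg_lorentz z p
  have h4 := one_le_neg_lorentz z q
  apply eq_of_neg_lorentz_le_one
  have h5 := one_le_neg_lorentz p q
  nlinarith

/-- The projection minimizes the distance to `z` over the closure of `V`, which is attained since
balls are compact. The obtuse angle is the first variation in the direction of `q`. -/
lemma exists_isProj (hc : GeodConvex V) (hV : V.Nonempty) (z : HypSpace n) :
    ∃ p, IsProj V p z := by
  obtain ⟨q₀, hq₀⟩ := hV
  have hcont : Continuous fun q : HypSpace n => -lorentz z.vec q.vec := by fun_prop
  obtain ⟨p, ⟨hp1, hp2⟩, hpmin⟩ := ((isCompact_setOf_le z (-lorentz z.vec q₀.vec)).inter_left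
    (isClosed_closure (s := V))).exists_isMinOn
      ⟨q₀, subset_closure hq₀, le_refl (-lorentz z.vec q₀.vec)⟩
    hcont.continuousOn
  have hmin : ∀ q ∈ closure V, -lorentz z.vec p.vec ≤ -lorentz z.vec q.vec := by
    intro q hq
    by_cases h : -lorentz z.vec q.vec ≤ -lorentz z.vec q₀.vec
    · exact hpmin ⟨hq, h⟩
    · exact le_trans hp2 (not_le.1 h).le
  refine ⟨p, hp1, fun q hq => ?_⟩
  have ha := one_le_neg_lorentz z p
  have hb := one_le_neg_lorentz z q
  have hm := one_le_neg_lorentz p q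
  set a := -lorentz z.vec p.vec with ha'
  set b := -lorentz z.vec q.vec with hb'
  set m := -lorentz p.vec q.vec with hm'
  -- Minimality against the radial projection of `p + s q`, squared.
  have key : ∀ s : ℝ, 0 < s → a ^ 2 * (1 + 2 * s * m + s ^ 2) ≤ (a + s * b) ^ 2 := by
    intro s hs
    have hw : p.vec + s • q.vec ∈ closure (cone V) :=
      add_mem_closure_cone hc (vec_mem_closure_cone.2 hp1)
        (subset_closure (smul_vec_mem_cone hq hs))
    have hT : p.vec + s • q.vec ∈ futureCone n :=
      add_mem_futureCone p.vec_mem_futureCone (smul_mem_futureCone q.vec_mem_futureCone hs)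
    have h1 := hmin _ ((mem_closure_cone hT).1 hw)
    have h2 : -lorentz (p.vec + s • q.vec) (p.vec + s • q.vec) = 1 + 2 * s * m + s ^ 2 := by
      simp only [lorentz_add_left, lorentz_add_right, lorentz_smul_left, lorentz_smul_right,
        lorentz_vec_self, lorentz_comm q.vec p.vec, hm']
      ring
    have h3 : -lorentz z.vec (p.vec + s • q.vec) = a + s * b := by
      simp only [lorentz_add_right, lorentz_smul_right, ha', hb']
      ring
    have hpos : 0 < 1 + 2 * s * m + s ^ 2 := by positivity
    rw [normalize_vec hT, lorentz_smul_right, h2, ← mul_neg, h3] at h1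
    have h4 := Real.sqrt_pos.2 hpos
    have h5 : a * √(1 + 2 * s * m + s ^ 2) ≤ a + s * b := by
      rw [inv_mul_eq_div, le_div_iff₀ h4] at h1
      exact h1
    calc a ^ 2 * (1 + 2 * s * m + s ^ 2) = (a * √(1 + 2 * s * m + s ^ 2)) ^ 2 := by
          rw [mul_pow, Real.sq_sqrt hpos.le]
      _ ≤ _ := by gcongr
  have : lorentz z.vec p.vec * lorentz p.vec q.vec = a * m := by rw [ha', hm']; ring
  rw [this]
  by_contra! hlt
  have hd : 0 < a * (a * m - b) := mul_pos (by linarith) (by linarith)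
  -- `key` says `2 * s * a * (a * m - b) ≤ s ^ 2 * (b ^ 2 - a ^ 2)`. For this `s` the left side is
  -- `2 * s ^ 2 * (b ^ 2 + 1)`, which is too large.
  have hs : 0 < a * (a * m - b) / (b ^ 2 + 1) := by positivity
  have h1 := key _ hs
  set s := a * (a * m - b) / (b ^ 2 + 1) with hs'
  have h2 : s * (b ^ 2 + 1) = a * (a * m - b) := by rw [hs']; field_simp
  have h3 : s * (2 * (a * (a * m - b))) ≤ s * (s * b ^ 2 - s * a ^ 2) := by nlinarith
  have h4 := le_of_mul_le_mul_left h3 hs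
  nlinarith [mul_pos hs hs]

/-- From a point `p` of the open set `V` one could still move towards `z`; the inequality at `p + s
z` then forces `cosh d(z, p) ≤ 1`, hence `z = p`. -/
lemma IsProj.notMem (hV : IsOpen V) (hz : z ∉ V) (h : IsProj V p z) : p ∉ V := by
  intro hp
  have ho : IsOpen {s : ℝ | p.vec + s • z.vec ∈ cone V} :=
    (isOpen_cone hV).preimage (by fun_prop : Continuous fun s : ℝ => p.vec + s • z.vec)
  have h0 : {s : ℝ | p.vec + s • z.vec ∈ cone V} ∈ 𝓝 (0 : ℝ) :=
    ho.mem_nhds (by simpa using hp)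
  obtain ⟨s, hs, hs0⟩ : ∃ s : ℝ, p.vec + s • z.vec ∈ cone V ∧ 0 < s :=
    (Filter.Eventually.and (mem_nhdsWithin_of_mem_nhds h0)
      (self_mem_nhdsWithin : Ioi (0 : ℝ) ∈ 𝓝[>] 0)).exists
  have h1 := h.le (subset_closure hs)
  simp only [lorentz_add_right, lorentz_smul_right, lorentz_vec_self, lorentz_comm p.vec z.vec]
    at h1
  have h2 : z = p := eq_of_neg_lorentz_le_one (by
    have := one_le_neg_lorentz z p
    by_contra! h3
    have h4 : s * (lorentz z.vec p.vec * lorentz z.vec p.vec) ≤ s * 1 := by linarith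
    have h5 := le_of_mul_le_mul_left h4 hs0
    nlinarith)
  exact hz (h2 ▸ hp)

lemma IsProj.mem_frontier (hV : IsOpen V) (hz : z ∉ V) (h : IsProj V p z) : p ∈ frontier V := by
  rw [hV.frontier_eq]
  exact ⟨h.1, h.notMem hV hz⟩

/-! ### Developments and normal rays. -/

/-- The points outside of `V` which project into `G`. -/
def development (V G : Set (HypSpace n)) : Set (HypSpace n) :=
  {z | z ∉ V ∧ ∃ p ∈ G, IsProj V p z}

lemma self_mem_development {G : Set (HypSpace n)} (hV : IsOpen V) (hp : p ∈ G ∩ frontier V) :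
    p ∈ development V G := by
  rw [hV.frontier_eq] at hp
  exact ⟨hp.2.2, p, hp.1, isProj_self hp.2.1⟩

lemma mem_of_mem_development {G : Set (HypSpace n)} (hp : p ∈ development V G)
    (hc : p ∈ closure V) : p ∈ G := by
  obtain ⟨q, hq, hq'⟩ := hp.2
  rwa [(isProj_self hc).unique hq']

/-- A neighbourhood basis of hyperbolic balls. -/
lemma exists_ball_subset {G : Set (HypSpace n)} (hG : G ∈ 𝓝 p) :
    ∃ δ : ℝ, 1 < δ ∧ ∀ q, -lorentz p.vec q.vec < δ → q ∈ G := by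
  obtain ⟨U, hU, hUG⟩ := (isEmbedding_vec.isInducing.nhds_eq_comap p ▸ hG :
    G ∈ comap vec (𝓝 p.vec))
  obtain ⟨ε, hε, hball⟩ := Metric.mem_nhds_iff.1 hU

  have hp := p.vec_zero_pos
  -- The bound `1` gives `cosh d(p, q) ≤ 2`, hence a time of `q` at most `4` times that of `p`; then
  -- `dist_vec_le` with this bound gives a distance smaller than `ε`.
  refine ⟨Real.cosh (min 1 (ε / (8 * (p.vec 0 * 4)))), ?_, fun q hq => ?_⟩
  · rw [Real.one_lt_cosh]
    exact (lt_min one_pos (by positivity)).ne'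
  · have hq1 : hdist p q < min 1 (ε / (8 * (p.vec 0 * 4))) := by
      rw [← cosh_hdist, Real.cosh_lt_cosh, abs_of_nonneg (hdist_nonneg p q), abs_of_nonneg
        (le_min zero_le_one (by positivity))] at hq
      exact hq
    have h1 : hdist p q < 1 := hq1.trans_le (min_le_left _ _)
    have h2 : hdist p q < ε / (8 * (p.vec 0 * 4)) := hq1.trans_le (min_le_right _ _)
    obtain ⟨h3, h4, -⟩ := sum_sq_sub_le p q
    have hq0 := q.vec_zero_pos
    have h5 : -lorentz p.vec q.vec ≤ 2 := by
      rw [← cosh_hdist]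
      have h6 : Real.cosh (hdist p q) ≤ Real.cosh 1 := by
        rw [Real.cosh_le_cosh, abs_of_nonneg (hdist_nonneg p q), abs_one]
        exact h1.le
      have := Real.cosh_le_exp_half_sq 1
      have h7 : Real.exp (1 ^ 2 / 2) ≤ 2 := by
        have h8 := Real.abs_exp_sub_one_le (x := 1 ^ 2 / 2) (by norm_num [abs_of_pos])
        have h9 := le_abs_self (Real.exp (1 ^ 2 / 2) - 1)
        norm_num [abs_of_pos] at h8 h9 ⊢
        linarith
      linarith
    have h6 : q.vec 0 ≤ p.vec 0 * 4 := by
      by_contra! h7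
      have h8 : (p.vec 0 * q.vec 0) * (-lorentz p.vec q.vec - 1) ≤ (p.vec 0 * q.vec 0) * 1 :=
        mul_le_mul_of_nonneg_left (by linarith) (by positivity)
      nlinarith
    have h7 := dist_vec_le (M := p.vec 0 * 4) (by linarith) h6 h1.le
    apply hUG
    apply hball
    rw [Metric.mem_ball, dist_comm]
    refine h7.trans_lt ?_
    have h8 := (lt_div_iff₀ (by positivity)).1 h2
    have := hdist_nonneg p q
    nlinarith

/-- Developments are relatively open in the complement of `V`. -/
lemma eventually_mem_development {G : Set (HypSpace n)} (hc : GeodConvex V)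
    (hG : IsOpen G) (hz : z ∈ development V G) : ∀ᶠ y in 𝓝 z, y ∉ V → y ∈ development V G := by
  obtain ⟨hzV, p, hpG, hp⟩ := hz
  obtain ⟨δ, hδ, hball⟩ := exists_ball_subset (hG.mem_nhds hpG)
  have hne : V.Nonempty := closure_nonempty_iff.1 ⟨p, hp.1⟩
  set a := -lorentz z.vec p.vec with ha'
  have ha : 1 ≤ a := one_le_neg_lorentz z p
  have hlim : Tendsto (fun η : ℝ => (1 + η) ^ 2) (𝓝[>] 0) (𝓝 1) := by
    have : Continuous fun η : ℝ => (1 + η) ^ 2 := by fun_prop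
    have h := this.tendsto 0
    simp only [add_zero, one_pow] at h
    exact h.mono_left nhdsWithin_le_nhds
  obtain ⟨η, hη1, hη0⟩ := ((hlim.eventually_lt_const hδ).and self_mem_nhdsWithin).exists
  -- Pairing with a point `q` gives `cosh d(z, q) < (1 + η) cosh d(y, q)` for all `q` at once.
  -- Uniformity matters, since `q` will be the projection of `y`.
  have h1 : ∀ᶠ y : HypSpace n in 𝓝 z, (1 + η) • y.vec - z.vec ∈ futureCone n := by
    have hcont : Continuous fun y : HypSpace n => (1 + η) • y.vec - z.vec := by fun_prop
    refine hcont.tendsto z |>.eventually (isOpen_futureCone.mem_nhds ?_)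
    convert smul_mem_futureCone z.vec_mem_futureCone hη0 using 1
    module
  have h2 : ∀ᶠ y : HypSpace n in 𝓝 z, -lorentz y.vec p.vec < (1 + η) * a := by
    have hcont : Continuous fun y : HypSpace n => -lorentz y.vec p.vec := by fun_prop
    exact (hcont.tendsto z).eventually_lt_const (by rw [← ha']; nlinarith)
  filter_upwards [h1, h2] with y hy1 hy2 hyV
  obtain ⟨q, hq⟩ := exists_isProj hc hne y
  refine ⟨hyV, q, hball q ?_, hq⟩
  have h3 := hq.le (vec_mem_closure_cone.2 hp.1)
  have h4 := hp.le (vec_mem_closure_cone.2 hq.1)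
  have h5 := lorentz_neg_of_mem_futureCone hy1 q.vec_mem_futureCone
  rw [lorentz_sub_left, lorentz_smul_left] at h5
  rw [lorentz_comm q.vec] at h3
  have h6 := one_le_neg_lorentz y q
  have h7 := one_le_neg_lorentz p q
  set m := -lorentz p.vec q.vec with hm'
  set b := -lorentz y.vec q.vec with hb'
  have e1 : b * m ≤ (1 + η) * a := by
    have : lorentz y.vec q.vec * lorentz p.vec q.vec = b * m := by rw [hb', hm']; ring
    linarith
  have e2 : a * m ≤ (1 + η) * b := by
    have : lorentz z.vec p.vec * lorentz p.vec q.vec = a * m := by rw [ha', hm']; ring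
    have : (1 + η) * b = -((1 + η) * lorentz y.vec q.vec) := by rw [hb']; ring
    linarith
  -- The product of the two projection inequalities: the distances to `z` and `y` cancel, and `m =
  -- cosh d(p, q)` is at most `1 + η`, so `q` is in the ball contained in `G`.
  have e3 : (a * b) * m ^ 2 ≤ (a * b) * (1 + η) ^ 2 := by
    have := mul_le_mul e1 e2 (by positivity) (by positivity)
    nlinarith
  have e4 := le_of_mul_le_mul_left e3 (by positivity)
  nlinarith

lemma mem_interior_development {G : Set (HypSpace n)} (hc : GeodConvex V)
    (hG : IsOpen G) (hz : z ∈ development V G) :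
    z ∈ interior (development V G) ↔ z ∉ closure V := by
  constructor
  · intro h hcl
    obtain ⟨y, hy, hyV⟩ := mem_closure_iff.1 hcl _ isOpen_interior h
    exact (interior_subset hy).1 hyV
  · intro h
    rw [mem_interior_iff_mem_nhds]
    filter_upwards [eventually_mem_development hc hG hz,
      isClosed_closure.isOpen_compl.mem_nhds h] with y hy hy'
    exact hy fun hyV => hy' (subset_closure hyV)

/-- Every boundary point of an open convex set has a normal vector. -/
lemma exists_normal (hV : IsOpen V) (hc : GeodConvex V) (hp : p ∈ frontier V) :
    ∃ v, IsUnitTangent p v ∧ ∀ q ∈ V, lorentz v q.vec ≤ 0 := by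
  rw [hV.frontier_eq] at hp
  have hconv : Convex ℝ (cone V) := by
    refine convex_iff_forall_pos.2 fun x hx y hy a b ha hb _ => ?_
    exact geodConvex_iff.1 hc _ (smul_mem_cone hx ha) _ (smul_mem_cone hy hb)
  have hpc : p.vec ∉ cone V := fun h => hp.2 (vec_mem_cone.1 h)
  -- The separating form is homogenized: scaling in the cone gives `f ≤ 0` there, and `p`, being a
  -- limit of the cone, gets `f p = 0`.
  obtain ⟨f, hf⟩ := geometric_hahn_banach_open_point hconv (isOpen_cone hV) hpc
  obtain ⟨o, ho⟩ := closure_nonempty_iff.1 ⟨p, hp.1⟩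
  have hps : ∀ s : ℝ, 0 < s → p.vec + s • o.vec ∈ cone V := fun s hs =>
    add_mem_cone_of_mem_closure hV hc (vec_mem_closure_cone.2 hp.1) (smul_vec_mem_cone ho hs)
  have hf0 : ∀ x ∈ cone V, f x ≤ 0 := by
    intro x hx
    by_contra! hpos
    have hc0 : 0 < (|f p.vec| + 1) / f x := by positivity
    have := hf _ (smul_mem_cone hx hc0)
    rw [map_smul, smul_eq_mul, div_mul_cancel₀ _ hpos.ne'] at this
    linarith [le_abs_self (f p.vec)]
  have hfo : f o.vec < 0 := by
    have := hf _ (hps 1 one_pos)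
    rw [one_smul, map_add] at this
    linarith
  have hfp : f p.vec = 0 := by
    apply le_antisymm
    · by_contra! hpos
      have hs : 0 < f p.vec / (-4 * f o.vec) := div_pos hpos (by linarith)
      have := hf0 _ (hps _ hs)
      rw [map_add, map_smul, smul_eq_mul] at this
      have h2 : f p.vec / (-4 * f o.vec) * f o.vec = - (f p.vec / 4) := by
        have := hfo.ne
        field_simp
      linarith
    · by_contra! hneg
      have hs : 0 < f p.vec / (2 * f o.vec) :=
        div_pos_of_neg_of_neg hneg (by linarith)
      have h1 := hf _ (smul_vec_mem_cone ho hs)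
      rw [map_smul, smul_eq_mul] at h1
      have h2 : f p.vec / (2 * f o.vec) * f o.vec = f p.vec / 2 := by
        have := hfo.ne
        field_simp
      linarith
  let w : Fin (n + 1) → ℝ := Fin.cons (-f (Pi.single 0 1)) fun i => f (Pi.single i.succ 1)
  have hw : ∀ x, lorentz w x = f x := by
    intro x
    conv_rhs => rw [pi_eq_sum_univ' x]
    rw [map_sum, Fin.sum_univ_succ]
    simp only [map_smul, smul_eq_mul, lorentz, w, Fin.cons_zero, Fin.cons_succ, neg_mul, neg_neg]
    congr 1
    · rw [mul_comm]
    · exact Finset.sum_congr rfl fun i _ => mul_comm _ _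
  have hwp : lorentz w p.vec = 0 := by rw [hw, hfp]
  -- The vector `w` representing `f` is nonzero and orthogonal to the timelike vector `p`, hence
  -- spacelike, and can be normalized.
  have hww : 0 < lorentz w w := by
    have cs := Finset.sum_mul_sq_le_sq_mul_sq Finset.univ (fun i : Fin n => w i.succ)
      (fun i => p.vec i.succ)
    have hpp := p.lorentz_vec_self
    have hwo : w ≠ 0 := by
      intro h0
      have := hw o.vec
      rw [h0, ← zero_smul ℝ (0 : Fin (n + 1) → ℝ), lorentz_smul_left, zero_mul] at this
      linarith
    simp only [lorentz, ← sq] at *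
    set Q := ∑ i : Fin n, w i.succ ^ 2 with hQ
    set P := ∑ i : Fin n, p.vec i.succ ^ 2
    have hQ0 : 0 ≤ Q := Finset.sum_nonneg fun i _ => sq_nonneg _
    have hp0 := p.vec_zero_pos
    have hQpos : 0 < Q := by
      refine lt_of_le_of_ne hQ0 fun h => hwo ?_
      have h1 := (Finset.sum_eq_zero_iff_of_nonneg fun i _ => sq_nonneg _).1 (hQ ▸ h.symm)
      have h2 : ∑ i : Fin n, w i.succ * p.vec i.succ = 0 :=
        Finset.sum_eq_zero fun i _ => by
          rw [pow_eq_zero_iff two_ne_zero |>.1 (h1 i (Finset.mem_univ _)), zero_mul]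
      rw [h2] at hwp
      funext i
      refine Fin.cases ?_ (fun i => ?_) i
      · have : w 0 * p.vec 0 = 0 := by linarith
        exact (mul_eq_zero.1 this).resolve_right hp0.ne'
      · exact pow_eq_zero_iff two_ne_zero |>.1 (h1 i (Finset.mem_univ _))
    have e1 : ∑ i : Fin n, w i.succ * p.vec i.succ = w 0 * p.vec 0 := by linarith
    rw [e1, mul_pow] at cs
    have e2 : P = p.vec 0 ^ 2 - 1 := by linarith
    rw [e2] at cs
    by_contra! hle
    nlinarith [sq_nonneg (p.vec 0)]
  have hsq := Real.sqrt_pos.2 hww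
  refine ⟨(√(lorentz w w))⁻¹ • w, ⟨?_, ?_⟩, fun q hq => ?_⟩
  · rw [lorentz_comm, lorentz_smul_left, hwp, mul_zero]
  · rw [lorentz_smul_left, lorentz_smul_right, ← mul_assoc, ← mul_inv,
      Real.mul_self_sqrt hww.le, inv_mul_cancel₀ hww.ne']
  · rw [lorentz_smul_left, hw q.vec]
    exact mul_nonpos_of_nonneg_of_nonpos (inv_nonneg.2 hsq.le) (hf0 _ (vec_mem_cone.2 hq))

lemma isProj_expMap {v : Fin (n + 1) → ℝ} (hp : p ∈ closure V) (hv : IsUnitTangent p v)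
    (hn : ∀ q ∈ V, lorentz v q.vec ≤ 0) {t : ℝ} (ht : 0 ≤ t) : IsProj V p (expMap p v t) := by
  refine ⟨hp, fun q hq => ?_⟩
  rw [expMap_vec hv]
  simp only [lorentz_add_left, lorentz_smul_left, lorentz_vec_self, lorentz_comm v p.vec, hv.1]
  have := mul_nonpos_of_nonneg_of_nonpos (Real.sinh_nonneg_iff.2 ht) (hn q hq)
  linarith

lemma expMap_notMem {v : Fin (n + 1) → ℝ} (hpV : p ∉ V) (hv : IsUnitTangent p v)
    (hn : ∀ q ∈ V, lorentz v q.vec ≤ 0) {t : ℝ} (ht : 0 ≤ t) : expMap p v t ∉ V := by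
  intro hz
  have h := hn _ hz
  rw [expMap_vec hv, lorentz_add_right, lorentz_smul_right, lorentz_smul_right, lorentz_comm,
    hv.1, hv.2, mul_zero, zero_add, mul_one, Real.sinh_nonpos_iff] at h
  rw [le_antisymm h ht, expMap_zero] at hz
  exact hpV hz

/-- The points which project to a given one are those on the normal rays. -/
lemma IsProj.exists_ray (hV : IsOpen V) (hc : GeodConvex V) (hz : z ∉ V) (h : IsProj V p z) :
    ∃ v t, 0 ≤ t ∧ IsUnitTangent p v ∧ (∀ q ∈ V, lorentz v q.vec ≤ 0) ∧ z = expMap p v t := by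
  by_cases hpz : p = z
  · obtain ⟨v, hv, hn⟩ := exists_normal hV hc (h.mem_frontier hV hz)
    exact ⟨v, 0, le_rfl, hv, hn, by rw [expMap_zero, hpz]⟩
  · obtain ⟨v, t, ht, hv, hexp⟩ := exists_isUnitTangent hpz
    refine ⟨v, t, ht.le, hv, fun q hq => ?_, (isExp_iff hv).1 hexp⟩
    have h1 := h.2 q hq
    rw [hexp] at h1
    simp only [lorentz_add_left, lorentz_smul_left, lorentz_vec_self, lorentz_comm v p.vec, hv.1]
      at h1
    have := Real.sinh_pos_iff.2 ht
    by_contra! hpos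
    nlinarith [mul_pos this hpos]

/-- The outward normal rays at `p` consist exactly of the points outside `V` which project to `p`.
Thus the parametrization `ψ` is replaced by the pair `(V, G)`, for which membership is a statement
on nearest points. -/
lemma concaveDevelopment_eq {H : Type*} {d : ℕ} {ψ : H → HypSpace (d + 1)}
    {V G : Set (HypSpace (d + 1))} (hV : IsOpen V) (hc : GeodConvex V)
    (hψ : range ψ = G ∩ frontier V) : concaveDevelopment ψ V = development V G := by
  ext z
  constructor
  · rintro ⟨x, v, ⟨hv, hn⟩, t, ht, hz⟩
    obtain ⟨hG, hf⟩ : ψ x ∈ G ∩ frontier V := hψ ▸ mem_range_self x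
    rw [hV.frontier_eq] at hf
    rw [isExp_iff hv] at hz
    rw [hz]
    exact ⟨expMap_notMem hf.2 hv hn ht, _, hG, isProj_expMap hf.1 hv hn ht⟩
  · rintro ⟨hz, p, hpG, hp⟩
    obtain ⟨v, t, ht, hv, hn, hze⟩ := hp.exists_ray hV hc hz
    obtain ⟨x, rfl⟩ : p ∈ range ψ := hψ ▸ ⟨hpG, hp.mem_frontier hV hz⟩
    exact ⟨x, v, ⟨hv, hn⟩, t, ht, (isExp_iff hv).2 hze⟩

end HypSpace

/-! ### Locally Lipschitz maps and null sets -/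

section Rademacher

variable {E F : Type*} [NormedAddCommGroup E] [NormedSpace ℝ E] [FiniteDimensional ℝ E]
  [MeasurableSpace E] [BorelSpace E] [NormedAddCommGroup F] [NormedSpace ℝ F]
  [FiniteDimensional ℝ F]

/-- Rademacher's theorem, localized. -/
lemma LocallyLipschitzOn.ae_differentiableAt {μ : Measure E} [μ.IsAddHaarMeasure] {f : E → F}
    {S : Set E} (hf : LocallyLipschitzOn S f) (hS : IsOpen S) :
    ∀ᵐ z ∂μ, z ∈ S → DifferentiableAt ℝ f z := by
  rw [ae_iff]
  refine measure_null_of_locally_null _ fun x hx => ?_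
  simp only [Classical.not_imp, mem_ofPred_eq] at hx
  obtain ⟨K, t, ht, hK⟩ := hf hx.1
  rw [hS.nhdsWithin_eq hx.1] at ht
  refine ⟨_, inter_mem_nhdsWithin _ (interior_mem_nhds.2 ht), ?_⟩
  have h1 := (hK.mono interior_subset).ae_differentiableWithinAt_of_mem (μ := μ)
  rw [ae_iff] at h1
  refine measure_mono_null ?_ h1
  rintro z ⟨hz, hzt⟩
  simp only [Classical.not_imp, mem_ofPred_eq] at hz ⊢
  exact ⟨hzt, fun h => hz.2 (h.differentiableAt (isOpen_interior.mem_nhds hzt))⟩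

/-- Countably many of the sets where `f` is Lipschitz cover `S`. On each, the Hausdorff measure of
the dimension of `E`, which is a Haar measure, is multiplied by a bounded factor at most. -/
lemma LocallyLipschitzOn.measure_image_eq_zero {μ : Measure E} [μ.IsAddHaarMeasure] {f : E → E}
    {S : Set E} (hf : LocallyLipschitzOn S f) (hS : μ S = 0) : μ (f '' S) = 0 := by
  have hf' : ∀ x ∈ S, ∃ K, ∃ t ∈ 𝓝[S] x, LipschitzOnWith K f t := fun x hx => hf hx
  choose! K t ht hK using hf'
  obtain ⟨c, hcS, hc, hcov⟩ := TopologicalSpace.countable_cover_nhdsWithin ht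
  have hsub : f '' S ⊆ ⋃ x ∈ c, f '' (t x ∩ S) := by
    rintro _ ⟨z, hz, rfl⟩
    obtain ⟨x, hx, hzx⟩ := mem_iUnion₂.1 (hcov hz)
    exact mem_iUnion₂.2 ⟨x, hx, z, ⟨hzx, hz⟩, rfl⟩
  refine measure_mono_null hsub ((measure_biUnion_null_iff hc).2 fun x hx => ?_)
  have habs : ∀ ν ν' : Measure E, ν.IsAddHaarMeasure → ν'.IsAddHaarMeasure → ν ≪ ν' := by
    intro ν ν' _ _
    rw [Measure.isAddLeftInvariant_eq_smul ν ν']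
    exact Measure.smul_absolutelyContinuous
  set D := (Module.finrank ℝ E : ℝ)
  have h0 : (μH[D] : Measure E) (t x ∩ S) = 0 :=
    habs μH[D] μ inferInstance inferInstance (measure_mono_null inter_subset_right hS)
  have h1 := ((hK x (hcS hx)).mono inter_subset_left : LipschitzOnWith (K x) f (t x ∩ S)
    ).hausdorffMeasure_image_le (d := D) (Nat.cast_nonneg _)
  rw [h0, mul_zero] at h1
  exact habs μ μH[D] inferInstance inferInstance (le_antisymm h1 zero_le)

end Rademacher

/-! ### The orientation form -/

section Orientation

variable {d : ℕ}

/-- The determinant of `(p, y, w)`, as an alternating map of the `d` last vectors. -/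
def volForm (p y : Fin (d + 2) → ℝ) : (Fin (d + 2) → ℝ) [⋀^Fin d]→ₗ[ℝ] ℝ :=
  ((Matrix.detRowAlternating (n := Fin (d + 2)) (R := ℝ)).curryLeft p).curryLeft y

lemma volForm_apply (p y : Fin (d + 2) → ℝ) (w : Fin d → Fin (d + 2) → ℝ) :
    volForm p y w = (Matrix.of (Matrix.vecCons p (Matrix.vecCons y w))).det := rfl

lemma volForm_combination (p y : Fin (d + 2) → ℝ) (a b : ℝ) (w : Fin d → Fin (d + 2) → ℝ) :
    volForm p (a • p + b • y) w = b * volForm p y w := by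
  simp [volForm]

lemma volForm_mulVec (A : Matrix (Fin (d + 2)) (Fin (d + 2)) ℝ) (p y : Fin (d + 2) → ℝ)
    (w : Fin d → Fin (d + 2) → ℝ) :
    volForm (A.mulVec p) (A.mulVec y) (fun i => A.mulVec (w i)) = A.det * volForm p y w := by
  rw [volForm_apply, volForm_apply, ← A.det_transpose, mul_comm, ← Matrix.det_mul]
  congr 1
  ext i j
  rw [Matrix.mul_apply_eq_vecMul, Matrix.vecMul_transpose]
  refine Fin.cases rfl (fun i => ?_) i
  refine Fin.cases rfl (fun i => rfl) i

/-- The determinant which expresses the orientation of a parametrized hypersurface. -/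
def jacobianDet (F : EuclideanSpace ℝ (Fin d) → Fin (d + 2) → ℝ) (y : Fin (d + 2) → ℝ)
    (z : EuclideanSpace ℝ (Fin d)) : ℝ :=
  volForm (F z) y fun i => fderiv ℝ F z (EuclideanSpace.single i (1 : ℝ))

/-- `fderiv` is zero by convention at a point of nondifferentiability, and for `d ≥ 1` the
determinant then has a zero row. So a sign condition on `jacobianDet` contains differentiability. -/
lemma differentiableAt_of_jacobianDet_ne_zero (hd : 1 ≤ d)
    {F : EuclideanSpace ℝ (Fin d) → Fin (d + 2) → ℝ} {y : Fin (d + 2) → ℝ}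
    {z : EuclideanSpace ℝ (Fin d)} (h : jacobianDet F y z ≠ 0) : DifferentiableAt ℝ F z := by
  by_contra hF
  refine h ?_
  rw [jacobianDet, fderiv_zero_of_not_differentiableAt hF]
  exact AlternatingMap.map_coord_zero _ ⟨0, hd⟩ rfl

lemma jacobianDet_of_eventuallyEq {F F₀ : EuclideanSpace ℝ (Fin d) → Fin (d + 2) → ℝ}
    {z : EuclideanSpace ℝ (Fin d)} {A : Matrix (Fin (d + 2)) (Fin (d + 2)) ℝ}
    (hA : A.det = 1) (hF : DifferentiableAt ℝ F z) (h : ∀ᶠ w in 𝓝 z, F₀ w = A.mulVec (F w))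
    (y : Fin (d + 2) → ℝ) : jacobianDet F₀ (A.mulVec y) z = jacobianDet F y z := by
  have h1 : F₀ =ᶠ[𝓝 z] (Matrix.mulVecLin A).toContinuousLinearMap ∘ F := h
  rw [jacobianDet, h1.fderiv_eq, h.self_of_nhds,
    (ContinuousLinearMap.hasFDerivAt _).comp z hF.hasFDerivAt |>.fderiv]
  exact (volForm_mulVec A _ _ _).trans (by rw [hA, one_mul]; rfl)

/-- The pullback of an alternating form of top degree is multiplied by the determinant. -/
lemma jacobianDet_comp {F : EuclideanSpace ℝ (Fin d) → Fin (d + 2) → ℝ}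
    {T : EuclideanSpace ℝ (Fin d) → EuclideanSpace ℝ (Fin d)} {z : EuclideanSpace ℝ (Fin d)}
    (hT : DifferentiableAt ℝ T z) (hF : DifferentiableAt ℝ F (T z)) (y : Fin (d + 2) → ℝ) :
    jacobianDet (F ∘ T) y z = (fderiv ℝ T z).det * jacobianDet F y (T z) := by
  rw [jacobianDet, fderiv_comp z hF hT]
  set b := (EuclideanSpace.basisFun (Fin d) ℝ).toBasis with hb
  have hbi : ∀ i, b i = EuclideanSpace.single i (1 : ℝ) := fun i => by simp [hb]
  set ω := (volForm (F (T z)) y).compLinearMap (fderiv ℝ F (T z)).toLinearMap with hω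
  have h1 := congrArg (fun α => α fun i => fderiv ℝ T z (b i)) (ω.eq_smul_basis_det b)
  have h2 : b.det (fun i => fderiv ℝ T z (b i)) = (fderiv ℝ T z).det := by
    have := b.det_comp_basis b (fderiv ℝ T z).toLinearMap
    simpa [ContinuousLinearMap.det, Function.comp_def] using this
  simp only [AlternatingMap.smul_apply, h2, smul_eq_mul] at h1
  rw [mul_comm, jacobianDet]
  simpa [hω, hbi, Function.comp_def] using h1

end Orientation

/-! ### Charts of the boundaries of convex sets -/

section BoundaryCharts

variable {M : Type*} [TopologicalSpace M] {d : ℕ}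

/-- `κ` is an oriented Lipschitz chart for the map `φ` into the boundary of the convex set `V`. -/
structure IsBoundaryChart (φ : M → HypSpace (d + 1)) (V : Set (HypSpace (d + 1)))
    (κ : OpenPartialHomeomorph M (EuclideanSpace ℝ (Fin d))) : Prop where
  isOpen : IsOpen V
  convex : GeodConvex V
  mapsTo : MapsTo φ κ.source (frontier V)
  biLipschitz : ∀ x ∈ κ.source, ∃ C : ℝ, 0 < C ∧ ∃ N ∈ 𝓝 x, ∀ y ∈ N ∩ κ.source,
    ∀ z ∈ N ∩ κ.source, hdist (φ y) (φ z) ≤ C * dist (κ y) (κ z) ∧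
      dist (κ y) (κ z) ≤ C * hdist (φ y) (φ z)
  oriented : ∀ᵐ z ∂(volume : Measure (EuclideanSpace ℝ (Fin d))), z ∈ κ.target → ∀ y ∈ V,
    jacobianDet (fun w => (φ (κ.symm w)).vec) y.vec z < 0

/-- Near `x`, an oriented isometry exchanges `φ` and `φ'` and the convex sets `V` and `V'`. -/
def AgreeAt (φ : M → HypSpace (d + 1)) (V : Set (HypSpace (d + 1))) (φ' : M → HypSpace (d + 1))
    (V' : Set (HypSpace (d + 1))) (x : M) : Prop :=
  ∃ g, IsOrientedIsometry g ∧ (∀ᶠ y in 𝓝 x, φ' y = g (φ y)) ∧ ∀ᶠ q in 𝓝 (φ x), q ∈ V ↔ g q ∈ V'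

variable {φ φ' φ'' : M → HypSpace (d + 1)} {V V' V'' : Set (HypSpace (d + 1))} {x : M}

lemma AgreeAt.refl (φ : M → HypSpace (d + 1)) (V : Set (HypSpace (d + 1))) (x : M) :
    AgreeAt φ V φ V x :=
  ⟨id, IsOrientedIsometry.id, by simp, by simp⟩

lemma AgreeAt.symm (h : AgreeAt φ V φ' V' x) : AgreeAt φ' V' φ V x := by
  obtain ⟨g, hg, h1, h2⟩ := h
  obtain ⟨k, hk, hl, hr⟩ := hg.exists_inverse
  refine ⟨k, hk, h1.mono fun y hy => by rw [hy, hl], ?_⟩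
  have h3 : Tendsto k (𝓝 (φ' x)) (𝓝 (φ x)) := by
    have := hk.continuous.tendsto (φ' x)
    rw [h1.self_of_nhds, hl] at this
    rwa [h1.self_of_nhds]
  filter_upwards [h3.eventually h2] with q hq
  rw [hq, hr]

lemma AgreeAt.trans (h : AgreeAt φ V φ' V' x) (h' : AgreeAt φ' V' φ'' V'' x) :
    AgreeAt φ V φ'' V'' x := by
  obtain ⟨g, hg, h1, h2⟩ := h
  obtain ⟨g', hg', h1', h2'⟩ := h'
  refine ⟨g' ∘ g, hg'.comp hg, ?_, ?_⟩
  · filter_upwards [h1, h1'] with y hy hy'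
    rw [hy', hy, Function.comp_apply]
  · have h3 : Tendsto g (𝓝 (φ x)) (𝓝 (φ' x)) := by
      rw [h1.self_of_nhds]
      exact hg.continuous.tendsto (φ x)
    filter_upwards [h2, h3.eventually h2'] with q hq hq'
    rw [hq, hq', Function.comp_apply]

/-- Both charts are bi-Lipschitz to the hyperbolic distance, which the isometry preserves. -/
lemma AgreeAt.exists_dist_bound {κ κ' : OpenPartialHomeomorph M (EuclideanSpace ℝ (Fin d))}
    (h : AgreeAt φ V φ' V' x) (hκ : IsBoundaryChart φ V κ) (hκ' : IsBoundaryChart φ' V' κ')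
    (hx : x ∈ κ.source) (hx' : x ∈ κ'.source) :
    ∃ C : ℝ, 0 < C ∧ ∃ N ∈ 𝓝 x, ∀ y ∈ N ∩ (κ.source ∩ κ'.source),
      ∀ z ∈ N ∩ (κ.source ∩ κ'.source), dist (κ' y) (κ' z) ≤ C * dist (κ y) (κ z) := by
  obtain ⟨g, hg, h1, -⟩ := h
  obtain ⟨C, hC, N, hN, hb⟩ := hκ.biLipschitz x hx
  obtain ⟨C', hC', N', hN', hb'⟩ := hκ'.biLipschitz x hx'
  refine ⟨C' * C, mul_pos hC' hC, _, inter_mem (inter_mem hN hN') h1, ?_⟩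
  rintro y ⟨⟨⟨hy1, hy2⟩, hy3⟩, hy4, hy5⟩ z ⟨⟨⟨hz1, hz2⟩, hz3⟩, hz4, hz5⟩
  have e1 := (hb y ⟨hy1, hy4⟩ z ⟨hz1, hz4⟩).1
  have e2 := (hb' y ⟨hy2, hy5⟩ z ⟨hz2, hz5⟩).2
  rw [hy3, hz3, hg.hdist_map] at e2
  refine e2.trans ?_
  rw [mul_assoc]
  gcongr

lemma locallyLipschitzOn_transition
    {κ κ' : OpenPartialHomeomorph M (EuclideanSpace ℝ (Fin d))}
    (hκ : IsBoundaryChart φ V κ) (hκ' : IsBoundaryChart φ' V' κ')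
    (h : ∀ x ∈ κ.source ∩ κ'.source, AgreeAt φ V φ' V' x) :
    LocallyLipschitzOn (κ.symm.trans κ').source (fun z => κ' (κ.symm z)) := by
  intro z hz
  have hzt : z ∈ κ.target := hz.1
  have hxs : κ.symm z ∈ κ.source := κ.map_target hzt
  have hxs' : κ.symm z ∈ κ'.source := hz.2
  obtain ⟨C, hC, N, hN, hb⟩ := (h _ ⟨hxs, hxs'⟩).exists_dist_bound hκ hκ' hxs hxs'
  refine ⟨⟨C, hC.le⟩, _, inter_mem_nhdsWithin _ ((κ.continuousAt_symm hzt).preimage_mem_nhds hN),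
    LipschitzOnWith.of_dist_le_mul ?_⟩
  rintro a ⟨ha, haN⟩ b ⟨hb', hbN⟩
  have := hb _ ⟨haN, κ.map_target ha.1, ha.2⟩ _ ⟨hbN, κ.map_target hb'.1, hb'.2⟩
  rwa [κ.right_inv ha.1, κ.right_inv hb'.1] at this

/-- By the chain rule and the invariance under `SO`, the two negative orientation determinants
differ by the factor `det` of the transition, which is therefore positive. Comparing them requires a
point `q` of `V` sent into `V'`, whence the condition on convex sets in `AgreeAt`. -/
lemma ae_det_fderiv_transition_pos (hd : 1 ≤ d)
    {κ κ' : OpenPartialHomeomorph M (EuclideanSpace ℝ (Fin d))}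
    (hκ : IsBoundaryChart φ V κ) (hκ' : IsBoundaryChart φ' V' κ')
    (h : ∀ x ∈ κ.source ∩ κ'.source, AgreeAt φ V φ' V' x) :
    ∀ᵐ z ∂(volume : Measure (EuclideanSpace ℝ (Fin d))),
      z ∈ (κ.symm.trans κ').source → 0 < (fderiv ℝ (fun w => κ' (κ.symm w)) z).det := by
  have hLip := locallyLipschitzOn_transition hκ hκ' h
  have hLip' := locallyLipschitzOn_transition hκ' hκ fun x hx => (h x hx.symm).symm
  -- The sign for `κ'` holds off a null set of its own target. Its preimage under the transition is
  -- the image of a null set by the inverse transition, a locally Lipschitz map.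
  have h3 : ∀ᵐ z ∂(volume : Measure (EuclideanSpace ℝ (Fin d))), z ∈ (κ.symm.trans κ').source →
      ∀ y ∈ V', jacobianDet (fun w => (φ' (κ'.symm w)).vec) y.vec (κ' (κ.symm z)) < 0 := by
    have hb := hκ'.oriented
    rw [ae_iff] at hb ⊢
    set S := {a | ¬(a ∈ κ'.target →
      ∀ y ∈ V', jacobianDet (fun w => (φ' (κ'.symm w)).vec) y.vec a < 0)}
    refine measure_mono_null ?_ ((hLip'.mono (inter_subset_right (s := S))
      ).measure_image_eq_zero (measure_mono_null inter_subset_left hb))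
    intro z hz
    simp only [Classical.not_imp, mem_ofPred_eq] at hz
    obtain ⟨⟨hz1, hz2⟩, hz3⟩ := hz
    have hz1' : z ∈ κ.target := hz1
    have hz2' : κ.symm z ∈ κ'.source := hz2
    have e := κ'.left_inv hz2'
    refine ⟨κ' (κ.symm z), ⟨fun hh => hz3 (hh (κ'.map_source hz2')), κ'.map_source hz2', ?_⟩, ?_⟩
    · change κ'.symm (κ' (κ.symm z)) ∈ κ.source
      rw [e]
      exact κ.map_target hz1'
    · simp only [e, κ.right_inv hz1']
  filter_upwards [hκ.oriented, h3, hLip.ae_differentiableAt (κ.symm.trans κ').open_source]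
    with z hz1 hz2 hz3 hz
  have hzt : z ∈ κ.target := hz.1
  have hxs : κ.symm z ∈ κ.source := κ.map_target hzt
  have hxs' : κ.symm z ∈ κ'.source := hz.2
  obtain ⟨g, hg, hgφ, hgV⟩ := h _ ⟨hxs, hxs'⟩
  have hfr := hκ.mapsTo hxs
  rw [hκ.isOpen.frontier_eq] at hfr
  -- `g` exchanges the convex sets only near `φ x`, so `q` is taken close to this boundary point.
  obtain ⟨q, hq, hq'⟩ := ((mem_closure_iff_frequently.1 hfr.1).and_eventually hgV).exists
  have hgq := hq'.1 hq
  have e1 := hz1 hzt q hq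
  have e2 := hz2 hz _ hgq
  have dT := hz3 hz
  obtain ⟨A, -, hA, hgA⟩ := hg
  have dF := differentiableAt_of_jacobianDet_ne_zero hd e1.ne
  have dF' := differentiableAt_of_jacobianDet_ne_zero hd e2.ne
  have heq : ∀ᶠ w in 𝓝 z, ((fun u => (φ' (κ'.symm u)).vec) ∘ fun w => κ' (κ.symm w)) w =
      A.mulVec (φ (κ.symm w)).vec := by
    filter_upwards [(κ.continuousAt_symm hzt).eventually hgφ,
      (κ.symm.trans κ').open_source.mem_nhds hz] with w hw hw'
    have : κ.symm w ∈ κ'.source := hw'.2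
    rw [Function.comp_apply, κ'.left_inv this, hw, hgA]
  have e3 := jacobianDet_of_eventuallyEq hA dF heq q.vec
  rw [jacobianDet_comp dT dF', ← hgA] at e3
  rw [← e3] at e1
  exact pos_of_mul_neg_left e1 e2.le

/-- Charts which are related by isometries form an oriented Lipschitz atlas. -/
def atlasOfBoundaryCharts (hd : 1 ≤ d)
    (𝓕 : Set ((M → HypSpace (d + 1)) × Set (HypSpace (d + 1)) ×
      OpenPartialHomeomorph M (EuclideanSpace ℝ (Fin d))))
    (h𝓕 : ∀ a ∈ 𝓕, IsBoundaryChart a.1 a.2.1 a.2.2)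
    (hcov : ∀ x, ∃ a ∈ 𝓕, x ∈ a.2.2.source)
    (hagree : ∀ a ∈ 𝓕, ∀ b ∈ 𝓕, ∀ x ∈ a.2.2.source ∩ b.2.2.source,
      AgreeAt a.1 a.2.1 b.1 b.2.1 x) : OrientedLipschitzAtlas M d where
  charts := (fun a => a.2.2) '' 𝓕
  cover x := by
    obtain ⟨a, ha, hx⟩ := hcov x
    exact ⟨_, mem_image_of_mem _ ha, hx⟩
  locallyLipschitz := by
    rintro _ ⟨a, ha, rfl⟩ _ ⟨b, hb, rfl⟩
    exact locallyLipschitzOn_transition (h𝓕 a ha) (h𝓕 b hb) (hagree a ha b hb)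
  oriented := by
    rintro _ ⟨a, ha, rfl⟩ _ ⟨b, hb, rfl⟩
    exact ae_det_fderiv_transition_pos hd (h𝓕 a ha) (h𝓕 b hb) (hagree a ha b hb)

/-- The point `y` of `V'` may be far from `p`, where `g` says nothing about the convex sets. It is
replaced by the radial projection of `p + s y` with `s` small, which is in `V'` near `p`; this only
multiplies the determinant by a positive factor. -/
lemma jacobianDet_neg_of_agreeAt (hd : 1 ≤ d)
    {κ : OpenPartialHomeomorph M (EuclideanSpace ℝ (Fin d))} (hVne : V.Nonempty)
    (hV' : IsOpen V') (hc' : GeodConvex V') {z : EuclideanSpace ℝ (Fin d)} (hz : z ∈ κ.target)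
    (hfr : φ' (κ.symm z) ∈ closure V') (h : AgreeAt φ V φ' V' (κ.symm z))
    (hneg : ∀ y ∈ V, jacobianDet (fun w => (φ (κ.symm w)).vec) y.vec z < 0)
    {y : HypSpace (d + 1)} (hy : y ∈ V') :
    jacobianDet (fun w => (φ' (κ.symm w)).vec) y.vec z < 0 := by
  obtain ⟨g, hg, hgφ, hgV⟩ := h
  obtain ⟨k, hk, hl, hr⟩ := hg.exists_inverse
  obtain ⟨A, -, hA, hgA⟩ := hg
  obtain ⟨o, ho⟩ := hVne
  have dF := differentiableAt_of_jacobianDet_ne_zero hd (hneg o ho).ne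
  have heq : ∀ᶠ w in 𝓝 z, (φ' (κ.symm w)).vec = A.mulVec (φ (κ.symm w)).vec := by
    filter_upwards [(κ.continuousAt_symm hz).eventually hgφ] with w hw
    rw [hw, hgA]
  set p := φ' (κ.symm z) with hp
  have hlim : Tendsto (fun s : ℝ => k (normalize (p.vec + s • y.vec))) (𝓝[>] 0)
      (𝓝 (φ (κ.symm z))) := by
    have h0 : φ (κ.symm z) = k (normalize (p.vec + (0 : ℝ) • y.vec)) := by
      rw [zero_smul, add_zero, normalize_vec_self, hp, hgφ.self_of_nhds, hl]
    rw [h0]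
    refine Tendsto.mono_left ?_ nhdsWithin_le_nhds
    refine (hk.continuous.continuousAt.comp (f := fun s : ℝ => normalize (p.vec + s • y.vec)) ?_)
    refine ContinuousAt.comp (f := fun s : ℝ => p.vec + s • y.vec)
      (continuousAt_normalize ?_) (by fun_prop)
    simpa using p.vec_mem_futureCone
  obtain ⟨s, hs, hs0⟩ := ((hlim.eventually hgV).and self_mem_nhdsWithin).exists
  replace hs0 : 0 < s := hs0
  have hcone : p.vec + s • y.vec ∈ cone V' :=
    add_mem_cone_of_mem_closure hV' hc' (vec_mem_closure_cone.2 hfr) (smul_vec_mem_cone hy hs0)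
  have hq : k (normalize (p.vec + s • y.vec)) ∈ V := hs.2 (by rw [hr]; exact hcone.2)
  have e1 := hneg _ hq
  rw [← jacobianDet_of_eventuallyEq hA dF heq, ← hgA, hr] at e1
  obtain ⟨c, hc, hn⟩ := exists_normalize hcone.1
  rw [hn, jacobianDet, ← hp, smul_add, smul_smul, volForm_combination] at e1
  exact neg_of_mul_neg_right e1 (mul_pos hc hs0).le

/-- A map which agrees locally with the maps of the charts is a convex embedding. -/
lemma isConvexEmbeddingOn_of_agreeAt (hd : 1 ≤ d) {O : OrientedLipschitzAtlas M d} {U : Set M}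
    (hO : ∀ κ ∈ O.charts, ∃ φ V, IsBoundaryChart φ V κ ∧
      ∀ x ∈ U ∩ κ.source, AgreeAt φ V φ' V' x)
    (hU : IsOpen U) (hemb : IsEmbedding (U.domRestrict φ')) (hV' : IsOpen V')
    (hc' : GeodConvex V') (himage : ∃ G, IsOpen G ∧ φ' '' U = G ∩ frontier V') :
    IsConvexEmbeddingOn O φ' U V' where
  lipschitz :=
    { isOpen := hU
      embedding := hemb
      biLipschitz := by
        intro κ hκ x hx
        obtain ⟨φ, V, hch, hag⟩ := hO κ hκ
        obtain ⟨g, hg, h1, -⟩ := hag x hx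
        obtain ⟨C, hC, N, hN, hb⟩ := hch.biLipschitz x hx.2
        refine ⟨C, hC, _, inter_mem hN h1, ?_⟩
        rintro y ⟨⟨hy1, hy2⟩, hy3, hy4⟩ z ⟨⟨hz1, hz2⟩, hz3, hz4⟩
        rw [hy2, hz2, hg.hdist_map]
        exact hb y ⟨hy1, hy4⟩ z ⟨hz1, hz4⟩ }
  isOpen := hV'
  convex := hc'
  image_open := himage
  oriented := by
    intro κ hκ
    obtain ⟨φ, V, hch, hag⟩ := hO κ hκ
    obtain ⟨G, -, hG⟩ := himage
    filter_upwards [hch.oriented] with z hz hzt hzU y hy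
    have hx := κ.map_target hzt
    have hVne : V.Nonempty := closure_nonempty_iff.1 ⟨_, frontier_subset_closure (hch.mapsTo hx)⟩
    have hfr : φ' (κ.symm z) ∈ closure V' :=
      frontier_subset_closure (hG.subset (mem_image_of_mem φ' hzU)).2
    exact jacobianDet_neg_of_agreeAt hd hVne hV' hc' hzt hfr (hag _ ⟨hzU, hx⟩)
      (hz hzt) hy

end BoundaryCharts

/-! ### Boundaries of convex sets as graphs -/

section Graph

variable {d : ℕ}

lemma volForm_add_right (p y y' : Fin (d + 2) → ℝ) (w : Fin d → Fin (d + 2) → ℝ) :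
    volForm p (y + y') w = volForm p y w + volForm p y' w := by
  simp [volForm]

lemma volForm_smul_right (p y : Fin (d + 2) → ℝ) (c : ℝ) (w : Fin d → Fin (d + 2) → ℝ) :
    volForm p (c • y) w = c * volForm p y w := by
  simp [volForm]

lemma volForm_add_left (p p' y : Fin (d + 2) → ℝ) (w : Fin d → Fin (d + 2) → ℝ) :
    volForm (p + p') y w = volForm p y w + volForm p' y w := by
  simp [volForm]

lemma volForm_smul_left (p y : Fin (d + 2) → ℝ) (c : ℝ) (w : Fin d → Fin (d + 2) → ℝ) :
    volForm (c • p) y w = c * volForm p y w := by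
  simp [volForm]

lemma volForm_basis_right (p : Fin (d + 2) → ℝ) (w : Fin d → Fin (d + 2) → ℝ) (i : Fin d) :
    volForm p (w i) w = 0 := by
  rw [volForm_apply]
  exact Matrix.det_zero_of_row_eq (i := 1) (j := i.succ.succ)
    (by rw [ne_eq, ← Fin.succ_zero_eq_one, Fin.succ_inj]; exact (Fin.succ_ne_zero i).symm) rfl

lemma volForm_basis_left (y : Fin (d + 2) → ℝ) (w : Fin d → Fin (d + 2) → ℝ) (i : Fin d) :
    volForm (w i) y w = 0 := by
  rw [volForm_apply]
  exact Matrix.det_zero_of_row_eq (i := 0) (j := i.succ.succ) (Fin.succ_ne_zero _).symm rfl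

lemma volForm_sum_right (p : Fin (d + 2) → ℝ) (w : Fin d → Fin (d + 2) → ℝ) (c : Fin d → ℝ) :
    volForm p (∑ i, c i • w i) w = 0 := by
  let ℓ : (Fin (d + 2) → ℝ) →ₗ[ℝ] ℝ :=
    { toFun := fun y => volForm p y w
      map_add' := fun y y' => volForm_add_right p y y' w
      map_smul' := fun c y => volForm_smul_right p y c w }
  change ℓ _ = 0
  rw [map_sum]
  refine Finset.sum_eq_zero fun i _ => ?_
  rw [map_smul]
  exact (congrArg _ (volForm_basis_right p w i)).trans (smul_zero _)

lemma volForm_sum_left (y : Fin (d + 2) → ℝ) (w : Fin d → Fin (d + 2) → ℝ) (c : Fin d → ℝ) :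
    volForm (∑ i, c i • w i) y w = 0 := by
  let ℓ : (Fin (d + 2) → ℝ) →ₗ[ℝ] ℝ :=
    { toFun := fun p => volForm p y w
      map_add' := fun p p' => volForm_add_left p p' y w
      map_smul' := fun c p => volForm_smul_left p y c w }
  change ℓ _ = 0
  rw [map_sum]
  refine Finset.sum_eq_zero fun i _ => ?_
  rw [map_smul]
  exact (congrArg _ (volForm_basis_left y w i)).trans (smul_zero _)

lemma volForm_shift_first (p y : Fin (d + 2) → ℝ) (w : Fin d → Fin (d + 2) → ℝ) (a : Fin d → ℝ) :
    volForm p y (fun i => w i + a i • p) = volForm p y w := by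
  rw [volForm_apply, volForm_apply]
  refine Matrix.det_eq_of_forall_row_eq_smul_add_const
    (Matrix.vecCons 0 (Matrix.vecCons 0 a)) 0 rfl fun i j => ?_
  refine Fin.cases (by simp) (fun i => Fin.cases (by simp) (fun i => by simp) i) i

lemma volForm_shift_second (p y : Fin (d + 2) → ℝ) (w : Fin d → Fin (d + 2) → ℝ) (c : ℝ)
    (a : Fin d → ℝ) : volForm (p + c • y) y (fun i => w i + a i • y) = volForm p y w := by
  rw [volForm_apply, volForm_apply]
  refine Matrix.det_eq_of_forall_row_eq_smul_add_const
    (Matrix.vecCons c (Matrix.vecCons 0 a)) 1 rfl fun i j => ?_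
  refine Fin.cases (by simp) (fun i => Fin.cases (by simp) (fun i => by simp) i) i

lemma volForm_smul (p y : Fin (d + 2) → ℝ) (c : ℝ) (w : Fin d → Fin (d + 2) → ℝ) :
    volForm (c • p) y (fun i => c • w i) = c ^ (d + 1) * volForm p y w := by
  rw [volForm_smul_left, (volForm p y).map_smul_univ (fun _ => c) w]
  simp [pow_succ']
  ring

lemma linearIndependent_pair {p o : HypSpace (d + 1)} (h : p ≠ o) :
    LinearIndependent ℝ ![p.vec, o.vec] := by
  rw [LinearIndependent.pair_iff]
  intro a c hac
  have h1 := congrArg (lorentz p.vec) hac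
  have h2 := congrArg (lorentz o.vec) hac
  have hz : ∀ x : Fin (d + 2) → ℝ, lorentz x 0 = 0 := fun x => by
    rw [← zero_smul ℝ (0 : Fin (d + 2) → ℝ), lorentz_smul_right, zero_mul]
  rw [hz, lorentz_add_right, lorentz_smul_right, lorentz_smul_right, lorentz_vec_self] at h1 h2
  rw [lorentz_comm o.vec] at h2
  have hm : 1 < -lorentz p.vec o.vec :=
    lt_of_not_ge fun h' => h (eq_of_neg_lorentz_le_one h')
  set m := -lorentz p.vec o.vec with hm'
  have e : lorentz p.vec o.vec = -m := by rw [hm', neg_neg]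
  rw [e] at h1 h2
  have e1 : a = -(c * m) := by linarith
  have e2 : c * (m ^ 2 - 1) = 0 := by rw [e1] at h2; linarith
  have e3 : c = 0 := (mul_eq_zero.1 e2).resolve_right (by nlinarith)
  exact ⟨by rw [e1, e3, zero_mul, neg_zero], e3⟩

lemma sumExtend_inl_apply {K W ι : Type*} [DivisionRing K] [AddCommGroup W] [Module K W]
    {v : ι → W} (hs : LinearIndependent K v) (i : ι) :
    Module.Basis.sumExtend hs (Sum.inl i) = v i := by
  simp only [Module.Basis.sumExtend, Trans.trans, Module.Basis.reindex_apply,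
    Module.Basis.extend_apply_self]
  classical
  exact congrArg Subtype.val (Equiv.Set.sumDiffSubset_apply_inl
    (hs.linearIndepOn_id.subset_extend (subset_univ (range v)))
      (Equiv.ofInjective v hs.injective i))

/-- `p` and `o` are completed to a basis; the sign is corrected by reversing one of the added
vectors, which exists since `d ≥ 1`. -/
lemma exists_volForm_neg (hd : 1 ≤ d) {p o : HypSpace (d + 1)} (h : p ≠ o) :
    ∃ b : Fin d → Fin (d + 2) → ℝ, volForm p.vec o.vec b < 0 := by
  suffices H : ∃ b : Fin d → Fin (d + 2) → ℝ, volForm p.vec o.vec b ≠ 0 by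
    obtain ⟨b, hb⟩ := H
    rcases lt_or_gt_of_ne hb with hb | hb
    · exact ⟨b, hb⟩
    · refine ⟨Function.update b ⟨0, hd⟩ (-b ⟨0, hd⟩), ?_⟩
      rw [AlternatingMap.map_update_neg, Function.update_eq_self]
      linarith
  obtain ⟨I, B, hB⟩ : ∃ (I : Set (Fin (d + 2) → ℝ))
      (B : Module.Basis (Fin 2 ⊕ I) ℝ (Fin (d + 2) → ℝ)),
      ∀ i, B (Sum.inl i) = ![p.vec, o.vec] i :=
    ⟨_, Module.Basis.sumExtend (linearIndependent_pair h), sumExtend_inl_apply _⟩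
  have hfin : Finite (Fin 2 ⊕ I) := Module.Finite.finite_basis B
  have hI : Finite I := Finite.of_injective Sum.inr (Sum.inr_injective (α := Fin 2) (β := I))
  have hcard : Nat.card I = d := by
    have h1 := Module.finrank_eq_nat_card_basis B
    rw [Nat.card_sum, Module.finrank_fin_fun, Nat.card_fin] at h1
    omega
  let e : Fin d ≃ I := (Finite.equivFinOfCardEq hcard).symm
  refine ⟨fun i => B (Sum.inr (e i)), ?_⟩
  rw [volForm_apply]
  let f : Fin (d + 2) → Fin 2 ⊕ I :=
    Matrix.vecCons (Sum.inl 0) (Matrix.vecCons (Sum.inl 1) fun i => Sum.inr (e i))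
  have hf : Function.Injective f := by
    refine Fin.cons_injective_iff.2 ⟨?_, ?_⟩
    · rintro ⟨i, hi⟩
      revert hi
      refine Fin.cases (by simp) (fun i => by simp) i
    · refine Fin.cons_injective_iff.2 ⟨?_, Sum.inr_injective.comp e.injective⟩
      rintro ⟨i, hi⟩
      exact Sum.inr_ne_inl hi
  have h3 : (fun i => B (f i)) = Matrix.vecCons p.vec
      (Matrix.vecCons o.vec fun i => B (Sum.inr (e i))) := by
    funext i
    refine Fin.cases (hB 0) (fun i => ?_) i
    exact Fin.cases (hB 1) (fun i => rfl) i
  have hli : LinearIndependent ℝ fun i => B (f i) := B.linearIndependent.comp f hf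
  have := Matrix.linearIndependent_rows_iff_isUnit (A := Matrix.of fun i => B (f i)) |>.1 hli
  rw [Matrix.isUnit_iff_isUnit_det, isUnit_iff_ne_zero, h3] at this
  exact this

/-- A frame in which the boundary of the convex set `V` is a graph near `p`. -/
structure GraphFrame (d : ℕ) where
  V : Set (HypSpace (d + 1))
  isOpen : IsOpen V
  convex : GeodConvex V
  p : HypSpace (d + 1)
  hp : p ∈ frontier V
  o : HypSpace (d + 1)
  ho : o ∈ V
  b : Fin d → Fin (d + 2) → ℝ
  neg : volForm p.vec o.vec b < 0

namespace GraphFrame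

variable (Γ : GraphFrame d)

/-- The basis formed by `p`, `o` and `b`. -/
def basis : Module.Basis (Fin (d + 2)) ℝ (Fin (d + 2) → ℝ) :=
  basisOfLinearIndependentOfCardEqFinrank
    (b := Matrix.vecCons Γ.p.vec (Matrix.vecCons Γ.o.vec Γ.b))
    (Matrix.linearIndependent_rows_of_det_ne_zero (A := Matrix.of _) Γ.neg.ne) (by simp)

lemma basis_apply : ⇑Γ.basis = Matrix.vecCons Γ.p.vec (Matrix.vecCons Γ.o.vec Γ.b) :=
  coe_basisOfLinearIndependentOfCardEqFinrank _ _

/-- The points of the hyperplane. -/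
def base (z : EuclideanSpace ℝ (Fin d)) : Fin (d + 2) → ℝ := Γ.p.vec + ∑ i, z i • Γ.b i

/-- The coordinates. -/
def lam : (Fin (d + 2) → ℝ) →L[ℝ] ℝ := LinearMap.toContinuousLinearMap (Γ.basis.coord 0)

/-- The coordinates. -/
def sig : (Fin (d + 2) → ℝ) →L[ℝ] ℝ := LinearMap.toContinuousLinearMap (Γ.basis.coord 1)

/-- The coordinates. -/
def zet (i : Fin d) : (Fin (d + 2) → ℝ) →L[ℝ] ℝ :=
  LinearMap.toContinuousLinearMap (Γ.basis.coord i.succ.succ)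

lemma expand (x : Fin (d + 2) → ℝ) :
    x = Γ.lam x • Γ.p.vec + (Γ.sig x • Γ.o.vec + ∑ i, Γ.zet i x • Γ.b i) := by
  conv_lhs => rw [← Γ.basis.sum_repr x, Fin.sum_univ_succ, Fin.sum_univ_succ]
  simp only [basis_apply]
  rfl

lemma coord_base (z : EuclideanSpace ℝ (Fin d)) (s : ℝ) :
    Γ.lam (Γ.base z + s • Γ.o.vec) = 1 ∧ ∀ i, Γ.zet i (Γ.base z + s • Γ.o.vec) = z i := by
  have h0 : Γ.basis 0 = Γ.p.vec := by rw [basis_apply]; rfl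
  have h1 : Γ.basis 1 = Γ.o.vec := by rw [basis_apply]; rfl
  have h2 : ∀ i : Fin d, Γ.basis i.succ.succ = Γ.b i := fun i => by rw [basis_apply]; rfl
  have hne : ∀ i : Fin d, i.succ.succ ≠ (1 : Fin (d + 2)) := fun i => by
    rw [ne_eq, ← Fin.succ_zero_eq_one, Fin.succ_inj]; exact Fin.succ_ne_zero i
  have hne0 : ∀ i : Fin d, i.succ.succ ≠ (0 : Fin (d + 2)) := fun i => Fin.succ_ne_zero _
  have h01 : (1 : Fin (d + 2)) ≠ 0 := by simp
  have key : ∀ k, Γ.basis.coord k (Γ.base z + s • Γ.o.vec) =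
      (if (0 : Fin (d + 2)) = k then 1 else 0) +
      (∑ i : Fin d, z i * (if i.succ.succ = k then 1 else 0)) +
      s * (if (1 : Fin (d + 2)) = k then 1 else 0) := by
    intro k
    rw [base, ← h0, ← h1]
    simp only [← h2, map_add, map_sum, map_smul, Module.Basis.coord_apply,
      Module.Basis.repr_self, Finsupp.single_apply, smul_eq_mul]
  refine ⟨?_, fun i => ?_⟩
  · refine (key 0).trans ?_
    simp [hne0, h01]
  · refine (key i.succ.succ).trans ?_
    simp [(hne i).symm, (hne0 i).symm]

/-- The height of the graph. -/
def height (z : EuclideanSpace ℝ (Fin d)) : ℝ := sInf {s : ℝ | Γ.base z + s • Γ.o.vec ∈ cone Γ.V}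

lemma mem_cone_of_le {z : EuclideanSpace ℝ (Fin d)} {s t : ℝ}
    (h : Γ.base z + s • Γ.o.vec ∈ cone Γ.V) (hst : s ≤ t) :
    Γ.base z + t • Γ.o.vec ∈ cone Γ.V := by
  rcases hst.eq_or_lt with rfl | hst
  · exact h
  · have := geodConvex_iff.1 Γ.convex _ h _ (smul_vec_mem_cone Γ.ho (sub_pos.2 hst))
    convert this using 1
    module

/-- Each line of direction `o` meets the cone in an open upper half line: it is stable upwards since
`o` is in the cone, nonempty since the cone is a neighbourhood of `o`, and bounded below since times
are positive. So the infimum defining `height` is never a default value. -/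
lemma mem_cone_iff {z : EuclideanSpace ℝ (Fin d)} {s : ℝ} :
    Γ.base z + s • Γ.o.vec ∈ cone Γ.V ↔ Γ.height z < s := by
  set S := {s : ℝ | Γ.base z + s • Γ.o.vec ∈ cone Γ.V} with hS
  have hopen : IsOpen S := (isOpen_cone Γ.isOpen).preimage
    (by fun_prop : Continuous fun s : ℝ => Γ.base z + s • Γ.o.vec)
  have hbdd : BddBelow S := by
    refine ⟨-Γ.base z 0 / Γ.o.vec 0, fun s hs => ?_⟩
    have h1 := hs.1.2
    have h2 := Γ.o.vec_zero_pos
    rw [Pi.add_apply, Pi.smul_apply, smul_eq_mul] at h1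
    rw [div_le_iff₀ h2]
    linarith
  have hne : S.Nonempty := by
    have hlim : Tendsto (fun s : ℝ => s • Γ.base z + Γ.o.vec) (𝓝[>] 0) (𝓝 Γ.o.vec) := by
      have hc : Continuous fun s : ℝ => s • Γ.base z + Γ.o.vec := by fun_prop
      have := hc.tendsto 0
      simp only [zero_smul, zero_add] at this
      exact this.mono_left nhdsWithin_le_nhds
    obtain ⟨s, hs, hs0⟩ := ((hlim.eventually ((isOpen_cone Γ.isOpen).mem_nhds
      (vec_mem_cone.2 Γ.ho))).and self_mem_nhdsWithin).exists
    replace hs0 : 0 < s := hs0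
    refine ⟨s⁻¹, ?_⟩
    have := smul_mem_cone hs (inv_pos.2 hs0)
    rwa [smul_add, smul_smul, inv_mul_cancel₀ hs0.ne', one_smul] at this
  constructor
  · intro h
    have h1 : ∀ᶠ t in 𝓝[<] s, t ∈ S := mem_nhdsWithin_of_mem_nhds (hopen.mem_nhds h)
    obtain ⟨t, ht, hts⟩ := (h1.and self_mem_nhdsWithin).exists
    exact (csInf_le hbdd ht).trans_lt hts
  · intro h
    obtain ⟨t, ht, hts⟩ := (csInf_lt_iff hbdd hne).1 h
    exact Γ.mem_cone_of_le ht hts.le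

/-- The strict epigraph is the preimage of a convex cone by an affine map. Convexity is what gives
the Lipschitz regularity of the boundary. -/
lemma convexOn_height : ConvexOn ℝ univ Γ.height := by
  refine convexOn_iff_forall_pos.2 ⟨convex_univ, ?_⟩
  intro x _ y _ a c ha hc hac
  refine le_of_forall_pos_lt_add fun ε hε => ?_
  have hx : Γ.base x + (Γ.height x + ε) • Γ.o.vec ∈ cone Γ.V := Γ.mem_cone_iff.2 (by linarith)
  have hy : Γ.base y + (Γ.height y + ε) • Γ.o.vec ∈ cone Γ.V := Γ.mem_cone_iff.2 (by linarith)
  have h := geodConvex_iff.1 Γ.convex _ (smul_mem_cone hx ha) _ (smul_mem_cone hy hc)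
  rw [← Γ.mem_cone_iff]
  have hb : Γ.base (a • x + c • y) = a • Γ.base x + c • Γ.base y := by
    simp only [base, PiLp.add_apply, PiLp.smul_apply, smul_eq_mul, add_smul, mul_smul,
      Finset.sum_add_distrib, ← Finset.smul_sum, smul_add]
    have hp : a • Γ.p.vec + c • Γ.p.vec = Γ.p.vec := by rw [← add_smul, hac, one_smul]
    nth_rewrite 1 [← hp]
    abel
  convert h using 1
  rw [hb, show a • Γ.height x + c • Γ.height y + ε =
    a * (Γ.height x + ε) + c * (Γ.height y + ε) by
      simp only [smul_eq_mul]; linear_combination (-ε) * hac]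
  module

/-- The parametrization of the boundary of the cone. -/
def lift (z : EuclideanSpace ℝ (Fin d)) : Fin (d + 2) → ℝ := Γ.base z + Γ.height z • Γ.o.vec

lemma locallyLipschitz_height : LocallyLipschitz Γ.height := Γ.convexOn_height.locallyLipschitz

lemma contDiff_base : ContDiff ℝ 1 Γ.base := by unfold base; fun_prop

lemma locallyLipschitz_lift : LocallyLipschitz Γ.lift := by
  intro z
  obtain ⟨K₁, t₁, ht₁, h₁⟩ := Γ.contDiff_base.locallyLipschitz z
  obtain ⟨K₂, t₂, ht₂, h₂⟩ := Γ.locallyLipschitz_height z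
  refine ⟨K₁ + K₂ * ‖Γ.o.vec‖₊, t₁ ∩ t₂, inter_mem ht₁ ht₂,
    LipschitzOnWith.of_dist_le_mul fun x hx y hy => ?_⟩
  have e₁ := h₁.dist_le_mul x hx.1 y hy.1
  have e₂ := h₂.dist_le_mul x hx.2 y hy.2
  refine (dist_add_add_le _ _ _ _).trans ?_
  rw [dist_eq_norm (Γ.height x • Γ.o.vec), ← sub_smul, norm_smul, ← dist_eq_norm]
  push_cast
  rw [add_mul]
  refine add_le_add e₁ ?_
  rw [mul_right_comm]
  exact mul_le_mul_of_nonneg_right e₂ (norm_nonneg _)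

@[fun_prop]
lemma continuous_lift : Continuous Γ.lift := Γ.locallyLipschitz_lift.continuous

lemma lift_notMem (z : EuclideanSpace ℝ (Fin d)) : Γ.lift z ∉ cone Γ.V := fun h =>
  (Γ.mem_cone_iff.1 h).false

lemma lift_mem_closure (z : EuclideanSpace ℝ (Fin d)) : Γ.lift z ∈ closure (cone Γ.V) := by
  have hc : Continuous fun s : ℝ => Γ.base z + s • Γ.o.vec := by fun_prop
  refine mem_closure_of_tendsto (b := 𝓝[>] (Γ.height z))
    ((hc.tendsto (Γ.height z)).mono_left nhdsWithin_le_nhds) ?_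
  filter_upwards [self_mem_nhdsWithin] with s hs
  exact Γ.mem_cone_iff.2 hs

lemma normalize_lift_mem {z : EuclideanSpace ℝ (Fin d)} (hz : Γ.lift z ∈ futureCone (d + 1)) :
    normalize (Γ.lift z) ∈ frontier Γ.V := by
  rw [Γ.isOpen.frontier_eq]
  exact ⟨(mem_closure_cone hz).1 (Γ.lift_mem_closure z), fun h => Γ.lift_notMem z ⟨hz, h⟩⟩

/-- The projection to the hyperplane. -/
def proj (x : Fin (d + 2) → ℝ) : EuclideanSpace ℝ (Fin d) :=
  WithLp.toLp 2 fun i => Γ.zet i x / Γ.lam x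

lemma proj_smul_lift {c : ℝ} (hc : 0 < c) (z : EuclideanSpace ℝ (Fin d)) :
    Γ.proj (c • Γ.lift z) = z := by
  ext i
  have := Γ.coord_base z (Γ.height z)
  simp only [proj, lift, map_smul, this.1, this.2, smul_eq_mul, mul_one]
  exact mul_div_cancel_left₀ _ hc.ne'

lemma lift_proj {x : HypSpace (d + 1)} (hx : x ∈ frontier Γ.V) (hl : 0 < Γ.lam x.vec) :
    x.vec = Γ.lam x.vec • Γ.lift (Γ.proj x.vec) := by
  rw [Γ.isOpen.frontier_eq] at hx
  set z := Γ.proj x.vec with hz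
  set s := Γ.sig x.vec / Γ.lam x.vec with hs
  have h1 : x.vec = Γ.lam x.vec • (Γ.base z + s • Γ.o.vec) := by
    conv_lhs => rw [Γ.expand x.vec]
    have : ∀ i, Γ.lam x.vec • z i • Γ.b i = Γ.zet i x.vec • Γ.b i := fun i => by
      rw [smul_smul]
      congr 1
      simp only [hz, proj]
      field_simp
    rw [base, smul_add, smul_add, Finset.smul_sum, smul_smul, hs, mul_div_cancel₀ _ hl.ne']
    simp only [this]
    abel
  -- Above the graph `x` would be in the open cone; below it, adding a small multiple of `o` to this
  -- point of the closure could not give a point of the cone.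
  have h2 : s = Γ.height z := by
    apply le_antisymm
    · by_contra! h
      refine hx.2 (vec_mem_cone.1 ?_)
      rw [h1]
      exact smul_mem_cone (Γ.mem_cone_iff.2 h) hl
    · refine le_of_forall_pos_le_add fun ε hε => le_of_lt ?_
      rw [← Γ.mem_cone_iff]
      have := add_mem_cone_of_mem_closure Γ.isOpen Γ.convex (vec_mem_closure_cone.2 hx.1)
        (smul_vec_mem_cone Γ.ho (mul_pos hl hε))
      have h3 : x.vec + (Γ.lam x.vec * ε) • Γ.o.vec =
          Γ.lam x.vec • (Γ.base z + (s + ε) • Γ.o.vec) := by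
        conv_lhs => enter [1]; rw [h1]
        module
      rwa [h3, smul_mem_cone_iff hl] at this
  conv_lhs => rw [h1, h2]
  rfl

lemma contDiffAt_proj {x : Fin (d + 2) → ℝ} (hx : Γ.lam x ≠ 0) : ContDiffAt ℝ 1 Γ.proj x := by
  rw [contDiffAt_euclidean]
  intro i
  exact (Γ.zet i).contDiff.contDiffAt.div Γ.lam.contDiff.contDiffAt hx

end GraphFrame

end Graph

/-! ### Oriented Lipschitz charts given by the graphs. -/

section GraphChart

variable {d n : ℕ}

/-- A point of the open cone can be pushed a little in the direction of `v`, where the weak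
inequality still holds. -/
lemma normal_lt {V : Set (HypSpace n)} (hV : IsOpen V) {v : Fin (n + 1) → ℝ}
    (hvv : lorentz v v = 1) (hn : ∀ q ∈ V, lorentz v q.vec ≤ 0) {x : Fin (n + 1) → ℝ}
    (hx : x ∈ cone V) : lorentz v x < 0 := by
  have ho : IsOpen {s : ℝ | x + s • v ∈ cone V} :=
    (isOpen_cone hV).preimage (by fun_prop : Continuous fun s : ℝ => x + s • v)
  have h0 : ∀ᶠ s : ℝ in 𝓝[>] 0, x + s • v ∈ cone V :=
    mem_nhdsWithin_of_mem_nhds (ho.mem_nhds (by simpa using hx))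
  obtain ⟨s, hs, hs0⟩ := (h0.and self_mem_nhdsWithin).exists
  replace hs0 : 0 < s := hs0
  obtain ⟨c, hc, hcn⟩ := exists_normalize hs.1
  have h1 := hn _ hs.2
  rw [hcn, lorentz_smul_right, lorentz_add_right, lorentz_smul_right, hvv] at h1
  have h2 : c * (lorentz v x + s * 1) ≤ c * 0 := by linarith
  have := le_of_mul_le_mul_left h2 hc
  linarith

lemma normal_le {V : Set (HypSpace n)} {v : Fin (n + 1) → ℝ}
    (hn : ∀ q ∈ V, lorentz v q.vec ≤ 0) {x : Fin (n + 1) → ℝ}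
    (hx : x ∈ closure (cone V)) : lorentz v x ≤ 0 := by
  refine closure_minimal (fun y hy => ?_)
    (isClosed_le (f := fun y => lorentz v y) (g := fun _ => (0 : ℝ)) (by fun_prop) (by fun_prop)) hx
  change lorentz v y ≤ 0
  rw [← smul_normalize hy.1, lorentz_smul_right]
  exact mul_nonpos_of_nonneg_of_nonpos (Real.sqrt_nonneg _) (hn _ hy.2)

/-- The linear form defined by a vector. -/
def lorentzCLM (v : Fin (n + 1) → ℝ) : (Fin (n + 1) → ℝ) →L[ℝ] ℝ :=
  LinearMap.toContinuousLinearMap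
    { toFun := fun x => lorentz v x
      map_add' := lorentz_add_right v
      map_smul' := fun c x => lorentz_smul_right c v x }

lemma lorentzCLM_apply (v x : Fin (n + 1) → ℝ) : lorentzCLM v x = lorentz v x := rfl

/-- The factor of the radial projection. -/
def radialFactor (x : Fin (n + 1) → ℝ) : ℝ := (√(-lorentz x x))⁻¹

lemma radialFactor_pos {x : Fin (n + 1) → ℝ} (hx : x ∈ futureCone n) : 0 < radialFactor x :=
  inv_pos.2 (Real.sqrt_pos.2 (by linarith [hx.1]))

lemma contDiffAt_radialFactor {x : Fin (n + 1) → ℝ} (hx : x ∈ futureCone n) :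
    ContDiffAt ℝ 1 (radialFactor (n := n)) x := by
  have h0 : 0 < -lorentz x x := by linarith [hx.1]
  have h1 : ContDiffAt ℝ 1 (fun x : Fin (n + 1) → ℝ => -lorentz x x) x := by
    unfold lorentz; fun_prop
  exact (h1.sqrt h0.ne').inv (Real.sqrt_pos.2 h0).ne'

namespace GraphFrame

variable (Γ : GraphFrame d)

/-- The chart of the boundary given by the graph. -/
def chart (G : Set (HypSpace (d + 1))) (hG : IsOpen G) (hp : Γ.p ∈ G) :
    OpenPartialHomeomorph ↥(G ∩ frontier Γ.V) (EuclideanSpace ℝ (Fin d)) where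
  toFun x := Γ.proj x.1.vec
  -- Off the target the value `p` is arbitrary.
  invFun z := open Classical in
    if h : normalize (Γ.lift z) ∈ G ∩ frontier Γ.V then ⟨_, h⟩ else ⟨Γ.p, hp, Γ.hp⟩
  source := {x | 0 < Γ.lam x.1.vec}
  target := {z | Γ.lift z ∈ futureCone (d + 1) ∧ normalize (Γ.lift z) ∈ G}
  map_source' := by
    intro x hx
    have h := Γ.lift_proj x.2.2 hx
    have h1 : Γ.lift (Γ.proj x.1.vec) = (Γ.lam x.1.vec)⁻¹ • x.1.vec := by
      conv_rhs => enter [2]; rw [h]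
      rw [smul_smul, inv_mul_cancel₀ (ne_of_gt hx), one_smul]
    have hpos : 0 < (Γ.lam x.1.vec)⁻¹ := inv_pos.2 hx
    constructor
    · rw [h1]
      exact smul_mem_futureCone x.1.vec_mem_futureCone hpos
    · rw [h1, normalize_smul_vec _ hpos]
      exact x.2.1
  map_target' := by
    intro z hz
    have h : normalize (Γ.lift z) ∈ G ∩ frontier Γ.V := ⟨hz.2, Γ.normalize_lift_mem hz.1⟩
    obtain ⟨c, hc, hn⟩ := exists_normalize hz.1
    rw [dif_pos h]
    change 0 < Γ.lam (normalize (Γ.lift z)).vec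
    rw [hn, map_smul, lift, (Γ.coord_base z _).1, smul_eq_mul, mul_one]
    exact hc
  left_inv' := by
    intro x hx
    have h := Γ.lift_proj x.2.2 hx
    have h1 : Γ.lift (Γ.proj x.1.vec) = (Γ.lam x.1.vec)⁻¹ • x.1.vec := by
      conv_rhs => enter [2]; rw [h]
      rw [smul_smul, inv_mul_cancel₀ (ne_of_gt hx), one_smul]
    have hpos : 0 < (Γ.lam x.1.vec)⁻¹ := inv_pos.2 hx
    have h2 : normalize (Γ.lift (Γ.proj x.1.vec)) = x.1 := by rw [h1, normalize_smul_vec _ hpos]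
    rw [dif_pos (by rw [h2]; exact x.2)]
    exact Subtype.ext h2
  right_inv' := by
    intro z hz
    have h : normalize (Γ.lift z) ∈ G ∩ frontier Γ.V := ⟨hz.2, Γ.normalize_lift_mem hz.1⟩
    obtain ⟨c, hc, hn⟩ := exists_normalize hz.1
    rw [dif_pos h]
    change Γ.proj (normalize (Γ.lift z)).vec = z
    rw [hn, Γ.proj_smul_lift hc]
  open_source := isOpen_lt continuous_const (by fun_prop)
  open_target := by
    have : IsOpen (Γ.lift ⁻¹' (futureCone (d + 1) ∩ normalize ⁻¹' G)) :=
      (continuousOn_normalize.isOpen_inter_preimage isOpen_futureCone hG).preimage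
        Γ.continuous_lift
    exact this
  continuousOn_toFun := by
    intro x hx
    have h1 : ContinuousAt Γ.proj x.1.vec := (Γ.contDiffAt_proj (ne_of_gt hx)).continuousAt
    exact (h1.comp (f := fun x : ↥(G ∩ frontier Γ.V) => x.1.vec)
      (by fun_prop)).continuousWithinAt
  continuousOn_invFun := by
    rw [IsInducing.subtypeVal.continuousOn_iff]
    have h1 : ContinuousOn (fun z => normalize (Γ.lift z))
        {z | Γ.lift z ∈ futureCone (d + 1) ∧ normalize (Γ.lift z) ∈ G} :=
      continuousOn_normalize.comp Γ.continuous_lift.continuousOn fun z hz => hz.1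
    refine h1.congr fun z hz => ?_
    have h : normalize (Γ.lift z) ∈ G ∩ frontier Γ.V := ⟨hz.2, Γ.normalize_lift_mem hz.1⟩
    rw [Function.comp_apply, dif_pos h]

variable {G : Set (HypSpace (d + 1))} {hG : IsOpen G} {hp : Γ.p ∈ G}

lemma chart_symm_val {z : EuclideanSpace ℝ (Fin d)} (hz : z ∈ (Γ.chart G hG hp).target) :
    ((Γ.chart G hG hp).symm z).1 = normalize (Γ.lift z) := by
  have h : normalize (Γ.lift z) ∈ G ∩ frontier Γ.V := ⟨hz.2, Γ.normalize_lift_mem hz.1⟩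
  exact congrArg Subtype.val (dif_pos h)

lemma hasFDerivAt_base (z : EuclideanSpace ℝ (Fin d)) : HasFDerivAt Γ.base
    (∑ i, (EuclideanSpace.proj i : EuclideanSpace ℝ (Fin d) →L[ℝ] ℝ).smulRight (Γ.b i)) z := by
  have h := (∑ i, (EuclideanSpace.proj i : EuclideanSpace ℝ (Fin d) →L[ℝ] ℝ).smulRight
    (Γ.b i)).hasFDerivAt (x := z) |>.const_add Γ.p.vec
  have heq : Γ.base = fun x => Γ.p.vec + (∑ i, (EuclideanSpace.proj i :
      EuclideanSpace ℝ (Fin d) →L[ℝ] ℝ).smulRight (Γ.b i)) x := by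
    funext x
    simp [base]
  rw [heq]
  exact h

lemma hasFDerivAt_lift {z : EuclideanSpace ℝ (Fin d)} (h : DifferentiableAt ℝ Γ.height z) :
    DifferentiableAt ℝ Γ.lift z ∧ ∀ i, fderiv ℝ Γ.lift z (EuclideanSpace.single i 1) =
      Γ.b i + fderiv ℝ Γ.height z (EuclideanSpace.single i 1) • Γ.o.vec := by
  have h1 := (Γ.hasFDerivAt_base z).add (h.hasFDerivAt.smul_const Γ.o.vec)
  refine ⟨h1.differentiableAt, fun i => ?_⟩
  rw [show Γ.lift = Γ.base + fun z => Γ.height z • Γ.o.vec from rfl, h1.fderiv]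
  simp

/-- Modulo `lift z` and the tangent vectors of the graph, `y` is a multiple `ℓ` of `o`. Pairing with
a normal vector `v` shows `ℓ > 0`, since `V` is strictly on one side. The determinant is then `ℓ`
times that of the frame, which is negative. -/
lemma volForm_lift_neg {z : EuclideanSpace ℝ (Fin d)} (hz : Γ.lift z ∈ futureCone (d + 1))
    (h : DifferentiableAt ℝ Γ.height z) {y : HypSpace (d + 1)} (hy : y ∈ Γ.V) :
    volForm (Γ.lift z) y.vec (fun i => fderiv ℝ Γ.lift z (EuclideanSpace.single i 1)) < 0 := by
  obtain ⟨hd, hw⟩ := Γ.hasFDerivAt_lift h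
  obtain ⟨v, ⟨hv1, hv2⟩, hn⟩ := exists_normal Γ.isOpen Γ.convex (Γ.normalize_lift_mem hz)
  have hvl : lorentz v (Γ.lift z) = 0 := by
    rw [← smul_normalize hz, lorentz_smul_right, lorentz_comm v, hv1, mul_zero]
  have hvw : ∀ e, lorentz v (fderiv ℝ Γ.lift z e) = 0 := by
    -- The whole graph is on the nonpositive side of `v` and touches it at `z`, so the tangent
    -- vectors are orthogonal to `v`.
    have hmax : IsLocalMax (fun z' => lorentzCLM v (Γ.lift z')) z := by
      refine Eventually.of_forall fun z' => ?_
      change lorentz v (Γ.lift z') ≤ lorentz v (Γ.lift z)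
      rw [hvl]
      exact normal_le hn (Γ.lift_mem_closure z')
    have h0 := hmax.hasFDerivAt_eq_zero
      ((lorentzCLM v).hasFDerivAt.comp z hd.hasFDerivAt)
    intro e
    exact congrArg (fun L => L e) h0
  have hvo : lorentz v Γ.o.vec < 0 := normal_lt Γ.isOpen hv2 hn (vec_mem_cone.2 Γ.ho)
  have hvy : lorentz v y.vec < 0 := normal_lt Γ.isOpen hv2 hn (vec_mem_cone.2 hy)
  set w : Fin d → Fin (d + 2) → ℝ :=
    fun i => fderiv ℝ Γ.lift z (EuclideanSpace.single i 1) with hw'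
  set f' : Fin d → ℝ := fun i => fderiv ℝ Γ.height z (EuclideanSpace.single i 1) with hf'
  set l := Γ.lam y.vec
  have hex := Γ.expand y.vec
  obtain ⟨ℓ, hℓ⟩ : ∃ ℓ : ℝ, y.vec = (l • Γ.lift z + ℓ • Γ.o.vec) +
      ∑ i, (Γ.zet i y.vec - l * z i) • w i := by
    refine ⟨Γ.sig y.vec - l * Γ.height z - ∑ i, (Γ.zet i y.vec - l * z i) * f' i, ?_⟩
    have e1 : ∑ i, (Γ.zet i y.vec - l * z i) • w i = (∑ i, Γ.zet i y.vec • Γ.b i) -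
        l • (∑ i, z i • Γ.b i) + (∑ i, (Γ.zet i y.vec - l * z i) * f' i) • Γ.o.vec := by
      rw [Finset.sum_smul, Finset.smul_sum, ← Finset.sum_sub_distrib, ← Finset.sum_add_distrib]
      refine Finset.sum_congr rfl fun i _ => ?_
      rw [hw', hf']
      simp only [hw i]
      module
    rw [e1, lift, base]
    conv_lhs => rw [hex]
    module
  have hℓpos : 0 < ℓ := by
    have e2 := congrArg (lorentzCLM v) hℓ
    simp only [map_add, map_smul, map_sum, lorentzCLM_apply, hvl, hw', hvw, smul_eq_mul, mul_zero,
      Finset.sum_const_zero, zero_add, add_zero] at e2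
    rw [e2] at hvy
    exact pos_of_mul_neg_left hvy hvo.le
  -- A shear: adding multiples of `o` to the first row and to the tangent rows does not change the
  -- determinant, nor does adding the `b i` to the first row.
  have e3 : volForm (Γ.lift z) Γ.o.vec w = volForm Γ.p.vec Γ.o.vec Γ.b := by
    have : w = fun i => Γ.b i + f' i • Γ.o.vec := funext hw
    rw [this, lift, volForm_shift_second, base, volForm_add_left, volForm_sum_left, add_zero]
  rw [hℓ, volForm_add_right, volForm_combination, volForm_sum_right, add_zero, e3]
  exact mul_neg_of_pos_of_neg hℓpos Γ.neg

/-- The chart and its inverse are compositions of `C¹` maps with `lift`, hence locally Lipschitz for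
position vectors, hence for the hyperbolic distance. The orientation is computed where `height` is
differentiable. -/
lemma isBoundaryChart_chart : IsBoundaryChart Subtype.val Γ.V (Γ.chart G hG hp) where
  isOpen := Γ.isOpen
  convex := Γ.convex
  mapsTo := fun x _ => x.2.2
  biLipschitz := by
    intro x hx
    replace hx : 0 < Γ.lam x.1.vec := hx
    set z₀ := Γ.proj x.1.vec with hz₀
    have hT : Γ.lift z₀ ∈ futureCone (d + 1) := ((Γ.chart G hG hp).map_source hx).1
    obtain ⟨C, hC, N, hN, hb⟩ := exists_hdist_bounds x.1
    obtain ⟨K₂, t₂, ht₂, h₂⟩ := (Γ.contDiffAt_proj hx.ne').exists_lipschitzOnWith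
    obtain ⟨K₃, t₃, ht₃, h₃⟩ :=
      ((contDiffAt_radialFactor hT).smul contDiffAt_id).exists_lipschitzOnWith
    obtain ⟨K₄, t₄, ht₄, h₄⟩ := Γ.locallyLipschitz_lift z₀
    have c1 : ContinuousAt (fun y : ↥(G ∩ frontier Γ.V) => Γ.proj y.1.vec) x :=
      ContinuousAt.comp (f := fun y : ↥(G ∩ frontier Γ.V) => y.1.vec)
        (Γ.contDiffAt_proj hx.ne').continuousAt (by fun_prop)
    have c2 : ContinuousAt (fun y : ↥(G ∩ frontier Γ.V) => Γ.lift (Γ.proj y.1.vec)) x :=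
      Γ.continuous_lift.continuousAt.comp c1
    have n1 : ∀ᶠ y : ↥(G ∩ frontier Γ.V) in 𝓝 x, y.1 ∈ N :=
      continuous_subtype_val.continuousAt.eventually hN
    have c0 : ContinuousAt (fun y : ↥(G ∩ frontier Γ.V) => y.1.vec) x := by fun_prop
    have n2 := c0.eventually ht₂
    have n3 := c2.eventually ht₃
    have n4 := c1.eventually ht₄
    have key : ∀ y : ↥(G ∩ frontier Γ.V), 0 < Γ.lam y.1.vec →
        y.1.vec = radialFactor (Γ.lift (Γ.proj y.1.vec)) • Γ.lift (Γ.proj y.1.vec) := by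
      intro y hy
      have e1 := (Γ.chart G hG hp).map_source hy
      have e2 := Γ.chart_symm_val e1
      rw [(Γ.chart G hG hp).left_inv hy] at e2
      conv_lhs => rw [e2]
      exact normalize_vec e1.1
    refine ⟨C * (K₃ * K₄) + K₂ * C + 1, by positivity, _, ((n1.and n2).and n3).and n4, ?_⟩
    rintro y ⟨⟨⟨⟨y1, y2⟩, y3⟩, y4⟩, hy⟩ z ⟨⟨⟨⟨z1, z2⟩, z3⟩, z4⟩, hz⟩
    have hb1 := hb _ y1 _ z1
    have hd0 := hdist_nonneg y.1 z.1
    have e4 := h₄.dist_le_mul _ y4 _ z4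
    have e3 := h₃.dist_le_mul _ y3 _ z3
    have e2 := h₂.dist_le_mul _ y2 _ z2
    have e3' : dist y.1.vec z.1.vec ≤
        K₃ * dist (Γ.lift (Γ.proj y.1.vec)) (Γ.lift (Γ.proj z.1.vec)) := by
      simp only [Pi.smul_apply', id_eq] at e3
      rwa [← key y hy, ← key z hz] at e3
    change _ ≤ _ * dist (Γ.proj y.1.vec) (Γ.proj z.1.vec) ∧
      dist (Γ.proj y.1.vec) (Γ.proj z.1.vec) ≤ _
    have hD : 0 ≤ dist (Γ.proj y.1.vec) (Γ.proj z.1.vec) := dist_nonneg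
    constructor
    · calc hdist y.1 z.1 ≤ C * dist y.1.vec z.1.vec := hb1.1
        _ ≤ C * (K₃ * (K₄ * dist (Γ.proj y.1.vec) (Γ.proj z.1.vec))) := by
          gcongr
          exact e3'.trans (by gcongr)
        _ = C * (K₃ * K₄) * dist (Γ.proj y.1.vec) (Γ.proj z.1.vec) := by ring
        _ ≤ _ := by
          gcongr
          have : 0 ≤ K₂ * C := by positivity
          linarith
    · calc dist (Γ.proj y.1.vec) (Γ.proj z.1.vec) ≤ K₂ * dist y.1.vec z.1.vec := e2
        _ ≤ K₂ * (C * hdist y.1 z.1) := by gcongr; exact hb1.2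
        _ = K₂ * C * hdist y.1 z.1 := by ring
        _ ≤ _ := by
          gcongr
          have : 0 ≤ C * (K₃ * K₄) := by positivity
          linarith
  oriented := by
    have hae := (LocallyLipschitz.locallyLipschitzOn (s := univ)
      Γ.locallyLipschitz_height).ae_differentiableAt
      (μ := (volume : Measure (EuclideanSpace ℝ (Fin d)))) isOpen_univ
    filter_upwards [hae] with z hz hzt y hy
    replace hz := hz (mem_univ z)
    have hT : Γ.lift z ∈ futureCone (d + 1) := hzt.1
    obtain ⟨hdl, -⟩ := Γ.hasFDerivAt_lift hz
    have hμd : DifferentiableAt ℝ (fun w => radialFactor (Γ.lift w)) z :=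
      ((contDiffAt_radialFactor hT).differentiableAt one_ne_zero).comp z hdl
    have heq : (fun w => ((Γ.chart G hG hp).symm w).1.vec) =ᶠ[𝓝 z]
        fun w => radialFactor (Γ.lift w) • Γ.lift w := by
      filter_upwards [(Γ.chart G hG hp).open_target.mem_nhds hzt] with w hw
      rw [Γ.chart_symm_val hw, normalize_vec hw.1]
      rfl
    set μ := radialFactor (Γ.lift z) with hμ
    have hμpos : 0 < μ := radialFactor_pos hT
    have heq₀ : ((Γ.chart G hG hp).symm z).1.vec = μ • Γ.lift z := heq.self_of_nhds
    rw [jacobianDet, heq.fderiv_eq, heq₀,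
      show (fun w => radialFactor (Γ.lift w) • Γ.lift w) =
        (fun w => radialFactor (Γ.lift w)) • Γ.lift from rfl,
        (hμd.hasFDerivAt.smul hdl.hasFDerivAt).fderiv]
    set α := fderiv ℝ (fun w => radialFactor (Γ.lift w)) z
    -- Differentiating the radial factor only adds multiples of the first row; what remains is a
    -- positive scaling.
    have hrow : (fun i : Fin d => (radialFactor (Γ.lift z) • fderiv ℝ Γ.lift z +
        α.smulRight (Γ.lift z)) (EuclideanSpace.single i 1)) = fun i : Fin d =>
        μ • fderiv ℝ Γ.lift z (EuclideanSpace.single i 1) +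
          (α (EuclideanSpace.single i 1) / μ) • (μ • Γ.lift z) := by
      funext i
      rw [smul_smul, div_mul_cancel₀ _ hμpos.ne']
      rfl
    rw [hrow, volForm_shift_first, volForm_smul]
    exact mul_neg_of_pos_of_neg (by positivity) (Γ.volForm_lift_neg hT hz hy)

end GraphFrame

lemma exists_isBoundaryChart_val (hd : 1 ≤ d) {V G : Set (HypSpace (d + 1))} (hV : IsOpen V)
    (hc : GeodConvex V) (hG : IsOpen G) (x : ↥(G ∩ frontier V)) :
    ∃ κ, IsBoundaryChart (Subtype.val : ↥(G ∩ frontier V) → HypSpace (d + 1)) V κ ∧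
      x ∈ κ.source := by
  obtain ⟨p, hpG, hp⟩ := x
  have hp' := hp
  rw [hV.frontier_eq] at hp'
  obtain ⟨o, ho⟩ := closure_nonempty_iff.1 ⟨p, hp'.1⟩
  obtain ⟨b, hb⟩ := exists_volForm_neg hd (p := p) (o := o) fun h => hp'.2 (h ▸ ho)
  let Γ : GraphFrame d := ⟨V, hV, hc, p, hp, o, ho, b, hb⟩
  refine ⟨Γ.chart G hG hpG, Γ.isBoundaryChart_chart, ?_⟩
  change 0 < Γ.lam Γ.p.vec
  have h0 : Γ.basis 0 = Γ.p.vec := by rw [Γ.basis_apply]; rfl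
  have : Γ.lam Γ.p.vec = 1 := by
    rw [← h0]
    change Γ.basis.coord 0 (Γ.basis 0) = 1
    simp
  rw [this]
  exact one_pos

/-- Every open subset of the boundary of an open convex set carries a convex embedding. -/
theorem exists_isConvexEmbeddingOn (hd : 1 ≤ d) {V G : Set (HypSpace (d + 1))} (hV : IsOpen V)
    (hc : GeodConvex V) (hG : IsOpen G) :
    ∃ O : OrientedLipschitzAtlas ↥(G ∩ frontier V) d,
      IsConvexEmbeddingOn O (Subtype.val : ↥(G ∩ frontier V) → HypSpace (d + 1)) univ V := by
  let 𝓕 : Set ((↥(G ∩ frontier V) → HypSpace (d + 1)) × Set (HypSpace (d + 1)) ×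
      OpenPartialHomeomorph ↥(G ∩ frontier V) (EuclideanSpace ℝ (Fin d))) :=
    {a | a.1 = Subtype.val ∧ a.2.1 = V ∧ IsBoundaryChart a.1 a.2.1 a.2.2}
  refine ⟨atlasOfBoundaryCharts hd 𝓕 (fun a ha => ha.2.2) (fun x => ?_) ?_, ?_⟩
  · obtain ⟨κ, hκ, hx⟩ := exists_isBoundaryChart_val hd hV hc hG x
    exact ⟨(Subtype.val, V, κ), ⟨rfl, rfl, hκ⟩, hx⟩
  · rintro ⟨φ, W, κ⟩ ⟨(rfl : φ = _), (rfl : W = V), -⟩ ⟨φ', W', κ'⟩ ⟨(rfl : φ' = _),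
      (rfl : W' = W), -⟩ x -
    exact AgreeAt.refl _ _ _
  · refine isConvexEmbeddingOn_of_agreeAt hd ?_ isOpen_univ ?_ hV hc
      ⟨G, hG, by rw [image_univ, Subtype.range_val]⟩
    · rintro _ ⟨⟨φ, W, κ⟩, ⟨(rfl : φ = _), (rfl : W = V), h⟩, rfl⟩
      exact ⟨_, _, h, fun x _ => AgreeAt.refl _ _ _⟩
    · exact IsEmbedding.subtypeVal.comp IsEmbedding.subtypeVal

end GraphChart

/-! ### Transport of the boundary charts by embeddings. -/

section Restriction

variable {M : Type*} [TopologicalSpace M] {d : ℕ}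

/-- An embedding of an open subset, as a partial homeomorphism. -/
lemma exists_openPartialHomeomorph {Y : Type*} [TopologicalSpace Y] {φ : M → Y} {S : Set M}
    (hS : IsOpen S) (hemb : IsEmbedding (S.domRestrict φ)) {T : Set Y} (himage : φ '' S = T)
    (hne : S.Nonempty) : ∃ e : OpenPartialHomeomorph M T, e.source = S ∧ e.target = univ ∧
      ∀ y ∈ S, (e y).1 = φ y := by
  have hne' : Nonempty S := hne.to_subtype
  have hr : range (S.domRestrict φ) = T := by rw [range_domRestrict, himage]
  let h : S ≃ₜ T := hemb.toHomeomorph.trans (Homeomorph.setCongr hr)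
  let e₀ := hS.isOpenEmbedding_subtypeVal.toOpenPartialHomeomorph (Subtype.val : S → M)
  have hsrc : e₀.target = S := by simp [e₀]
  refine ⟨e₀.symm.trans h.toOpenPartialHomeomorph, ?_, ?_, fun y hy => ?_⟩
  · simp [hsrc]
  · simp [e₀]
  · have h1 : (e₀.symm y).1 = y := e₀.right_inv (by rw [hsrc]; exact hy)
    change φ (e₀.symm y).1 = φ y
    rw [h1]

lemma exists_isBoundaryChart (hd : 1 ≤ d) {V G : Set (HypSpace (d + 1))} (hV : IsOpen V)
    (hc : GeodConvex V) (hG : IsOpen G) {φ : M → HypSpace (d + 1)} {S : Set M}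
    (hS : IsOpen S) (hemb : IsEmbedding (S.domRestrict φ)) (himage : φ '' S = G ∩ frontier V)
    {x : M} (hx : x ∈ S) : ∃ κ, IsBoundaryChart φ V κ ∧ x ∈ κ.source ∧ κ.source ⊆ S := by
  obtain ⟨e, hes, het, he⟩ := exists_openPartialHomeomorph hS hemb himage ⟨x, hx⟩
  obtain ⟨κ, hκ, hxκ⟩ := exists_isBoundaryChart_val hd hV hc hG (e x)
  have hsub : (e.trans κ).source ⊆ S := fun y hy => hes ▸ hy.1
  have hxe : x ∈ e.source := by rw [hes]; exact hx
  refine ⟨e.trans κ, ⟨hV, hc, fun y hy => ?_, fun y hy => ?_, ?_⟩, ⟨hxe, hxκ⟩, hsub⟩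
  · rw [← he y (hsub hy)]
    exact (e y).2.2
  · obtain ⟨C, hC, N, hN, hb⟩ := hκ.biLipschitz (e y) hy.2
    refine ⟨C, hC, _, (e.continuousAt hy.1).preimage_mem_nhds hN, ?_⟩
    rintro a ⟨ha, ha'⟩ b ⟨hb1, hb'⟩
    rw [← he a (hsub ha'), ← he b (hsub hb')]
    exact hb _ ⟨ha, ha'.2⟩ _ ⟨hb1, hb'.2⟩
  · have heq : (fun w => (φ ((e.trans κ).symm w)).vec) = fun w => ((κ.symm w).1).vec := by
      funext w
      have h1 : κ.symm w ∈ e.target := het ▸ mem_univ _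
      have h2 := he _ (hes ▸ e.map_target h1)
      rw [e.right_inv h1] at h2
      rw [h2]
      rfl
    rw [heq]
    filter_upwards [hκ.oriented] with z hz hzt y hy
    exact hz hzt.1 y hy

lemma AgreeAt.closure_imp {φ φ' : M → HypSpace (d + 1)} {V V' : Set (HypSpace (d + 1))} {x : M}
    (h : AgreeAt φ V φ' V' x) (hx : φ x ∈ closure V) : φ' x ∈ closure V' := by
  obtain ⟨g, hg, h1, h2⟩ := h
  rw [h1.self_of_nhds]
  refine mem_closure_of_frequently_of_tendsto ?_ (hg.continuous.tendsto (φ x))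
  exact ((mem_closure_iff_frequently.1 hx).and_eventually h2).mono fun q hq => hq.2.1 hq.1

lemma AgreeAt.mem_closure_iff {φ φ' : M → HypSpace (d + 1)} {V V' : Set (HypSpace (d + 1))}
    {x : M} (h : AgreeAt φ V φ' V' x) : φ x ∈ closure V ↔ φ' x ∈ closure V' :=
  ⟨h.closure_imp, h.symm.closure_imp⟩

lemma AgreeAt.comp {M' : Type*} [TopologicalSpace M'] {φ φ' : M → HypSpace (d + 1)}
    {V V' : Set (HypSpace (d + 1))} {f : M' → M} {x : M'} (hf : ContinuousAt f x)
    (h : AgreeAt φ V φ' V' (f x)) : AgreeAt (φ ∘ f) V (φ' ∘ f) V' x := by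
  obtain ⟨g, hg, h1, h2⟩ := h
  exact ⟨g, hg, hf.eventually h1, h2⟩

lemma Topology.IsEmbedding.domRestrict_mono {Y : Type*} [TopologicalSpace Y] {φ : M → Y}
    {S T : Set M} (h : IsEmbedding (T.domRestrict φ)) (hST : S ⊆ T) :
    IsEmbedding (S.domRestrict φ) :=
  h.comp (IsEmbedding.inclusion hST)

end Restriction

/-! ### Concave atlases -/

section Concave

variable {X : Type u} [TopologicalSpace X] {d : ℕ}

/-- The image of the chart `c` is the part over `G` of the development of the boundary of `V`. -/
structure HypChart.IsDevelopment (c : HypChart X d) (V G : Set (HypSpace (d + 1))) : Prop where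
  isOpen : IsOpen V
  convex : GeodConvex V
  isOpen_base : IsOpen G
  embedding : IsEmbedding (c.source.domRestrict c.toFun)
  image : c.toFun '' c.source = development V G

lemma IsConcaveAtlas.exists_isDevelopment {A : Set (HypChart X d)} (hA : IsConcaveAtlas A)
    {c : HypChart X d} (hc : c ∈ A) : ∃ V G, c.IsDevelopment V G := by
  obtain ⟨H, _, O, ψ, V, hψ, himage⟩ := hA.image c hc
  obtain ⟨G, hG, hG'⟩ := hψ.image_open
  rw [image_univ] at hG'
  exact ⟨V, G, hψ.isOpen, hψ.convex, hG, hA.embedding c hc,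
    himage.trans (concaveDevelopment_eq hψ.isOpen hψ.convex hG')⟩

namespace HypChart.IsDevelopment

variable {c : HypChart X d} {V G : Set (HypSpace (d + 1))}

/-- Converse of `exists_isDevelopment`, with `G ∩ frontier V` as parameter space; it certifies the
charts of the glued manifold. -/
lemma exists_image (hd : 1 ≤ d) (h : c.IsDevelopment V G) :
    ∃ (H : Type) (_ : TopologicalSpace H) (O : OrientedLipschitzAtlas H d)
      (ψ : H → HypSpace (d + 1)) (V : Set (HypSpace (d + 1))),
      IsConvexEmbeddingOn O ψ univ V ∧ c.toFun '' c.source = concaveDevelopment ψ V := by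
  obtain ⟨O, hO⟩ := exists_isConvexEmbeddingOn hd h.isOpen h.convex h.isOpen_base
  refine ⟨_, _, O, _, V, hO, ?_⟩
  rw [h.image, concaveDevelopment_eq h.isOpen h.convex Subtype.range_val]

lemma map_mem (h : c.IsDevelopment V G) {x : X} (hx : x ∈ c.source) :
    c.toFun x ∈ development V G := h.image ▸ mem_image_of_mem _ hx

lemma injOn (h : c.IsDevelopment V G) : InjOn c.toFun c.source :=
  injOn_iff_injective.2 h.embedding.injective

lemma continuousOn (h : c.IsDevelopment V G) : ContinuousOn c.toFun c.source :=
  continuousOn_iff_continuous_domRestrict.2 h.embedding.continuous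

lemma continuousAt (h : c.IsDevelopment V G) {x : X} (hx : x ∈ c.source) :
    ContinuousAt c.toFun x := h.continuousOn.continuousAt (c.isOpen_source.mem_nhds hx)

lemma exists_isOpen_image (h : c.IsDevelopment V G) {O : Set X} (hO : IsOpen O) :
    ∃ P, IsOpen P ∧ c.source ∩ c.toFun ⁻¹' P = c.source ∩ O := by
  obtain ⟨P, hP, hP'⟩ := h.embedding.isInducing.isOpen_iff.1 (hO.preimage continuous_subtype_val)
  refine ⟨P, hP, ?_⟩
  ext y
  refine and_congr_right fun hy => ?_
  have : (⟨y, hy⟩ : c.source) ∈ c.source.domRestrict c.toFun ⁻¹' P ↔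
      (⟨y, hy⟩ : c.source) ∈ (Subtype.val ⁻¹' O : Set c.source) := by rw [hP']
  exact this

/-- The chart is locally onto the complement of the convex set. -/
lemma eventually_exists (h : c.IsDevelopment V G) {O : Set X} {x : X} (hx : x ∈ c.source)
    (hO : O ∈ 𝓝 x) : ∀ᶠ q in 𝓝 (c.toFun x), q ∉ V → ∃ y ∈ O ∩ c.source, c.toFun y = q := by
  obtain ⟨P, hP, hPO⟩ := h.exists_isOpen_image (isOpen_interior (s := O))
  have hxP : x ∈ c.source ∩ c.toFun ⁻¹' P := hPO ▸ ⟨hx, mem_interior_iff_mem_nhds.2 hO⟩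
  filter_upwards [eventually_mem_development h.convex h.isOpen_base (h.map_mem hx),
    hP.mem_nhds hxP.2] with q hq hqP hqV
  obtain ⟨y, hy, rfl⟩ : q ∈ c.toFun '' c.source := h.image ▸ hq hqV
  have hy' : y ∈ c.source ∩ interior O := hPO ▸ ⟨hy, hqP⟩
  exact ⟨y, ⟨interior_subset hy'.2, hy⟩, rfl⟩

lemma notMem_interior_iff (h : c.IsDevelopment V G) {x : X} (hx : x ∈ c.source) :
    c.toFun x ∉ interior (c.toFun '' c.source) ↔ c.toFun x ∈ closure V := by
  rw [h.image, mem_interior_development h.convex h.isOpen_base (h.map_mem hx), not_not]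

end HypChart.IsDevelopment

variable {A : Set (HypChart X d)}

/-- Near the common point, each point outside `V` is the image of a point of both domains, so its
image by `g` is in the second chart, outside `V'`; and symmetrically. The germ of the convex set is
thus determined by the end itself. -/
lemma HypChart.IsDevelopment.eventually_mem_iff {c c' : HypChart X d}
    {V G V' G' : Set (HypSpace (d + 1))} (h : c.IsDevelopment V G)
    (h' : c'.IsDevelopment V' G') {g : HypSpace (d + 1) → HypSpace (d + 1)}
    (hg : IsOrientedIsometry g) (hgc : ∀ x ∈ c.source ∩ c'.source, c'.toFun x = g (c.toFun x))
    {x : X} (hx : x ∈ c.source ∩ c'.source) : ∀ᶠ q in 𝓝 (c.toFun x), q ∈ V ↔ g q ∈ V' := by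
  have hopen := (c.isOpen_source.inter c'.isOpen_source).mem_nhds hx
  have ht : Tendsto g (𝓝 (c.toFun x)) (𝓝 (c'.toFun x)) := by
    rw [hgc x hx]
    exact hg.continuous.tendsto _
  filter_upwards [h.eventually_exists hx.1 hopen,
    ht.eventually (h'.eventually_exists hx.2 hopen)] with q hq hq'
  constructor
  · intro hqV
    by_contra hgq
    obtain ⟨y, ⟨hy, -⟩, hyq⟩ := hq' hgq
    rw [hgc y hy] at hyq
    exact (h.map_mem hy.1).1 (hg.injective hyq ▸ hqV)
  · intro hgq
    by_contra hqV
    obtain ⟨y, ⟨hy, -⟩, hyq⟩ := hq hqV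
    refine (h'.map_mem hy.2).1 ?_
    rwa [hgc y hy, hyq]

lemma IsConcaveAtlas.agreeAt (hA : IsConcaveAtlas A) {c c' : HypChart X d} (hc : c ∈ A)
    (hc' : c' ∈ A) {V G V' G' : Set (HypSpace (d + 1))} (h : c.IsDevelopment V G)
    (h' : c'.IsDevelopment V' G') {x : X} (hx : x ∈ c.source ∩ c'.source) :
    AgreeAt c.toFun V c'.toFun V' x := by
  obtain ⟨g, hg, hgc⟩ := hA.compatible c hc c' hc'
  refine ⟨g, hg, ?_, h.eventually_mem_iff h' hg hgc hx⟩
  filter_upwards [(c.isOpen_source.inter c'.isOpen_source).mem_nhds hx] with y hy using hgc y hy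

/-- Interior points of a development are those off the closure of `V`, and by `agreeAt` the
criterion does not depend on the chart. -/
lemma IsConcaveAtlas.mem_pleatedBoundary_iff (hA : IsConcaveAtlas A) {c : HypChart X d}
    (hc : c ∈ A) {V G : Set (HypSpace (d + 1))} (h : c.IsDevelopment V G) {x : X}
    (hx : x ∈ c.source) : x ∈ pleatedBoundary A ↔ c.toFun x ∈ closure V := by
  constructor
  · rintro ⟨c', hc', hx', hint⟩
    obtain ⟨V', G', h'⟩ := hA.exists_isDevelopment hc'
    rw [h'.notMem_interior_iff hx'] at hint
    exact (hA.agreeAt hc hc' h h' ⟨hx, hx'⟩).mem_closure_iff.2 hint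
  · intro hcl
    exact ⟨c, hc, hx, (h.notMem_interior_iff hx).2 hcl⟩

lemma IsConcaveAtlas.isClosed_pleatedBoundary (hA : IsConcaveAtlas A) :
    IsClosed (pleatedBoundary A) := by
  rw [← isOpen_compl_iff, isOpen_iff_mem_nhds]
  intro x hx
  obtain ⟨c, hc, hxc⟩ := hA.cover x
  obtain ⟨V, G, h⟩ := hA.exists_isDevelopment hc
  rw [mem_compl_iff, hA.mem_pleatedBoundary_iff hc h hxc] at hx
  filter_upwards [c.isOpen_source.mem_nhds hxc,
    (h.continuousAt hxc).eventually (isClosed_closure.isOpen_compl.mem_nhds hx)] with y hy hy'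
  rw [mem_compl_iff, hA.mem_pleatedBoundary_iff hc h hy]
  exact hy'

lemma IsConcaveAtlas.image_pleatedBoundary (hA : IsConcaveAtlas A) {c : HypChart X d}
    (hc : c ∈ A) {V G : Set (HypSpace (d + 1))} (h : c.IsDevelopment V G) :
    (fun x : pleatedBoundary A => c.toFun x) '' (Subtype.val ⁻¹' c.source) = G ∩ frontier V := by
  ext q
  constructor
  · rintro ⟨x, hx, rfl⟩
    have h1 := (hA.mem_pleatedBoundary_iff hc h hx).1 x.2
    have h2 := h.map_mem hx
    refine ⟨mem_of_mem_development h2 h1, ?_⟩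
    rw [h.isOpen.frontier_eq]
    exact ⟨h1, h2.1⟩
  · intro hq
    obtain ⟨x, hx, rfl⟩ : q ∈ c.toFun '' c.source :=
      h.image ▸ self_mem_development h.isOpen hq
    exact ⟨⟨x, (hA.mem_pleatedBoundary_iff hc h hx).2 (frontier_subset_closure hq.2)⟩, hx, rfl⟩

lemma HypChart.IsDevelopment.embedding_restrict {c : HypChart X d}
    {V G : Set (HypSpace (d + 1))} (h : c.IsDevelopment V G) (S : Set X) :
    IsEmbedding ((Subtype.val ⁻¹' c.source : Set S).domRestrict fun x : S => c.toFun x) := by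
  have h1 : IsEmbedding fun x : (Subtype.val ⁻¹' c.source : Set S) =>
      (⟨x.1.1, x.2⟩ : c.source) := by
    have := IsEmbedding.subtypeVal.comp
      (IsEmbedding.subtypeVal (p := (· ∈ (Subtype.val ⁻¹' c.source : Set S))))
    exact IsEmbedding.of_comp (by fun_prop) continuous_subtype_val this
  exact h.embedding.comp h1

/-- The Lipschitz structure of the pleated boundary. -/
lemma IsConcaveAtlas.exists_orientedLipschitzAtlas (hd : 1 ≤ d) (hA : IsConcaveAtlas A) :
    ∃ O : OrientedLipschitzAtlas (pleatedBoundary A) d, ∀ N : Set (pleatedBoundary A), IsOpen N →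
      ∀ c ∈ A, ∀ V G, c.IsDevelopment V G → N ⊆ Subtype.val ⁻¹' c.source →
      ∀ (φ' : pleatedBoundary A → HypSpace (d + 1)) (V' : Set (HypSpace (d + 1))),
        IsOpen V' → GeodConvex V' → (∃ G', IsOpen G' ∧ φ' '' N = G' ∩ frontier V') →
        IsEmbedding (N.domRestrict φ') →
        (∀ x ∈ N, AgreeAt (fun x : pleatedBoundary A => c.toFun x) V φ' V' x) →
        IsConvexEmbeddingOn O φ' N V' := by
  -- All graph charts subordinate to some chart of `A` are admitted, so that the atlas involves no
  -- choice of `V` or `G`.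
  let 𝓕 : Set ((pleatedBoundary A → HypSpace (d + 1)) × Set (HypSpace (d + 1)) ×
      OpenPartialHomeomorph (pleatedBoundary A) (EuclideanSpace ℝ (Fin d))) :=
    {a | IsBoundaryChart a.1 a.2.1 a.2.2 ∧ ∃ c ∈ A, ∃ G, c.IsDevelopment a.2.1 G ∧
      a.1 = (fun x : pleatedBoundary A => c.toFun x.1) ∧ a.2.2.source ⊆ Subtype.val ⁻¹' c.source}
  have hag : ∀ c ∈ A, ∀ c' ∈ A, ∀ V V' G G', c.IsDevelopment V G → c'.IsDevelopment V' G' →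
      ∀ x : pleatedBoundary A, x.1 ∈ c.source → x.1 ∈ c'.source →
      AgreeAt (fun x : pleatedBoundary A => c.toFun x) V (fun x => c'.toFun x) V' x := by
    intro c hc c' hc' V V' G G' h h' x hx hx'
    exact (hA.agreeAt hc hc' h h' ⟨hx, hx'⟩).comp continuous_subtype_val.continuousAt
  refine ⟨atlasOfBoundaryCharts hd 𝓕 (fun a ha => ha.1) (fun x => ?_) ?_, ?_⟩
  · obtain ⟨c, hc, hx⟩ := hA.cover x.1
    obtain ⟨V, G, h⟩ := hA.exists_isDevelopment hc
    obtain ⟨κ, hκ, hxκ, hκs⟩ := exists_isBoundaryChart hd h.isOpen h.convex h.isOpen_base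
      (c.isOpen_source.preimage continuous_subtype_val) (h.embedding_restrict (pleatedBoundary A))
      (hA.image_pleatedBoundary hc h) (x := x) hx
    exact ⟨((fun x : pleatedBoundary A => c.toFun x), V, κ), ⟨hκ, c, hc, G, h, rfl, hκs⟩, hxκ⟩
  · rintro ⟨φ, V, κ⟩ ⟨-, c, hc, G, h, (rfl : φ = _), hκ⟩ ⟨φ', V', κ'⟩
      ⟨-, c', hc', G', h', (rfl : φ' = _), hκ'⟩ x ⟨hx, hx'⟩
    exact hag c hc c' hc' V V' G G' h h' x (hκ hx) (hκ' hx')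
  · intro N hN c hc V G h hNc φ' V' hV' hcV' himage hemb hagree
    refine isConvexEmbeddingOn_of_agreeAt hd ?_ hN hemb hV' hcV' himage
    rintro _ ⟨⟨φ, W, κ⟩, ⟨hb, c', hc', G', h', (rfl : φ = _), hκ⟩, rfl⟩
    refine ⟨_, W, hb, fun x hx => ?_⟩
    exact (hag c' hc' c hc W V G' G h' h x (hκ hx.2) (hNc hx.1)).trans (hagree x hx.1)

/-! ### Geodesic segments in the boundary. -/

/-- `p` is in the interior of a geodesic segment of the closure of `V`. -/
def HypSpace.IsInnerPoint {n : ℕ} (V : Set (HypSpace n)) (p : HypSpace n) : Prop :=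
  ∃ v, IsUnitTangent p v ∧ ∃ ε : ℝ, 0 < ε ∧ ∀ t ∈ Ioo (-ε) ε, expMap p v t ∈ closure V

/-- If the segment entered `V` at time `t`, then `p`, the midpoint between the times `t` and `-t`,
would be in `V`. -/
lemma HypSpace.expMap_mem_frontier {n : ℕ} {V : Set (HypSpace n)} (hV : IsOpen V)
    (hc : GeodConvex V) {p : HypSpace n} (hp : p ∈ frontier V) {v : Fin (n + 1) → ℝ}
    (hv : IsUnitTangent p v) {ε : ℝ} (h : ∀ t ∈ Ioo (-ε) ε, expMap p v t ∈ closure V) {t : ℝ}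
    (ht : t ∈ Ioo (-ε) ε) : expMap p v t ∈ frontier V := by
  rw [hV.frontier_eq] at hp ⊢
  refine ⟨h t ht, fun hmem => hp.2 ?_⟩
  have h2 := add_mem_cone_of_mem_closure hV hc
    (vec_mem_closure_cone.2 (h (-t) ⟨by linarith [ht.2], by linarith [ht.1]⟩))
    (vec_mem_cone.2 hmem)
  rw [expMap_vec hv, expMap_vec hv, Real.cosh_neg, Real.sinh_neg] at h2
  have h3 : Real.cosh t • p.vec + -Real.sinh t • v + (Real.cosh t • p.vec + Real.sinh t • v) =
      (2 * Real.cosh t) • p.vec := by module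
  rw [h3, smul_mem_cone_iff (by positivity)] at h2
  exact vec_mem_cone.1 h2

/-- A short piece of the segment stays in `G ∩ frontier V`, where the inverse of the restricted
chart lifts it. -/
lemma IsConcaveAtlas.exists_curve (hA : IsConcaveAtlas A) {c : HypChart X d} (hc : c ∈ A)
    {V G : Set (HypSpace (d + 1))} (h : c.IsDevelopment V G) {x : pleatedBoundary A}
    (hx : x.1 ∈ c.source) (hin : IsInnerPoint V (c.toFun x)) :
    ∃ (ε : ℝ) (γ : ℝ → pleatedBoundary A), 0 < ε ∧ ContinuousOn γ (Ioo (-ε) ε) ∧ γ 0 = x ∧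
      ∃ v, IsUnitTangent (c.toFun x) v ∧ ∀ t ∈ Ioo (-ε) ε, (γ t).1 ∈ c.source ∧
        c.toFun (γ t) = expMap (c.toFun x) v t := by
  obtain ⟨v, hv, ε, hε, hseg⟩ := hin
  obtain ⟨e, hes, het, he⟩ := exists_openPartialHomeomorph
    (φ := fun x : pleatedBoundary A => c.toFun x)
    (c.isOpen_source.preimage continuous_subtype_val) (h.embedding_restrict (pleatedBoundary A))
    (hA.image_pleatedBoundary hc h) ⟨x, hx⟩
  have hx0 : c.toFun x ∈ G ∩ frontier V := by rw [← he x hx]; exact (e x).2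
  have hG : ∀ᶠ t in 𝓝 (0 : ℝ), expMap (c.toFun x) v t ∈ G := by
    refine (continuous_expMap hv).continuousAt.eventually (h.isOpen_base.mem_nhds ?_)
    rw [expMap_zero]
    exact hx0.1
  obtain ⟨δ, hδ, hδG⟩ := Metric.eventually_nhds_iff.1 hG
  have hmem : ∀ t ∈ Ioo (-min ε δ) (min ε δ), expMap (c.toFun x) v t ∈ G ∩ frontier V := by
    intro t ht
    have h1 : |t| < min ε δ := abs_lt.2 ht
    refine ⟨hδG (by rw [Real.dist_eq, sub_zero]; exact h1.trans_le (min_le_right _ _)), ?_⟩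
    exact expMap_mem_frontier h.isOpen h.convex hx0.2 hv hseg
      (abs_lt.1 (h1.trans_le (min_le_left _ _)))
  classical
  let f : ℝ → ↥(G ∩ frontier V) := fun t =>
    if h : expMap (c.toFun x) v t ∈ G ∩ frontier V then ⟨_, h⟩ else ⟨_, hx0⟩
  have hf : ∀ t ∈ Ioo (-min ε δ) (min ε δ), (f t).1 = expMap (c.toFun x) v t := fun t ht =>
    congrArg Subtype.val (dif_pos (hmem t ht))
  have hfc : ContinuousOn f (Ioo (-min ε δ) (min ε δ)) := by
    rw [IsInducing.subtypeVal.continuousOn_iff]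
    exact (continuous_expMap hv).continuousOn.congr hf
  have hpos : 0 < min ε δ := lt_min hε hδ
  have hsymm : ∀ q, e.symm q ∈ (Subtype.val ⁻¹' c.source : Set (pleatedBoundary A)) ∧
      c.toFun (e.symm q) = q.1 := by
    intro q
    have h1 : q ∈ e.target := het ▸ mem_univ _
    have h2 := hes ▸ e.map_target h1
    refine ⟨h2, ?_⟩
    rw [← he _ h2, e.right_inv h1]
  refine ⟨min ε δ, fun t => e.symm (f t), hpos, ?_, ?_, v, hv, fun t ht => ?_⟩
  · exact e.continuousOn_symm.comp hfc fun t _ => het ▸ mem_univ _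
  · have h0 : f 0 = e x := by
      apply Subtype.ext
      rw [hf 0 ⟨by linarith, hpos⟩, expMap_zero, he x hx]
    change e.symm (f 0) = x
    rw [h0, e.left_inv (hes ▸ hx)]
  · exact ⟨(hsymm _).1, by rw [(hsymm _).2, hf t ht]⟩

end Concave

/-! ### Extension to maximal atlases. -/

lemma IsHypEmbeddingAtlas.exists_maximal {M : Type u} [TopologicalSpace M] {d : ℕ}
    {O : OrientedLipschitzAtlas M d} {B : Set (HypChart M d)} (hB : IsHypEmbeddingAtlas O B) :
    ∃ B', B ⊆ B' ∧ IsHypEmbeddingStructure O B' := by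
  refine zorn_subset_nonempty {B | IsHypEmbeddingAtlas O B} (fun C hC hchain hne => ?_) B hB
  refine ⟨⋃₀ C, ⟨fun x => ?_, ?_, ?_⟩, fun s hs => subset_sUnion_of_mem hs⟩
  · obtain ⟨s, hs⟩ := hne
    obtain ⟨c, hc, hx⟩ := IsHypEmbeddingAtlas.cover (hC hs) x
    exact ⟨c, ⟨s, hs, hc⟩, hx⟩
  · rintro c ⟨s, hs, hc⟩
    exact IsHypEmbeddingAtlas.embedding (hC hs) c hc
  · rintro c ⟨s, hs, hc⟩ c' ⟨s', hs', hc'⟩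
    rcases hchain.total hs hs' with h | h
    · exact IsHypEmbeddingAtlas.compatible (hC hs') c (h hc) c' hc'
    · exact IsHypEmbeddingAtlas.compatible (hC hs) c hc c' (h hc')

lemma IsConcaveAtlas.exists_maximal {X : Type u} [TopologicalSpace X] {d : ℕ}
    {A : Set (HypChart X d)} (hA : IsConcaveAtlas A) :
    ∃ A', A ⊆ A' ∧ Maximal IsConcaveAtlas A' := by
  refine zorn_subset_nonempty {B | IsConcaveAtlas B} (fun C hC hchain hne => ?_) A hA
  refine ⟨⋃₀ C, ⟨fun x => ?_, ?_, ?_, ?_⟩, fun s hs => subset_sUnion_of_mem hs⟩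
  · obtain ⟨s, hs⟩ := hne
    obtain ⟨c, hc, hx⟩ := IsConcaveAtlas.cover (hC hs) x
    exact ⟨c, ⟨s, hs, hc⟩, hx⟩
  · rintro c ⟨s, hs, hc⟩
    exact IsConcaveAtlas.embedding (hC hs) c hc
  · rintro c ⟨s, hs, hc⟩
    exact IsConcaveAtlas.image (hC hs) c hc
  · rintro c ⟨s, hs, hc⟩ c' ⟨s', hs', hc'⟩
    rcases hchain.total hs hs' with h | h
    · exact IsConcaveAtlas.compatible (hC hs') c (h hc) c' hc'
    · exact IsConcaveAtlas.compatible (hC hs) c hc c' (h hc')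

lemma HypSpace.IsOrientedIsometry.exists_homeomorph {n : ℕ} {g : HypSpace n → HypSpace n}
    (hg : IsOrientedIsometry g) :
    ∃ e : HypSpace n ≃ₜ HypSpace n, ⇑e = g ∧ IsOrientedIsometry e.symm := by
  obtain ⟨k, hk, hl, hr⟩ := hg.exists_inverse
  exact ⟨⟨⟨g, k, hl, hr⟩, hg.continuous, hk.continuous⟩, rfl, hk⟩

/-! ### Assembly of the convex ruled structure. -/

section Boundary

variable {X : Type u} [TopologicalSpace X] {d : ℕ} {A : Set (HypChart X d)}

/-- If all points of the boundary are inner points of segments of the boundary, then the boundary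
carries a convex ruled hyperbolic embedding structure. -/
lemma IsConcaveAtlas.exists_convexRuled (hd : 1 ≤ d) (hA : IsConcaveAtlas A)
    (hin : ∀ c ∈ A, ∀ V G, c.IsDevelopment V G → ∀ x ∈ pleatedBoundary A, x ∈ c.source →
      IsInnerPoint V (c.toFun x)) :
    ∃ (O : OrientedLipschitzAtlas (pleatedBoundary A) d)
      (B : Set (HypChart (pleatedBoundary A) d)),
      IsHypEmbeddingStructure O B ∧ IsConvexRuled O B ∧
        ∀ c ∈ A, c.restrictTo (pleatedBoundary A) ∈ B := by
  obtain ⟨O, hO⟩ := hA.exists_orientedLipschitzAtlas hd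
  have hB₀ : IsHypEmbeddingAtlas O ((fun c => c.restrictTo (pleatedBoundary A)) '' A) := by
    refine ⟨fun x => ?_, ?_, ?_⟩
    · obtain ⟨c, hc, hx⟩ := hA.cover x
      exact ⟨_, mem_image_of_mem _ hc, hx⟩
    · rintro _ ⟨c, hc, rfl⟩
      obtain ⟨V, G, h⟩ := hA.exists_isDevelopment hc
      exact (hO _ (c.restrictTo _).isOpen_source c hc V G h Subset.rfl _ V h.isOpen h.convex
        ⟨G, h.isOpen_base, hA.image_pleatedBoundary hc h⟩ (h.embedding_restrict _)
        fun x _ => AgreeAt.refl _ _ _).lipschitz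
    · rintro _ ⟨c, hc, rfl⟩ _ ⟨c', hc', rfl⟩ x hx
      obtain ⟨g, hg, hgc⟩ := hA.compatible c hc c' hc'
      refine ⟨g, hg, ?_⟩
      filter_upwards [((c.restrictTo _).isOpen_source.inter
        (c'.restrictTo _).isOpen_source).mem_nhds hx] with y hy using hgc y hy
  obtain ⟨B, hB₀B, hB⟩ := hB₀.exists_maximal
  refine ⟨O, B, hB, fun b hb => ?_, fun c hc => hB₀B (mem_image_of_mem _ hc)⟩
  -- Maximality may add charts to those of the end, but compatibility makes each of them locally an
  -- isometry composed with a chart of the end. Local convexity and ruling are then transported by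
  -- the isometry.
  have key : ∀ x ∈ b.source, ∃ c ∈ A, ∃ g, IsOrientedIsometry g ∧ ∃ N ⊆ b.source, IsOpen N ∧
      x ∈ N ∧ N ⊆ Subtype.val ⁻¹' c.source ∧ ∀ y ∈ N, b.toFun y = g (c.toFun y) := by
    intro x hx
    obtain ⟨c, hc, hxc⟩ := hA.cover x
    obtain ⟨g, hg, hgb⟩ := hB.prop.compatible _ (hB₀B (mem_image_of_mem _ hc)) b hb x ⟨hxc, hx⟩
    obtain ⟨N, hN, hNo, hxN⟩ := mem_nhds_iff.1 (inter_mem (inter_mem (b.isOpen_source.mem_nhds hx)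
      ((c.restrictTo _).isOpen_source.mem_nhds hxc)) hgb)
    exact ⟨c, hc, g, hg, N, fun y hy => (hN hy).1.1, hNo, hxN, fun y hy => (hN hy).1.2,
      fun y hy => (hN hy).2⟩
  constructor
  · intro x hx
    obtain ⟨c, hc, g, hg, N, hNb, hN, hxN, hNc, hbg⟩ := key x hx
    obtain ⟨V, G, h⟩ := hA.exists_isDevelopment hc
    obtain ⟨e, rfl, he⟩ := hg.exists_homeomorph
    refine ⟨N, hNb, hxN, e.symm ⁻¹' V, hO N hN c hc V G h hNc b.toFun _
      (h.isOpen.preimage e.symm.continuous) (he.geodConvex_preimage h.convex) ?_ ?_ ?_⟩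
    · obtain ⟨N', hN', rfl⟩ := isOpen_induced_iff.1 hN
      obtain ⟨P, hP, hPN⟩ := h.exists_isOpen_image hN'
      refine ⟨e.symm ⁻¹' (P ∩ G), (hP.inter h.isOpen_base).preimage e.symm.continuous, ?_⟩
      rw [← Homeomorph.preimage_frontier, ← preimage_inter, inter_assoc,
        ← hA.image_pleatedBoundary hc h]
      ext q
      constructor
      · rintro ⟨y, hy, rfl⟩
        have hyP : y.1 ∈ c.source ∩ c.toFun ⁻¹' P := hPN ▸ ⟨hNc hy, hy⟩
        have hq : e.symm (b.toFun y) = c.toFun y := by rw [hbg y hy, e.symm_apply_apply]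
        exact ⟨hq ▸ hyP.2, y, hyP.1, hq.symm⟩
      · rintro ⟨hqP, y, hy, hyq⟩
        have hyP : y.1 ∈ c.source ∩ N' := by
          rw [← hPN]
          have hyq' : c.toFun y.1 = e.symm q := hyq
          refine ⟨hy, ?_⟩
          rw [mem_preimage, hyq']
          exact hqP
        refine ⟨y, hyP.2, ?_⟩
        rw [hbg y hyP.2]
        exact (congrArg e hyq).trans (e.apply_symm_apply q)
    · have h1 : N.domRestrict b.toFun =
          e ∘ N.domRestrict fun x : pleatedBoundary A => c.toFun x := by
        funext y
        exact hbg y y.2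
      rw [h1]
      exact e.isEmbedding.comp ((h.embedding_restrict _).domRestrict_mono hNc)
    · intro y hy
      refine ⟨e, hg, ?_, Eventually.of_forall fun q => ?_⟩
      · filter_upwards [hN.mem_nhds hy] with z hz using hbg z hz
      · change q ∈ V ↔ e.symm (e q) ∈ V
        rw [e.symm_apply_apply]
  · intro x hx
    obtain ⟨c, hc, g, hg, N, hNb, hN, hxN, hNc, hbg⟩ := key x hx
    obtain ⟨V, G, h⟩ := hA.exists_isDevelopment hc
    obtain ⟨ε, γ, hε, hγc, hγ0, v, hv, hγ⟩ :=
      hA.exists_curve hc h (hNc hxN) (hin c hc V G h x x.2 (hNc hxN))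
    have hγ0' : ContinuousAt γ 0 := hγc.continuousAt (Ioo_mem_nhds (by linarith) hε)
    obtain ⟨δ, hδ, hδN⟩ := Metric.eventually_nhds_iff.1
      (hγ0'.eventually (hN.mem_nhds (hγ0.symm ▸ hxN)))
    obtain ⟨w, hw, hgw⟩ := hg.isExp_map hv
    have hsub : Ioo (-min ε δ) (min ε δ) ⊆ Ioo (-ε) ε :=
      Ioo_subset_Ioo (neg_le_neg (min_le_left _ _)) (min_le_left _ _)
    have hmem : ∀ t ∈ Ioo (-min ε δ) (min ε δ), γ t ∈ N := by
      intro t ht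
      refine hδN ?_
      rw [Real.dist_eq, sub_zero]
      exact (abs_lt.2 ht).trans_le (min_le_right _ _)
    refine ⟨min ε δ, γ, lt_min hε hδ, hγc.mono hsub, fun s hs t ht hst => ?_,
      fun t ht => hNb (hmem t ht), hγ0, w, ?_, fun t ht => ?_⟩
    · have h1 := (hγ s (hsub hs)).2
      rw [hst, (hγ t (hsub ht)).2] at h1
      exact (expMap_injective hv h1).symm
    · rw [hbg x hxN]
      exact hw
    · rw [hbg x hxN, isExp_iff hw, hbg _ (hmem t ht), (hγ t (hsub ht)).2, hgw]

end Boundary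

/-! ### Cutting a convex set near an extreme point -/

section Extreme

variable {F : Type*} [NormedAddCommGroup F] [NormedSpace ℝ F]

lemma IsCompact.convexJoin {s t : Set F} (hs : IsCompact s) (ht : IsCompact t) :
    IsCompact (convexJoin ℝ s t) := by
  have h := ((hs.prod ht).prod (isCompact_Icc (a := (0 : ℝ)) (b := 1))).image
    (f := fun a : (F × F) × ℝ => (1 - a.2) • a.1.1 + a.2 • a.1.2) (by fun_prop)
  convert h using 1
  ext x
  simp only [mem_convexJoin, segment_eq_image, mem_image, mem_prod, Prod.exists]
  constructor
  · rintro ⟨a, ha, b, hb, θ, hθ, rfl⟩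
    exact ⟨a, b, θ, ⟨⟨ha, hb⟩, hθ⟩, rfl⟩
  · rintro ⟨a, b, θ, ⟨⟨ha, hb⟩, hθ⟩, rfl⟩
    exact ⟨a, ha, b, hb, θ, hθ, rfl⟩

/-- An extreme point of a compact convex set has small slices as neighbourhoods. -/
lemma exists_slice_subset {S : Set F} (hS : IsCompact S) (hconv : Convex ℝ S) {p : F}
    (hp : p ∈ S.extremePoints ℝ) {U : Set F} (hU : IsOpen U) (hpU : p ∈ U) :
    ∃ (f : StrongDual ℝ F) (u : ℝ), u < f p ∧ ∀ x ∈ S, u ≤ f x → x ∈ U := by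
  obtain ⟨hpS, hpe⟩ := mem_extremePoints_iff_forall_segment.1 hp
  have hQ : IsCompact (S \ U) := hS.diff hU
  -- The part of `S` to be avoided is enclosed in a compact convex set missing `p`. This is clear
  -- for a small piece, and survives finite unions because the join of two convex subsets of `S`
  -- missing an extreme point still misses it.
  obtain ⟨C, hC, hCc, hCS, hQC, hpC⟩ : ∃ C : Set F, IsCompact C ∧ Convex ℝ C ∧ C ⊆ S ∧
      S \ U ⊆ C ∧ p ∉ C := by
    refine hQ.induction_on (p := fun s => ∃ C : Set F, IsCompact C ∧ Convex ℝ C ∧ C ⊆ S ∧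
      s ⊆ C ∧ p ∉ C) ⟨∅, isCompact_empty, convex_empty, empty_subset _, Subset.rfl, by simp⟩
      ?_ ?_ ?_
    · rintro s t hst ⟨C, h1, h2, h3, h4, h5⟩
      exact ⟨C, h1, h2, h3, hst.trans h4, h5⟩
    · rintro s t ⟨C, h1, h2, h3, h4, h5⟩ ⟨C', h1', h2', h3', h4', h5'⟩
      rcases C.eq_empty_or_nonempty with rfl | hne
      · exact ⟨C', h1', h2', h3', union_subset (h4.trans (empty_subset _)) h4', h5'⟩
      rcases C'.eq_empty_or_nonempty with rfl | hne'
      · exact ⟨C, h1, h2, h3, union_subset h4 (h4'.trans (empty_subset _)), h5⟩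
      refine ⟨convexJoin ℝ C C', h1.convexJoin h1', h2.convexJoin h2', ?_,
        union_subset (h4.trans (subset_convexJoin_left hne'))
          (h4'.trans (subset_convexJoin_right hne)), fun hmem => ?_⟩
      · intro x hx
        obtain ⟨a, ha, b, hb, hx⟩ := mem_convexJoin.1 hx
        exact hconv.segment_subset (h3 ha) (h3' hb) hx
      · obtain ⟨a, ha, b, hb, hx⟩ := mem_convexJoin.1 hmem
        rcases hpe a (h3 ha) b (h3' hb) hx with rfl | rfl
        · exact h5 ha
        · exact h5' hb
    · intro x hx
      have hxp : 0 < dist p x := dist_pos.2 fun h => hx.2 (h ▸ hpU)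
      refine ⟨_, inter_mem_nhdsWithin (S \ U) (Metric.closedBall_mem_nhds x (half_pos hxp)),
        S ∩ Metric.closedBall x (dist p x / 2), hS.inter_right Metric.isClosed_closedBall,
        hconv.inter (convex_closedBall _ _), inter_subset_left,
        inter_subset_inter_left _ sdiff_subset, fun h => ?_⟩
      have := Metric.mem_closedBall.1 h.2
      linarith
  obtain ⟨f, u, hu, hfp⟩ := geometric_hahn_banach_closed_point hCc hC.isClosed hpC
  refine ⟨f, u, hfp, fun x hx hux => ?_⟩
  by_contra hxU
  exact absurd (hu x (hQC ⟨hx, hxU⟩)) (not_lt.2 hux)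

end Extreme

namespace HypSpace

variable {n : ℕ}

lemma lorentz_self_pos_of_orthogonal (p : HypSpace n) {w : Fin (n + 1) → ℝ}
    (h : lorentz p.vec w = 0) (hw : w ≠ 0) : 0 < lorentz w w := by
  have h1 := p.lorentz_vec_self
  have h2 := Finset.sum_mul_sq_le_sq_mul_sq Finset.univ (fun i : Fin n => p.vec i.succ)
    fun i => w i.succ
  have hB : 0 ≤ ∑ i : Fin n, w i.succ ^ 2 := Finset.sum_nonneg fun i _ => sq_nonneg _
  have hp := p.vec_zero_pos
  unfold lorentz at *
  simp only [← pow_two] at *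
  by_contra hcon
  have h0 : w 0 = 0 := by
    rw [← sq_eq_zero_iff]
    refine le_antisymm ?_ (sq_nonneg _)
    have ha : 0 ≤ p.vec 0 ^ 2 - 1 := by
      have : 0 ≤ ∑ i : Fin n, p.vec i.succ ^ 2 := Finset.sum_nonneg fun i _ => sq_nonneg _
      linarith
    have h3 := mul_le_mul_of_nonneg_left (by linarith : ∑ i : Fin n, w i.succ ^ 2 ≤ w 0 ^ 2) ha
    rw [show ∑ i : Fin n, p.vec i.succ ^ 2 = p.vec 0 ^ 2 - 1 by linarith,
      show ∑ i : Fin n, p.vec i.succ * w i.succ = p.vec 0 * w 0 by linarith] at h2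
    linarith
  have hB0 : ∑ i : Fin n, w i.succ ^ 2 = 0 := by
    rw [h0] at hcon
    linarith
  rw [Finset.sum_eq_zero_iff_of_nonneg fun i _ => sq_nonneg _] at hB0
  refine hw (funext fun i => ?_)
  refine Fin.cases h0 (fun i => ?_) i
  exact sq_eq_zero_iff.1 (hB0 i (Finset.mem_univ i))

/-- The slices of the closed future cone by the spacelike hyperplanes are bounded. -/
lemma abs_le_of_mem_closure_futureCone (p : HypSpace n) {x : Fin (n + 1) → ℝ}
    (hx : x ∈ closure (futureCone n)) (i : Fin (n + 1)) :
    |x i| ≤ 2 * p.vec 0 * -lorentz p.vec x := by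
  refine closure_minimal (fun x hx => ?_) (isClosed_le (f := fun x : Fin (n + 1) → ℝ => |x i|)
    (g := fun x => 2 * p.vec 0 * -lorentz p.vec x) (by fun_prop) (by fun_prop)) hx
  change |x i| ≤ 2 * p.vec 0 * -lorentz p.vec x
  obtain ⟨hx1, hx0⟩ := hx
  have h1 := p.lorentz_vec_self
  have hp := p.vec_zero_pos
  have h2 := Finset.sum_mul_sq_le_sq_mul_sq Finset.univ (fun i : Fin n => p.vec i.succ)
    fun i => x i.succ
  have hi : |x i| ≤ x 0 := by
    refine abs_le_of_sq_le_sq ?_ hx0.le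
    refine Fin.cases le_rfl (fun i => ?_) i
    have h5 := Finset.single_le_sum (f := fun i : Fin n => x i.succ * x i.succ)
      (fun i _ => mul_self_nonneg _) (Finset.mem_univ i)
    rw [lorentz] at hx1
    nlinarith
  refine hi.trans ?_
  unfold lorentz at *
  simp only [← pow_two] at *
  set s := ∑ i : Fin n, p.vec i.succ * x i.succ
  set a := p.vec 0
  have ha : 1 ≤ a ^ 2 := by
    have : 0 ≤ ∑ i : Fin n, p.vec i.succ ^ 2 := Finset.sum_nonneg fun i _ => sq_nonneg _
    linarith
  have h3 : s ^ 2 ≤ (a ^ 2 - 1) * x 0 ^ 2 := by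
    refine h2.trans ?_
    rw [show ∑ i : Fin n, p.vec i.succ ^ 2 = a ^ 2 - 1 by linarith]
    exact mul_le_mul_of_nonneg_left (by linarith) (by linarith)
  have h4 : 2 * a * s ≤ (2 * a ^ 2 - 1) * x 0 := by
    refine le_of_sq_le_sq ?_ (mul_nonneg (by linarith) hx0.le)
    have h5 := mul_le_mul_of_nonneg_left h3 (by positivity : 0 ≤ 4 * a ^ 2)
    have h6 := sq_nonneg (x 0)
    nlinarith
  linarith

/-- The slice of the closure of a convex cone. -/
def slice (V : Set (HypSpace n)) (p : HypSpace n) : Set (Fin (n + 1) → ℝ) :=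
  {x ∈ closure (cone V) | lorentz p.vec x = -1}

lemma isCompact_slice (V : Set (HypSpace n)) (p : HypSpace n) : IsCompact (slice V p) := by
  refine Metric.isCompact_of_isClosed_isBounded (isClosed_closure.inter
    (isClosed_eq (f := fun x => lorentz p.vec x) (by fun_prop) continuous_const)) ?_
  refine (Metric.isBounded_closedBall (x := 0) (r := 2 * p.vec 0)).subset fun x hx => ?_
  rw [mem_closedBall_zero_iff, pi_norm_le_iff_of_nonneg (by have := p.vec_zero_pos; linarith)]
  intro i
  have := abs_le_of_mem_closure_futureCone p (closure_mono (fun y hy => hy.1) hx.1) i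
  rw [hx.2] at this
  simpa using this

lemma smul_mem_closure_cone_of_nonneg {V : Set (HypSpace n)} {x y : Fin (n + 1) → ℝ}
    (hc : GeodConvex V) (hx : x ∈ closure (cone V)) (hy : y ∈ closure (cone V)) {a b : ℝ}
    (ha : 0 ≤ a) (hb : 0 ≤ b) (hab : a + b = 1) : a • x + b • y ∈ closure (cone V) := by
  rcases ha.eq_or_lt with rfl | ha
  · simpa [show b = 1 by linarith] using hy
  rcases hb.eq_or_lt with rfl | hb
  · simpa [show a = 1 by linarith] using hx
  exact add_mem_closure_cone hc (smul_mem_closure_cone hx ha) (smul_mem_closure_cone hy hb)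

lemma convex_slice {V : Set (HypSpace n)} (hc : GeodConvex V) (p : HypSpace n) :
    Convex ℝ (slice V p) := by
  intro x hx y hy a b ha hb hab
  refine ⟨smul_mem_closure_cone_of_nonneg hc hx.1 hy.1 ha hb hab, ?_⟩
  rw [lorentz_add_right, lorentz_smul_right, lorentz_smul_right, hx.2, hy.2]
  linarith

/-- If `p` is strictly between `x` and `y` in the slice, then `x - y` is a nonzero spacelike tangent
vector at `p`, and the geodesic in this direction stays for a short time in the cone over the
segment from `x` to `y`. -/
lemma vec_mem_extremePoints_slice {V : Set (HypSpace n)} (hc : GeodConvex V) {p : HypSpace n}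
    (hp : p ∈ closure V) (hin : ¬ IsInnerPoint V p) :
    p.vec ∈ (slice V p).extremePoints ℝ := by
  refine mem_extremePoints_iff_left.2
    ⟨⟨vec_mem_closure_cone.2 hp, p.lorentz_vec_self⟩, ?_⟩
  rintro x hx y hy ⟨a, b, ha, hb, hab, hpab⟩
  by_contra hxp
  have hw0 : x - y ≠ 0 := by
    intro h
    rw [← sub_eq_zero.1 h, ← add_smul, hab, one_smul] at hpab
    exact hxp hpab
  have hpw : lorentz p.vec (x - y) = 0 := by
    rw [lorentz_sub_right, hx.2, hy.2, sub_self]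
  have hww := lorentz_self_pos_of_orthogonal p hpw hw0
  set r := √(lorentz (x - y) (x - y)) with hr
  have hr0 : 0 < r := Real.sqrt_pos.2 hww
  have hrr : r * r = lorentz (x - y) (x - y) := Real.mul_self_sqrt hww.le
  have hv : IsUnitTangent p (r⁻¹ • (x - y)) := by
    refine ⟨by rw [lorentz_smul_right, hpw, mul_zero], ?_⟩
    rw [lorentz_smul_right, lorentz_smul_left, ← hrr]
    field_simp
  have hcont : Continuous fun t : ℝ => Real.sinh t / Real.cosh t * r⁻¹ :=
    (Real.continuous_sinh.div Real.continuous_cosh fun t => (Real.cosh_pos t).ne').mul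
      continuous_const
  have hev : ∀ᶠ t in 𝓝 (0 : ℝ), Real.sinh t / Real.cosh t * r⁻¹ ∈ Ioo (-a) b :=
    hcont.continuousAt.eventually (Ioo_mem_nhds (by simp [ha]) (by simp [hb]))
  obtain ⟨ε, hε, hball⟩ := Metric.eventually_nhds_iff.1 hev
  refine hin ⟨_, hv, ε, hε, fun t ht => ?_⟩
  have hs := hball (show dist t 0 < ε by rw [Real.dist_eq, sub_zero]; exact abs_lt.2 ht)
  have hch := Real.cosh_pos t
  rw [← vec_mem_closure_cone, expMap_vec hv]
  have hcalc : Real.cosh t • p.vec + Real.sinh t • r⁻¹ • (x - y) =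
      Real.cosh t • ((a + Real.sinh t / Real.cosh t * r⁻¹) • x +
        (b - Real.sinh t / Real.cosh t * r⁻¹) • y) := by
    rw [← hpab]
    match_scalars <;> field_simp
    ring
  rw [hcalc]
  exact smul_mem_closure_cone (smul_mem_closure_cone_of_nonneg hc hx.1 hy.1
    (by linarith [hs.1]) (by linarith [hs.2]) (by linarith)) hch

/-- Extreme points can be cut off. -/
lemma exists_cap {V : Set (HypSpace n)} (hc : GeodConvex V) {p : HypSpace n}
    (hp : p ∈ closure V) (hin : ¬ IsInnerPoint V p) {O : Set (HypSpace n)} (hO : O ∈ 𝓝 p) :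
    ∃ l : (Fin (n + 1) → ℝ) →L[ℝ] ℝ, 0 < l p.vec ∧
      ∀ q ∈ closure V, 0 ≤ l q.vec → q ∈ O := by
  have hpo : p.vec ∈ interior (normalize ⁻¹' O) := by
    rw [mem_interior_iff_mem_nhds]
    refine (continuousAt_normalize p.vec_mem_futureCone).preimage_mem_nhds ?_
    rwa [normalize_vec_self]
  obtain ⟨f, u, hu, hf⟩ := exists_slice_subset (isCompact_slice V p) (convex_slice hc p)
    (vec_mem_extremePoints_slice hc hp hin) isOpen_interior hpo
  -- The affine function `f - u` on the slice, made linear by means of the equation `lorentz p.vec x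
  -- = -1` of the slice.
  refine ⟨f + u • lorentzCLM p.vec, ?_, fun q hq hlq => ?_⟩
  · change 0 < f p.vec + u * lorentz p.vec p.vec
    rw [lorentz_vec_self]
    linarith
  · have hpq : 0 < -lorentz p.vec q.vec := by have := one_le_neg_lorentz p q; linarith
    have hlq' : 0 ≤ f q.vec + u * lorentz p.vec q.vec := hlq
    have h1 := hf ((-lorentz p.vec q.vec)⁻¹ • q.vec)
      ⟨smul_mem_closure_cone (vec_mem_closure_cone.2 hq) (inv_pos.2 hpq), by
        rw [lorentz_smul_right, inv_neg, neg_mul, inv_mul_cancel₀ (neg_pos.1 hpq).ne]⟩ (by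
        rw [map_smul, smul_eq_mul, ← div_eq_inv_mul, le_div_iff₀ hpq]
        linarith)
    have h2 := interior_subset h1
    rwa [mem_preimage, normalize_smul_vec q (inv_pos.2 hpq)] at h2

end HypSpace

/-! ### Half spaces and developments -/

namespace HypSpace

variable {n : ℕ} {V : Set (HypSpace n)} {l : (Fin (n + 1) → ℝ) →L[ℝ] ℝ}

/-- The part of `V` where a linear form is negative. -/
def cut (V : Set (HypSpace n)) (l : (Fin (n + 1) → ℝ) →L[ℝ] ℝ) : Set (HypSpace n) :=
  {q ∈ V | l q.vec < 0}

lemma continuous_apply_vec (l : (Fin (n + 1) → ℝ) →L[ℝ] ℝ) :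
    Continuous fun q : HypSpace n => l q.vec := l.continuous.comp continuous_vec

lemma isOpen_cut (hV : IsOpen V) : IsOpen (cut V l) :=
  hV.inter (isOpen_lt (continuous_apply_vec l) continuous_const)

lemma cone_cut : cone (cut V l) = {x ∈ cone V | l x < 0} := by
  ext x
  constructor
  · rintro ⟨hx, hxV, hxl⟩
    refine ⟨⟨hx, hxV⟩, ?_⟩
    obtain ⟨c, hc, hn⟩ := exists_normalize hx
    rw [hn, map_smul, smul_eq_mul] at hxl
    exact neg_of_mul_neg_right hxl hc.le
  · rintro ⟨⟨hx, hxV⟩, hxl⟩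
    refine ⟨hx, hxV, ?_⟩
    obtain ⟨c, hc, hn⟩ := exists_normalize hx
    rw [hn, map_smul, smul_eq_mul]
    exact mul_neg_of_pos_of_neg hc hxl

lemma geodConvex_cut (hc : GeodConvex V) : GeodConvex (cut V l) := by
  rw [geodConvex_iff, cone_cut]
  rintro x ⟨hx, hxl⟩ y ⟨hy, hyl⟩
  exact ⟨geodConvex_iff.1 hc x hx y hy, by rw [map_add]; exact add_neg hxl hyl⟩

lemma mem_closure_cut (hV : IsOpen V) (hc : GeodConvex V) {o : HypSpace n} (ho : o ∈ cut V l)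
    {q : HypSpace n} (hq : q ∈ closure V) (hql : l q.vec ≤ 0) : q ∈ closure (cut V l) := by
  rw [← vec_mem_closure_cone]
  have ht : Tendsto (fun s : ℝ => q.vec + s • o.vec) (𝓝[>] 0) (𝓝 q.vec) := by
    have : Continuous fun s : ℝ => q.vec + s • o.vec := by fun_prop
    simpa using (this.tendsto 0).mono_left nhdsWithin_le_nhds
  refine mem_closure_of_tendsto ht ?_
  filter_upwards [self_mem_nhdsWithin] with s hs
  rw [cone_cut]
  refine ⟨add_mem_cone_of_mem_closure hV hc (vec_mem_closure_cone.2 hq)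
    (smul_vec_mem_cone ho.1 hs), ?_⟩
  rw [map_add, map_smul, smul_eq_mul]
  exact add_neg_of_nonpos_of_neg hql (mul_neg_of_pos_of_neg hs ho.2)

lemma le_of_mem_closure_cut {q : HypSpace n} (hq : q ∈ closure (cut V l)) : l q.vec ≤ 0 :=
  closure_minimal (fun _ hx => hx.2.le) (isClosed_le (continuous_apply_vec l) continuous_const) hq

lemma IsProj.cut (hV : IsOpen V) (hc : GeodConvex V) {o : HypSpace n} (ho : o ∈ cut V l)
    {q z : HypSpace n} (h : IsProj V q z) (hq : l q.vec ≤ 0) : IsProj (cut V l) q z :=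
  ⟨mem_closure_cut hV hc ho h.1 hq, fun r hr => h.2 r hr.1⟩

/-- Being a projection is local at `q`: for small `s` the point `q + s r` is still in the cut, and
its inequality is equivalent to the one for `r`. -/
lemma IsProj.of_cut (hV : IsOpen V) (hc : GeodConvex V) {q z : HypSpace n}
    (h : IsProj (HypSpace.cut V l) q z) (hq : l q.vec < 0) : IsProj V q z := by
  have hqV : q ∈ closure V := closure_mono (fun _ hx => hx.1) h.1
  refine ⟨hqV, fun r hr => ?_⟩
  have hcont : Continuous fun s : ℝ => l (q.vec + s • r.vec) := by fun_prop
  have h1 : ∀ᶠ s in 𝓝[>] (0 : ℝ), l (q.vec + s • r.vec) < 0 :=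
    (hcont.tendsto 0).mono_left nhdsWithin_le_nhds |>.eventually
      (gt_mem_nhds (by simpa using hq))
  obtain ⟨s, hs, hs0⟩ := (h1.and self_mem_nhdsWithin).exists
  replace hs0 : 0 < s := hs0
  have h2 : q.vec + s • r.vec ∈ cone (HypSpace.cut V l) := by
    rw [cone_cut]
    exact ⟨add_mem_cone_of_mem_closure hV hc (vec_mem_closure_cone.2 hqV)
      (smul_vec_mem_cone hr hs0), hs⟩
  have h3 := h.le (subset_closure h2)
  rw [lorentz_add_right, lorentz_add_right, lorentz_smul_right, lorentz_smul_right,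
    lorentz_vec_self] at h3
  refine le_of_mul_le_mul_left ?_ hs0
  linarith

/-- The data of a convex set and of a smaller one, which differ in a compact set. -/
structure IsCap (V G V' K : Set (HypSpace n)) : Prop where
  isOpen : IsOpen V'
  convex : GeodConvex V'
  isCompact : IsCompact K
  isPreconnected : IsPreconnected K
  subset_base : K ⊆ G
  subset_closure : K ⊆ closure V
  notMem : ∀ q ∈ K, q ∉ V'
  subset : V' ⊆ V
  sdiff_subset : V \ V' ⊆ K
  sdiff_nonempty : (V \ V').Nonempty
  development_eq : development V' G = development V G ∪ V \ V'

lemma isPreconnected_setOf_le (hc : GeodConvex V) :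
    IsPreconnected {q ∈ closure V | 0 ≤ l q.vec} := by
  have h1 : Convex ℝ {x ∈ futureCone n | x ∈ closure (cone V) ∧ 0 ≤ l x} := by
    rw [convex_iff_forall_pos]
    rintro x ⟨hx, hxV, hxl⟩ y ⟨hy, hyV, hyl⟩ a b ha hb -
    refine ⟨add_mem_futureCone (smul_mem_futureCone hx ha) (smul_mem_futureCone hy hb),
      add_mem_closure_cone hc (smul_mem_closure_cone hxV ha) (smul_mem_closure_cone hyV hb), ?_⟩
    rw [map_add, map_smul, map_smul, smul_eq_mul, smul_eq_mul]
    positivity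
  have h2 := h1.isPreconnected.image normalize
    (continuousOn_normalize.mono fun x hx => hx.1)
  convert h2 using 1
  ext q
  constructor
  · rintro ⟨hq, hql⟩
    exact ⟨q.vec, ⟨q.vec_mem_futureCone, vec_mem_closure_cone.2 hq, hql⟩, normalize_vec_self q⟩
  · rintro ⟨x, ⟨hx, hxV, hxl⟩, rfl⟩
    refine ⟨(mem_closure_cone hx).1 hxV, ?_⟩
    obtain ⟨c, hc, hn⟩ := exists_normalize hx
    rw [hn, map_smul, smul_eq_mul]
    positivity

/-- The cut only changes projections within the cap, and the closed cap is over `G`. A point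
projecting to the negative side of the hyperplane has the same projection on both sets; otherwise
the projection that changes is in the closed cap, so remains over `G`. -/
lemma isCap_cut {G K : Set (HypSpace n)} (hV : IsOpen V) (hc : GeodConvex V)
    {o p : HypSpace n} (ho : o ∈ cut V l) (hp : p ∈ closure V) (hpl : 0 < l p.vec)
    (hK : IsCompact K) (hKG : K ⊆ G) (hlK : ∀ q ∈ closure V, 0 ≤ l q.vec → q ∈ K) :
    IsCap V G (cut V l) {q ∈ closure V | 0 ≤ l q.vec} := by
  have hsub : {q ∈ closure V | 0 ≤ l q.vec} ⊆ G := fun q hq => hKG (hlK q hq.1 hq.2)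
  refine ⟨isOpen_cut hV, geodConvex_cut hc, ?_, isPreconnected_setOf_le hc, hsub,
    fun q hq => hq.1, fun q hq h => not_lt.2 hq.2 h.2, fun q hq => hq.1,
    fun q hq => ⟨subset_closure hq.1, ?_⟩, ?_, ?_⟩
  · refine hK.of_isClosed_subset (isClosed_closure.inter (isClosed_le continuous_const
      (continuous_apply_vec l)))
      fun q hq => hlK q hq.1 hq.2
  · exact not_lt.1 fun h => hq.2 ⟨hq.1, h⟩
  · have hopen : IsOpen {q : HypSpace n | 0 < l q.vec} := isOpen_lt continuous_const
      (continuous_apply_vec l)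
    obtain ⟨q, hql, hq⟩ := mem_closure_iff.1 hp _ hopen hpl
    exact ⟨q, hq, fun h => lt_asymm h.2 hql⟩
  · ext z
    constructor
    · rintro ⟨hz, q, hqG, hq⟩
      by_cases hzV : z ∈ V
      · exact Or.inr ⟨hzV, hz⟩
      refine Or.inl ⟨hzV, ?_⟩
      obtain ⟨r, hr⟩ := exists_isProj hc ⟨o, ho.1⟩ z
      rcases le_total (l r.vec) 0 with h | h
      · exact ⟨q, hqG, hq.unique (hr.cut hV hc ho h) ▸ hr⟩
      · exact ⟨r, hsub ⟨hr.1, h⟩, hr⟩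
    · intro hz
      have hzV : z ∉ cut V l := by
        rcases hz with hz | hz
        · exact fun h => hz.1 h.1
        · exact hz.2
      refine ⟨hzV, ?_⟩
      obtain ⟨r, hr⟩ := exists_isProj (geodConvex_cut hc) ⟨o, ho⟩ z
      refine ⟨r, ?_, hr⟩
      have hrV : r ∈ closure V := closure_mono (fun _ hx => hx.1) hr.1
      rcases (le_of_mem_closure_cut hr.1).eq_or_lt with h | h
      · exact hsub ⟨hrV, h.ge⟩
      have hr' := hr.of_cut hV hc h
      rcases hz with ⟨hz, q, hqG, hq⟩ | hz
      · exact hr'.unique hq ▸ hqG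
      · have := hr'.unique (isProj_self (subset_closure hz.1))
        exact absurd ⟨hz.1, this ▸ h⟩ hz.2

/-- A boundary point which is not inner can be cut off by a hyperplane. -/
lemma exists_isCap {G : Set (HypSpace n)} (hV : IsOpen V) (hc : GeodConvex V) (hG : IsOpen G)
    {p : HypSpace n} (hp : p ∈ frontier V) (hpG : p ∈ G) (hin : ¬ IsInnerPoint V p) :
    ∃ V' K, IsCap V G V' K ∧ p ∈ K := by
  have hpc := frontier_subset_closure hp
  obtain ⟨o, ho⟩ : V.Nonempty := closure_nonempty_iff.1 ⟨p, hpc⟩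
  have hpo : p ≠ o := by
    rintro rfl
    rw [hV.frontier_eq] at hp
    exact hp.2 ho
  -- The neighbourhood also avoids a point `o` of `V`, so that `o` is on the negative side and the
  -- cut is nonempty.
  obtain ⟨K, hK, hKG, hKc⟩ := local_compact_nhds ((hG.inter isOpen_ne).mem_nhds ⟨hpG, hpo⟩)
  obtain ⟨l, hl, hlK⟩ := exists_cap hc hpc hin hK
  have hol : l o.vec < 0 := by
    by_contra h
    exact (hKG (hlK o (subset_closure ho) (not_lt.1 h))).2 rfl
  exact ⟨_, _, isCap_cut hV hc ⟨ho, hol⟩ hpc hl hKc (fun q hq => (hKG hq).1) hlK, hpc, hl.le⟩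

end HypSpace

/-! ### Gluing a cap -/

section Glue

variable {X : Type u} [TopologicalSpace X] {d : ℕ}

/-- The space `Z` is obtained from `X` by replacing the image of the chart `c`, a development of
`V`, by a development of the smaller convex set `V'`. -/
structure IsGluing {Z : Type u} [TopologicalSpace Z] (c : HypChart X d)
    (V V' G K : Set (HypSpace (d + 1))) (ι : X → Z) (j : development V' G → Z) : Prop where
  isOpenEmbedding : IsOpenEmbedding j
  continuous : Continuous ι
  injective : Function.Injective ι
  isOpen_image : ∀ O : Set X, IsOpen O → (∀ y ∈ O, y ∈ c.source → c.toFun y ∉ K) →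
    IsOpen (ι '' O)
  eq_iff : ∀ y w, ι y = j w ↔ y ∈ c.source ∧ c.toFun y = w.1
  cover : ∀ z, z ∈ range ι ∨ ∃ w, w.1 ∈ V ∧ j w = z

variable {c : HypChart X d} {V V' G K : Set (HypSpace (d + 1))}

lemma HypSpace.IsCap.subset_development {n : ℕ} {V V' G K : Set (HypSpace n)}
    (hcap : IsCap V G V' K) (hV : IsOpen V) : K ⊆ development V' G := by
  intro q hq
  rw [hcap.development_eq]
  by_cases hqV : q ∈ V
  · exact Or.inr ⟨hqV, hcap.notMem q hq⟩
  · refine Or.inl (self_mem_development hV ⟨hcap.subset_base hq, ?_⟩)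
    rw [hV.frontier_eq]
    exact ⟨hcap.subset_closure hq, hqV⟩

/-- The points of the chart over `K` correspond to `K \ V`, which is compact and contained in the
image of the chart. -/
lemma HypChart.IsDevelopment.isCompact_preimage (h : c.IsDevelopment V G) (hK : IsCompact K)
    (hKG : K ⊆ G) (hKV : K ⊆ closure V) : IsCompact {y ∈ c.source | c.toFun y ∈ K} := by
  have hsub : K \ V ⊆ range (c.source.domRestrict c.toFun) := by
    rw [range_domRestrict, h.image]
    intro q hq
    refine self_mem_development h.isOpen ⟨hKG hq.1, ?_⟩
    rw [h.isOpen.frontier_eq]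
    exact ⟨hKV hq.1, hq.2⟩
  have h1 := ((h.embedding.isInducing.isCompact_preimage_iff hsub).2
    (hK.diff h.isOpen)).image continuous_subtype_val
  convert h1 using 1
  ext y
  constructor
  · rintro ⟨hy, hyK⟩
    exact ⟨⟨y, hy⟩, ⟨hyK, (h.map_mem hy).1⟩, rfl⟩
  · rintro ⟨y, hy, rfl⟩
    exact ⟨y.2, hy.1⟩

open Classical in
lemma exists_isGluing [T2Space X] (h : c.IsDevelopment V G) (hcap : IsCap V G V' K) :
    ∃ (Z : Type u) (_ : TopologicalSpace Z) (ι : X → Z) (j : development V' G → Z),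
      IsGluing c V V' G K ι j := by
  have hW : ∀ w : development V' G, w.1 ∉ V → w.1 ∈ c.toFun '' c.source := by
    rintro ⟨w, hw'⟩ hw
    rw [h.image]
    rw [hcap.development_eq] at hw'
    exact hw'.resolve_right fun h => hw h.1
  have hinv : ∀ w : development V' G, ∃ y : w.1 ∉ V → X, ∀ hw, y hw ∈ c.source ∧
      c.toFun (y hw) = w.1 := fun w => by
    choose y hy using hW w
    exact ⟨y, hy⟩
  choose inv hinv using hinv
  -- As a set, `Z` only has the points of the cap as new points; `j` sends the others to their
  -- preimages by the chart.
  let Z := X ⊕ ULift.{u} ↥(V \ V')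
  let j : development V' G → Z := fun w =>
    if hw : w.1 ∈ V then Sum.inr ⟨⟨w.1, hw, w.2.1⟩⟩ else Sum.inl (inv w hw)
  have hj : ∀ y w, Sum.inl y = j w ↔ y ∈ c.source ∧ c.toFun y = w.1 := by
    intro y w
    by_cases hw : w.1 ∈ V
    · simp only [j, hw, dif_pos, reduceCtorEq, false_iff]
      rintro ⟨hy, hyw⟩
      exact (h.map_mem hy).1 (hyw ▸ hw)
    · simp only [j, hw, dif_neg, not_false_eq_true, Sum.inl.injEq]
      constructor
      · rintro rfl
        exact hinv w hw
      · rintro ⟨hy, hyw⟩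
        exact h.injOn hy (hinv w hw).1 (hyw.trans (hinv w hw).2.symm)
  have hjinj : Function.Injective j := by
    intro w w' hww
    by_cases hw : w.1 ∈ V
    · by_cases hw' : w'.1 ∈ V
      · simp only [j, hw, hw', dif_pos] at hww
        exact Subtype.ext (congrArg (fun r => r.down.1) (Sum.inr_injective hww))
      · simp only [j, hw, hw', dif_pos, dif_neg, not_false_eq_true, reduceCtorEq] at hww
    · have h1 : j w = Sum.inl (inv w hw) := dif_neg hw
      have h2 := (hj _ _).1 h1.symm
      rw [hww] at h1
      exact Subtype.ext (h2.2.symm.trans ((hj _ _).1 h1.symm).2)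
  have hclosed : IsClosed {y ∈ c.source | c.toFun y ∈ K} :=
    (h.isCompact_preimage hcap.isCompact hcap.subset_base hcap.subset_closure).isClosed
  -- Boundary points over `K` may become interior ones, so their neighbourhoods in `X` need not be
  -- open in `Z`. Off them, the topology of `X` is kept.
  let E₀ := {y ∈ c.source | c.toFun y ∈ K}ᶜ
  let i : E₀ → Z := fun y => Sum.inl y.1
  have hiinj : Function.Injective i := fun y y' hyy => Subtype.ext (Sum.inl_injective hyy)
  -- The final topology for the two pieces; both turn out to be open embeddings, because each
  -- intersection is open on both sides.
  let t : TopologicalSpace Z := TopologicalSpace.coinduced i inferInstance ⊔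
    TopologicalSpace.coinduced j inferInstance
  have ht : ∀ S : Set Z, IsOpen S ↔ IsOpen (i ⁻¹' S) ∧ IsOpen (j ⁻¹' S) := fun S => Iff.rfl
  have hi : IsOpenEmbedding i := by
    refine .of_continuous_injective_isOpenMap (continuous_def.2 fun S hS => ((ht S).1 hS).1)
      hiinj fun O hO => (ht _).2 ⟨by rwa [preimage_image_eq _ hiinj], ?_⟩
    obtain ⟨O', hO', rfl⟩ := isOpen_induced_iff.1 hO
    obtain ⟨P, hP, hPO⟩ := h.exists_isOpen_image hO'
    convert (hP.inter hcap.isCompact.isClosed.isOpen_compl).preimage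
      (continuous_subtype_val (p := (· ∈ development V' G))) using 1
    ext w
    constructor
    · rintro ⟨y, hy, hyw⟩
      obtain ⟨hys, hyw⟩ := (hj _ _).1 hyw
      have hyP : y.1 ∈ c.source ∩ c.toFun ⁻¹' P := hPO ▸ ⟨hys, hy⟩
      exact ⟨hyw ▸ hyP.2, fun hK => y.2 ⟨hys, hyw ▸ hK⟩⟩
    · rintro ⟨hwP, hwK⟩
      obtain ⟨y, hys, hyw⟩ := hW w fun hw => hwK (hcap.sdiff_subset ⟨hw, w.2.1⟩)
      have hyP : y ∈ c.source ∩ O' := by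
        rw [← hPO]
        refine ⟨hys, ?_⟩
        rw [mem_preimage, hyw]
        exact hwP
      refine ⟨⟨y, fun hy => hwK ?_⟩, hyP.2, (hj _ _).2 ⟨hys, hyw⟩⟩
      change w.1 ∈ K
      rw [← hyw]
      exact hy.2
  have hjo : IsOpenEmbedding j := by
    refine .of_continuous_injective_isOpenMap (continuous_def.2 fun S hS => ((ht S).1 hS).2)
      hjinj fun Q hQ => (ht _).2 ⟨?_, by rwa [preimage_image_eq _ hjinj]⟩
    obtain ⟨Q', hQ', rfl⟩ := isOpen_induced_iff.1 hQ
    convert (h.continuousOn.isOpen_inter_preimage c.isOpen_source hQ').preimage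
      (continuous_subtype_val (p := (· ∈ E₀))) using 1
    ext y
    constructor
    · rintro ⟨w, hw, hyw⟩
      obtain ⟨hys, hyw⟩ := (hj _ _).1 hyw.symm
      exact ⟨hys, by rw [mem_preimage, hyw]; exact hw⟩
    · rintro ⟨hys, hyQ⟩
      have hW' : c.toFun y.1 ∈ development V' G := by
        rw [hcap.development_eq]
        exact Or.inl (h.map_mem hys)
      exact ⟨⟨_, hW'⟩, hyQ, ((hj _ _).2 ⟨hys, rfl⟩).symm⟩
  refine ⟨Z, t, Sum.inl, j, hjo, ?_, Sum.inl_injective, ?_, hj, ?_⟩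
  · rw [continuous_iff_continuousAt]
    intro y
    by_cases hy : y ∈ c.source
    · have hW' : ∀ y : c.source, c.toFun y.1 ∈ development V' G := by
        intro y
        rw [hcap.development_eq]
        exact Or.inl (h.map_mem y.2)
      have h1 : Continuous fun y : c.source => j ⟨c.toFun y.1, hW' y⟩ :=
        hjo.continuous.comp (h.embedding.continuous.subtype_mk _)
      have h2 : (fun y : c.source => j ⟨c.toFun y.1, hW' y⟩) = Sum.inl ∘ Subtype.val := by
        funext y
        exact ((hj _ _).2 ⟨y.2, rfl⟩).symm
      rw [h2] at h1
      exact (c.isOpen_source.isOpenEmbedding_subtypeVal.continuousAt_iff (x := ⟨y, hy⟩)).1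
        h1.continuousAt
    · have hy' : y ∈ E₀ := fun h => hy h.1
      exact (hclosed.isOpen_compl.isOpenEmbedding_subtypeVal.continuousAt_iff
        (x := ⟨y, hy'⟩)).1 hi.continuous.continuousAt
  · intro O hO hOK
    have h1 : Sum.inl '' O = i '' (Subtype.val ⁻¹' O) := by
      ext z
      constructor
      · rintro ⟨y, hy, rfl⟩
        exact ⟨⟨y, fun h => hOK y hy h.1 h.2⟩, hy, rfl⟩
      · rintro ⟨y, hy, rfl⟩
        exact ⟨y, hy, rfl⟩
    rw [h1]
    exact hi.isOpenMap _ (hO.preimage continuous_subtype_val)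
  · rintro (y | ⟨⟨w, hw, hw'⟩⟩)
    · exact Or.inl ⟨y, rfl⟩
    · have hwW : w ∈ development V' G := by
        rw [hcap.development_eq]
        exact Or.inr ⟨hw, hw'⟩
      exact Or.inr ⟨⟨w, hwW⟩, hw, dif_pos hw⟩

namespace IsGluing

variable {Z : Type u} [TopologicalSpace Z] {ι : X → Z} {j : development V' G → Z}

lemma map_eq (hg : IsGluing c V V' G K ι j) (h : c.IsDevelopment V G) (hcap : IsCap V G V' K)
    {y : X} (hy : y ∈ c.source) : ∃ hw, ι y = j ⟨c.toFun y, hw⟩ := by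
  have hw : c.toFun y ∈ development V' G := by
    rw [hcap.development_eq]
    exact Or.inl (h.map_mem hy)
  exact ⟨hw, (hg.eq_iff _ _).2 ⟨hy, rfl⟩⟩

lemma isOpen_image_preimage (hg : IsGluing c V V' G K ι j) {P : Set (HypSpace (d + 1))}
    (hP : IsOpen P) : IsOpen (j '' (Subtype.val ⁻¹' P)) :=
  hg.isOpenEmbedding.isOpenMap _ (hP.preimage continuous_subtype_val)

lemma isClosed_preimage [T2Space X] (h : c.IsDevelopment V G) (hcap : IsCap V G V' K) :
    IsClosed {y ∈ c.source | c.toFun y ∈ K} :=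
  (h.isCompact_preimage hcap.isCompact hcap.subset_base hcap.subset_closure).isClosed

lemma isOpen_image_sdiff [T2Space X] (hg : IsGluing c V V' G K ι j) (h : c.IsDevelopment V G)
    (hcap : IsCap V G V' K) {O : Set X} (hO : IsOpen O) :
    IsOpen (ι '' (O ∩ {y ∈ c.source | c.toFun y ∈ K}ᶜ)) :=
  hg.isOpen_image _ (hO.inter (isClosed_preimage h hcap).isOpen_compl)
    fun _ hy hys hyK => hy.2 ⟨hys, hyK⟩

lemma isEmbedding [T2Space X] (hg : IsGluing c V V' G K ι j) (h : c.IsDevelopment V G)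
    (hcap : IsCap V G V' K) : IsEmbedding ι := by
  refine ⟨isInducing_iff_nhds.2 fun y => le_antisymm
    (map_le_iff_le_comap.1 hg.continuous.continuousAt) fun O hO => ?_, hg.injective⟩
  obtain ⟨O', hO'O, hO', hyO⟩ := mem_nhds_iff.1 hO
  by_cases hy : y ∈ c.source
  · obtain ⟨P, hP, hPO⟩ := h.exists_isOpen_image hO'
    obtain ⟨hw, hyw⟩ := hg.map_eq h hcap hy
    have hyP : y ∈ c.source ∩ c.toFun ⁻¹' P := hPO ▸ ⟨hy, hyO⟩
    refine ⟨_, (hg.isOpen_image_preimage hP).mem_nhds (hyw ▸ mem_image_of_mem j hyP.2), ?_⟩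
    rintro z ⟨w, hwP, hzw⟩
    obtain ⟨hz, hzw⟩ := (hg.eq_iff _ _).1 hzw.symm
    have hzP : z ∈ c.source ∩ O' := by
      rw [← hPO]
      refine ⟨hz, ?_⟩
      rw [mem_preimage, hzw]
      exact hwP
    exact hO'O hzP.2
  · refine ⟨_, (hg.isOpen_image_sdiff h hcap hO').mem_nhds
      (mem_image_of_mem ι ⟨hyO, fun h => hy h.1⟩), ?_⟩
    rintro z ⟨w, hw, hzw⟩
    exact hO'O (hg.injective hzw ▸ hw.1)

/-- A point outside the chart domain has a neighbourhood missing the closed set over `K`, hence open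
in `Z`. It is separated from old points as in `X`, and from the cap because `j` maps the part inside
`V` off `X`. -/
lemma separated [T2Space X] (hg : IsGluing c V V' G K ι j) (h : c.IsDevelopment V G)
    (hcap : IsCap V G V' K) {y : X} (hy : y ∉ c.source) {z : Z} (hz : ι y ≠ z) :
    SeparatedNhds {ι y} {z} := by
  have hyK : y ∉ {y ∈ c.source | c.toFun y ∈ K} := fun h => hy h.1
  rcases hg.cover z with ⟨y', rfl⟩ | ⟨w, hw, rfl⟩
  · obtain ⟨O, O', hO, hO', hyO, hyO', hdisj⟩ := t2_separation (ne_of_apply_ne ι hz)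
    by_cases hy' : y' ∈ c.source
    · obtain ⟨P, hP, hPO⟩ := h.exists_isOpen_image hO'
      obtain ⟨hw, hyw⟩ := hg.map_eq h hcap hy'
      have hyP : y' ∈ c.source ∩ c.toFun ⁻¹' P := hPO ▸ ⟨hy', hyO'⟩
      refine ⟨_, _, hg.isOpen_image_sdiff h hcap hO, hg.isOpen_image_preimage hP,
        singleton_subset_iff.2 (mem_image_of_mem ι ⟨hyO, hyK⟩),
        singleton_subset_iff.2 (hyw ▸ mem_image_of_mem j hyP.2), ?_⟩
      rw [Set.disjoint_left]
      rintro _ ⟨x, hx, rfl⟩ ⟨w, hwP, hxw⟩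
      obtain ⟨hxs, hxw⟩ := (hg.eq_iff _ _).1 hxw.symm
      have hxO' : x ∈ c.source ∩ O' := by
        rw [← hPO]
        refine ⟨hxs, ?_⟩
        rw [mem_preimage, hxw]
        exact hwP
      exact Set.disjoint_left.1 hdisj hx.1 hxO'.2
    · refine ⟨_, _, hg.isOpen_image_sdiff h hcap hO, hg.isOpen_image_sdiff h hcap hO',
        singleton_subset_iff.2 (mem_image_of_mem ι ⟨hyO, hyK⟩),
        singleton_subset_iff.2 (mem_image_of_mem ι ⟨hyO', fun h => hy' h.1⟩), ?_⟩
      rw [disjoint_image_iff hg.injective]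
      exact hdisj.mono inter_subset_left inter_subset_left
  · refine ⟨_, _, hg.isOpen_image_sdiff h hcap isOpen_univ, hg.isOpen_image_preimage h.isOpen,
      singleton_subset_iff.2 (mem_image_of_mem ι ⟨mem_univ _, hyK⟩),
      singleton_subset_iff.2 (mem_image_of_mem j hw), ?_⟩
    rw [Set.disjoint_left]
    rintro _ ⟨x, hx, rfl⟩ ⟨w, hwV, hxw⟩
    obtain ⟨hxs, hxw⟩ := (hg.eq_iff _ _).1 hxw.symm
    exact (h.map_mem hxs).1 (hxw ▸ hwV)

lemma mem_range_or (hg : IsGluing c V V' G K ι j) (h : c.IsDevelopment V G)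
    (hcap : IsCap V G V' K) (z : Z) : z ∈ range j ∨ ∃ y ∉ c.source, ι y = z := by
  rcases hg.cover z with ⟨y, rfl⟩ | ⟨w, -, rfl⟩
  · by_cases hy : y ∈ c.source
    · obtain ⟨hw, hyw⟩ := hg.map_eq h hcap hy
      exact Or.inl ⟨_, hyw.symm⟩
    · exact Or.inr ⟨y, hy, rfl⟩
  · exact Or.inl (mem_range_self w)

lemma t2Space [T2Space X] (hg : IsGluing c V V' G K ι j) (h : c.IsDevelopment V G)
    (hcap : IsCap V G V' K) : T2Space Z := by
  refine ⟨fun z z' hzz => ?_⟩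
  suffices hs : SeparatedNhds {z} {z'} by
    obtain ⟨u, v, hu, hv, hzu, hzv, huv⟩ := hs
    exact ⟨u, v, hu, hv, singleton_subset_iff.1 hzu, singleton_subset_iff.1 hzv, huv⟩
  rcases hg.mem_range_or h hcap z with ⟨w, rfl⟩ | ⟨y, hy, rfl⟩
  · rcases hg.mem_range_or h hcap z' with ⟨w', rfl⟩ | ⟨y, hy, rfl⟩
    · obtain ⟨O, O', hO, hO', hw, hw', hdisj⟩ := t2_separation (ne_of_apply_ne j hzz)
      exact ⟨_, _, hg.isOpenEmbedding.isOpenMap _ hO, hg.isOpenEmbedding.isOpenMap _ hO',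
        singleton_subset_iff.2 (mem_image_of_mem j hw),
        singleton_subset_iff.2 (mem_image_of_mem j hw'),
        (disjoint_image_iff hg.isOpenEmbedding.injective).2 hdisj⟩
    · exact (hg.separated h hcap hy hzz.symm).symm
  · exact hg.separated h hcap hy hzz

lemma secondCountableTopology [T2Space X] [SecondCountableTopology X]
    (hg : IsGluing c V V' G K ι j) (h : c.IsDevelopment V G)
    (hcap : IsCap V G V' K) : SecondCountableTopology Z := by
  let S : Bool → Set Z := fun b => bif b then range j else
    ι '' (univ ∩ {y ∈ c.source | c.toFun y ∈ K}ᶜ)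
  have hsub : ι '' (univ ∩ {y ∈ c.source | c.toFun y ∈ K}ᶜ) ⊆ range ι := image_subset_range _ _
  have h1 : SecondCountableTopology (range ι) :=
    (hg.isEmbedding h hcap).toHomeomorph.symm.secondCountableTopology
  have h2 : ∀ b, SecondCountableTopology (S b) := by
    rintro (_ | _)
    · exact (IsEmbedding.inclusion hsub).secondCountableTopology
    · exact hg.isOpenEmbedding.isEmbedding.toHomeomorph.symm.secondCountableTopology
  refine TopologicalSpace.secondCountableTopology_of_countable_cover (U := S) ?_ ?_
  · rintro (_ | _)
    · exact hg.isOpen_image_sdiff h hcap isOpen_univ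
    · exact hg.isOpenEmbedding.isOpen_range
  · refine eq_univ_of_forall fun z => mem_iUnion.2 ?_
    rcases hg.mem_range_or h hcap z with hz | ⟨y, hy, rfl⟩
    · exact ⟨true, hz⟩
    · exact ⟨false, mem_image_of_mem ι ⟨mem_univ _, fun h => hy h.1⟩⟩

/-- The connected set `K` contains all new points and meets the image of `X`. -/
lemma connectedSpace [ConnectedSpace X] (hg : IsGluing c V V' G K ι j)
    (h : c.IsDevelopment V G) (hcap : IsCap V G V' K) {x : X} (hx : x ∈ c.source)
    (hxK : c.toFun x ∈ K) : ConnectedSpace Z := by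
  have hKW := hcap.subset_development h.isOpen
  have : PreconnectedSpace K := Subtype.preconnectedSpace hcap.isPreconnected
  have h1 : IsPreconnected (range fun k : K => j ⟨k.1, hKW k.2⟩) :=
    isPreconnected_range (hg.isOpenEmbedding.continuous.comp
      (continuous_subtype_val.subtype_mk _))
  have h2 : ι x ∈ range fun k : K => j ⟨k.1, hKW k.2⟩ := by
    obtain ⟨hw, hyw⟩ := hg.map_eq h hcap hx
    exact ⟨⟨_, hxK⟩, hyw.symm⟩
  have h3 := (isPreconnected_range hg.continuous).union _ (mem_range_self x) h2 h1
  have h4 : range ι ∪ range (fun k : K => j ⟨k.1, hKW k.2⟩) = univ := by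
    refine eq_univ_of_forall fun z => ?_
    rcases hg.cover z with hz | ⟨w, hw, rfl⟩
    · exact Or.inl hz
    · exact Or.inr ⟨⟨w.1, hcap.sdiff_subset ⟨hw, w.2.1⟩⟩, rfl⟩
  rw [h4] at h3
  have : PreconnectedSpace Z := ⟨h3⟩
  exact { toNonempty := ⟨ι x⟩ }

end IsGluing

end Glue

/-! ### Rays in concave manifolds -/

section Rays

variable {X : Type u} [TopologicalSpace X] {d : ℕ} {A : Set (HypChart X d)}

lemma HypChart.IsDevelopment.exists_lift {c : HypChart X d} {V G : Set (HypSpace (d + 1))}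
    (h : c.IsDevelopment V G) {T : Type*} [TopologicalSpace T] {f : T → HypSpace (d + 1)}
    (hf : Continuous f) (hfW : ∀ t, f t ∈ development V G) :
    ∃ α : T → X, Continuous α ∧ ∀ t, α t ∈ c.source ∧ c.toFun (α t) = f t := by
  have hex : ∀ t, ∃ y : c.source, c.toFun y = f t := by
    intro t
    obtain ⟨y, hy, hyt⟩ : f t ∈ c.toFun '' c.source := h.image ▸ hfW t
    exact ⟨⟨y, hy⟩, hyt⟩
  choose α hα using hex
  refine ⟨fun t => (α t).1, continuous_subtype_val.comp ?_, fun t => ⟨(α t).2, hα t⟩⟩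
  rw [h.embedding.continuous_iff]
  convert hf using 1
  funext t
  exact hα t

lemma HypSpace.IsOrientedIsometry.lorentz_map_tangent {n : ℕ} {g : HypSpace n → HypSpace n}
    (hg : IsOrientedIsometry g) {p : HypSpace n} {v w : Fin (n + 1) → ℝ}
    (hv : IsUnitTangent p v) (hw : IsUnitTangent (g p) w)
    (h : ∀ t, g (expMap p v t) = expMap (g p) w t) (r : HypSpace n) :
    lorentz w (g r).vec = lorentz v r.vec := by
  have h1 := hg.lorentz_map (expMap p v 1) r
  rw [h, expMap_vec hv, expMap_vec hw, lorentz_add_left, lorentz_add_left, lorentz_smul_left,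
    lorentz_smul_left, lorentz_smul_left, lorentz_smul_left, hg.lorentz_map] at h1
  exact mul_left_cancel₀ (Real.sinh_pos_iff.2 one_pos).ne' (add_left_cancel h1)

/-- Supporting a convex set is a local property. -/
lemma HypSpace.lorentz_nonpos_of_eventually {n : ℕ} {V : Set (HypSpace n)} (hV : IsOpen V)
    (hc : GeodConvex V) {p : HypSpace n} (hp : p ∈ closure V) {w : Fin (n + 1) → ℝ}
    (hw : lorentz w p.vec = 0) (h : ∀ᶠ q in 𝓝 p, q ∈ V → lorentz w q.vec ≤ 0)
    {r : HypSpace n} (hr : r ∈ V) : lorentz w r.vec ≤ 0 := by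
  have hcont : Tendsto (fun s : ℝ => normalize (p.vec + s • r.vec)) (𝓝[>] 0) (𝓝 p) := by
    have h1 : Continuous fun s : ℝ => p.vec + s • r.vec := by fun_prop
    have h2 : ContinuousAt normalize (p.vec + (0 : ℝ) • r.vec) := by
      rw [zero_smul, add_zero]
      exact continuousAt_normalize p.vec_mem_futureCone
    have h3 := (ContinuousAt.comp (f := fun s : ℝ => p.vec + s • r.vec) h2 h1.continuousAt).tendsto
    simp only [Function.comp_apply, zero_smul, add_zero, normalize_vec_self] at h3
    exact h3.mono_left nhdsWithin_le_nhds
  obtain ⟨s, hs, hs0⟩ := ((hcont.eventually h).and self_mem_nhdsWithin).exists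
  replace hs0 : 0 < s := hs0
  have h4 := add_mem_cone_of_mem_closure hV hc (vec_mem_closure_cone.2 hp)
    (smul_vec_mem_cone hr hs0)
  obtain ⟨a, ha, hn⟩ := exists_normalize h4.1
  have h5 := hs h4.2
  rw [hn, lorentz_smul_right, lorentz_add_right, lorentz_smul_right, hw, zero_add] at h5
  exact nonpos_of_mul_nonpos_right (nonpos_of_mul_nonpos_right h5 ha) hs0

/-- The rays which leave the boundary in the domain of a chart stay in this domain. -/
lemma IsConcaveAtlas.mem_source_of_isProj [T2Space X] (hA : IsConcaveAtlas A) {c c' : HypChart X d}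
    (hc : c ∈ A) (hc' : c' ∈ A) {V G V' G' : Set (HypSpace (d + 1))} (h : c.IsDevelopment V G)
    (h' : c'.IsDevelopment V' G') {x y : X} (hx : x ∈ c.source ∩ c'.source)
    (hy : y ∈ c'.source) (hproj : IsProj V' (c'.toFun x) (c'.toFun y)) : y ∈ c.source := by
  obtain ⟨g, hg, hgc⟩ := hA.compatible c' hc' c hc
  obtain ⟨v, t₀, ht₀, hv, hvn, hyt⟩ := hproj.exists_ray h'.isOpen h'.convex (h'.map_mem hy).1
  obtain ⟨w, hw, hgw⟩ := hg.isExp_map hv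
  have hxV : c.toFun x ∈ closure V :=
    (hA.agreeAt hc' hc h' h hx.symm).closure_imp hproj.1
  have hgx : c.toFun x = g (c'.toFun x) := hgc x hx.symm
  rw [← hgx] at hw hgw
  -- The normal vector `v` of `V'` is carried to a normal vector `w` of `V`: the isometry only
  -- exchanges the convex sets near the point, but supporting is a local property.
  have hwn : ∀ r ∈ V, lorentz w r.vec ≤ 0 := by
    obtain ⟨e, rfl, he⟩ := hg.exists_homeomorph
    have h1 : Tendsto e.symm (𝓝 (c.toFun x)) (𝓝 (c'.toFun x)) := by
      have := e.symm.continuous.tendsto (c.toFun x)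
      rwa [hgx, e.symm_apply_apply, ← hgx] at this
    refine fun r hr => lorentz_nonpos_of_eventually h.isOpen h.convex hxV
      ((lorentz_comm _ _).trans hw.1) ?_ hr
    filter_upwards [h1.eventually (h'.eventually_mem_iff h hg hgc hx.symm)] with q hq hqV
    rw [e.apply_symm_apply] at hq
    have h2 := hg.lorentz_map_tangent hv (hgx ▸ hw) (fun t => hgx ▸ hgw t) (e.symm q)
    rw [e.apply_symm_apply] at h2
    rw [h2]
    exact hvn _ (hq.2 hqV)
  obtain ⟨α, hα, hα'⟩ := h'.exists_lift (T := Ici (0 : ℝ)) (f := fun t => expMap (c'.toFun x) v t)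
    ((continuous_expMap hv).comp continuous_subtype_val) fun t =>
      ⟨expMap_notMem (h'.map_mem hx.2).1 hv hvn t.2, _,
        mem_of_mem_development (h'.map_mem hx.2) hproj.1, isProj_expMap hproj.1 hv hvn t.2⟩
  obtain ⟨β, hβ, hβ'⟩ := h.exists_lift (T := Ici (0 : ℝ)) (f := fun t => expMap (c.toFun x) w t)
    ((continuous_expMap hw).comp continuous_subtype_val) fun t =>
      ⟨expMap_notMem (h.map_mem hx.1).1 hw hwn t.2, _,
        mem_of_mem_development (h.map_mem hx.1) hxV, isProj_expMap hxV hw hwn t.2⟩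
  -- `α` and `β` lift the same normal ray in the two charts. Agreement is closed since `X` is
  -- Hausdorff, and open since the chart `c` is injective on its domain.
  have hclopen : IsClopen {t | α t = β t} := by
    refine ⟨isClosed_eq hα hβ, isOpen_iff_mem_nhds.2 fun t ht => ?_⟩
    have ht' : α t ∈ c.source := by
      have : α t = β t := ht
      rw [this]
      exact (hβ' t).1
    filter_upwards [hα.continuousAt.eventually (c.isOpen_source.mem_nhds ht')] with s hs
    refine h.injOn hs (hβ' s).1 ?_
    rw [hgc _ ⟨(hα' s).1, hs⟩, (hα' s).2, (hβ' s).2, hgw]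
  have h0 : (⟨0, self_mem_Ici⟩ : Ici (0 : ℝ)) ∈ {t | α t = β t} := by
    have h1 : α ⟨0, self_mem_Ici⟩ = x :=
      h'.injOn (hα' _).1 hx.2 ((hα' _).2.trans expMap_zero)
    have h2 : β ⟨0, self_mem_Ici⟩ = x :=
      h.injOn (hβ' _).1 hx.1 ((hβ' _).2.trans expMap_zero)
    exact h1.trans h2.symm
  have : PreconnectedSpace (Ici (0 : ℝ)) := Subtype.preconnectedSpace isPreconnected_Ici
  have huniv := hclopen.eq_univ ⟨_, h0⟩
  have hyα : α ⟨t₀, ht₀⟩ = y :=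
    h'.injOn (hα' _).1 hy ((hα' _).2.trans hyt.symm)
  have hyβ : α ⟨t₀, ht₀⟩ = β ⟨t₀, ht₀⟩ := eq_univ_iff_forall.1 huniv ⟨t₀, ht₀⟩
  rw [← hyα, hyβ]
  exact (hβ' _).1

/-- Removal of a closed part of the boundary from a chart. -/
lemma IsConcaveAtlas.exists_restriction (hA : IsConcaveAtlas A) {c : HypChart X d}
    (hc : c ∈ A) {V G : Set (HypSpace (d + 1))} (h : c.IsDevelopment V G) {D : Set X}
    (hD : IsClosed D) (hDA : D ⊆ pleatedBoundary A) {y : X} (hy : y ∈ c.source)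
    (hyD : ∀ x ∈ D, x ∈ c.source → ¬ IsProj V (c.toFun x) (c.toFun y)) :
    ∃ (S : Set X) (G' : Set (HypSpace (d + 1))), IsOpen S ∧ S ⊆ c.source ∧ y ∈ S ∧
      Disjoint S D ∧ IsOpen G' ∧ c.toFun '' S = development V G' := by
  obtain ⟨P, hP, hPD⟩ := h.exists_isOpen_image hD.isOpen_compl
  -- The points of the chart whose projection avoids `D`; shrinking the base rather than the domain
  -- keeps the image a development.
  refine ⟨c.source ∩ c.toFun ⁻¹' development V (G ∩ P), G ∩ P, ?_, inter_subset_left,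
    ⟨hy, (h.map_mem hy).1, ?_⟩, ?_, h.isOpen_base.inter hP, ?_⟩
  · refine isOpen_iff_mem_nhds.2 fun z hz => ?_
    filter_upwards [c.isOpen_source.mem_nhds hz.1, (h.continuousAt hz.1).eventually
      (eventually_mem_development h.convex (h.isOpen_base.inter hP) hz.2)] with z' hz' hz''
    exact ⟨hz', hz'' (h.map_mem hz').1⟩
  · obtain ⟨p, hpG, hp⟩ := (h.map_mem hy).2
    obtain ⟨x, hx, rfl⟩ : p ∈ c.toFun '' c.source := h.image ▸
      self_mem_development h.isOpen ⟨hpG, hp.mem_frontier h.isOpen (h.map_mem hy).1⟩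
    have hxP : x ∈ c.source ∩ c.toFun ⁻¹' P := hPD ▸ ⟨hx, fun hxD => hyD x hxD hx hp⟩
    exact ⟨_, ⟨hpG, hxP.2⟩, hp⟩
  · rw [Set.disjoint_left]
    rintro x ⟨hx, hxdev⟩ hxD
    have h1 := mem_of_mem_development hxdev ((hA.mem_pleatedBoundary_iff hc h hx).1 (hDA hxD))
    have h2 : x ∈ c.source ∩ Dᶜ := hPD ▸ ⟨hx, h1.2⟩
    exact h2.2 hxD
  · rw [image_inter_preimage, h.image]
    refine inter_eq_right.2 ?_
    rintro z ⟨hz, p, hp, hpz⟩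
    exact ⟨hz, p, hp.1, hpz⟩

end Rays

/-! ### Hyperbolic ends are ruled -/

section Extension

lemma Topology.IsEmbedding.domRestrict_image {X Y Z : Type*} [TopologicalSpace X]
    [TopologicalSpace Y] [TopologicalSpace Z] {ι : X → Z} (hι : IsEmbedding ι) {S : Set X}
    {f : X → Y} {F : Z → Y} (hf : IsEmbedding (S.domRestrict f)) (hF : ∀ y ∈ S, F (ι y) = f y) :
    IsEmbedding ((ι '' S).domRestrict F) := by
  have h : (ι '' S).domRestrict F = S.domRestrict f ∘ (hι.homeomorphImage S).symm := by
    funext z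
    obtain ⟨y, rfl⟩ := (hι.homeomorphImage S).surjective z
    rw [Function.comp_apply, Homeomorph.symm_apply_apply]
    exact hF y y.2
  rw [h]
  exact hf.comp (Homeomorph.isEmbedding _)

variable {X : Type u} [TopologicalSpace X] {d : ℕ} {A : Set (HypChart X d)}
  {Z : Type u} [TopologicalSpace Z] {c : HypChart X d} {V V' G K : Set (HypSpace (d + 1))}
  {ι : X → Z} {j : development V' G → Z}

/-- A chart of the glued space which comes from a restriction of a chart of `X`. -/
def IsOldChart (A : Set (HypChart X d)) (ι : X → Z) (χ : HypChart Z d) : Prop :=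
  ∃ c ∈ A, ∃ V G G', c.IsDevelopment V G ∧ χ.IsDevelopment V G' ∧
    ∃ S ⊆ c.source, χ.source = ι '' S ∧ ∀ y ∈ S, χ.toFun (ι y) = c.toFun y

/-- The chart of the glued space which is given by the cap. -/
def IsNewChart (j : development V' G → Z) (χ : HypChart Z d) : Prop :=
  χ.IsDevelopment V' G ∧ χ.source = range j ∧ ∀ w, χ.toFun (j w) = w.1

namespace IsGluing

lemma exists_isNewChart (hg : IsGluing c V V' G K ι j) (h : c.IsDevelopment V G)
    (hcap : IsCap V G V' K) : ∃ χ : HypChart Z d, IsNewChart j χ := by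
  have hval : ∀ w, Function.extend j Subtype.val (fun _ => basePoint) (j w) = w.1 :=
    hg.isOpenEmbedding.injective.extend_apply _ _
  refine ⟨⟨range j, hg.isOpenEmbedding.isOpen_range,
    Function.extend j Subtype.val fun _ => basePoint⟩,
    ⟨hcap.isOpen, hcap.convex, h.isOpen_base, ?_, ?_⟩, rfl, hval⟩
  · have := hg.isOpenEmbedding.isEmbedding.domRestrict_image (S := univ) (f := Subtype.val)
      (IsEmbedding.subtypeVal.comp IsEmbedding.subtypeVal) fun w _ => hval w
    rwa [image_univ] at this
  · rw [← range_comp]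
    convert Subtype.range_val using 2
    funext w
    exact hval w

/-- A chart at `y` is restricted to the rays which do not start over `K`. The ray of `y` is kept: if
it started over `K`, it would stay in the domain of `c` by `mem_source_of_isProj`. -/
lemma exists_isOldChart [T2Space X] (hg : IsGluing c V V' G K ι j) (hA : IsConcaveAtlas A)
    (hc : c ∈ A) (h : c.IsDevelopment V G) (hcap : IsCap V G V' K) {y : X} (hy : y ∉ c.source) :
    ∃ χ : HypChart Z d, IsOldChart A ι χ ∧ ι y ∈ χ.source := by
  obtain ⟨c₁, hc₁, hyc⟩ := hA.cover y
  obtain ⟨V₁, G₁, h₁⟩ := hA.exists_isDevelopment hc₁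
  have hD : {y ∈ c.source | c.toFun y ∈ K} ⊆ pleatedBoundary A := fun x hx =>
    (hA.mem_pleatedBoundary_iff hc h hx.1).2 (hcap.subset_closure hx.2)
  obtain ⟨S, G', hS, hSc, hyS, hSD, hG', himage⟩ := hA.exists_restriction hc₁ h₁
    (isClosed_preimage h hcap) hD hyc fun x hx hxs hproj =>
      hy (hA.mem_source_of_isProj hc hc₁ h h₁ ⟨hx.1, hxs⟩ hyc hproj)
  have hval : ∀ y, Function.extend ι c₁.toFun (fun _ => basePoint) (ι y) = c₁.toFun y :=
    hg.injective.extend_apply _ _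
  refine ⟨⟨ι '' S, hg.isOpen_image S hS fun x hx hxs hxK =>
    Set.disjoint_left.1 hSD hx ⟨hxs, hxK⟩, Function.extend ι c₁.toFun fun _ => basePoint⟩,
    ⟨c₁, hc₁, V₁, G₁, G', h₁, ⟨h₁.isOpen, h₁.convex, hG', ?_, ?_⟩, S, hSc, rfl,
      fun y _ => hval y⟩, mem_image_of_mem ι hyS⟩
  · exact (hg.isEmbedding h hcap).domRestrict_image (h₁.embedding.domRestrict_mono hSc)
      fun y _ => hval y
  · rw [← himage, image_image]
    exact image_congr fun y _ => hval y

lemma exists_chart (hg : IsGluing c V V' G K ι j) (hc : c ∈ A) {χ : HypChart Z d}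
    (hχ : IsOldChart A ι χ ∨ IsNewChart j χ) :
    ∃ c' ∈ A, ∀ y, ι y ∈ χ.source → y ∈ c'.source ∧ χ.toFun (ι y) = c'.toFun y := by
  rcases hχ with ⟨c', hc', _, _, _, _, _, S, hS, hχs, hχ⟩ | ⟨-, hχs, hχ⟩
  · refine ⟨c', hc', fun y hy => ?_⟩
    rw [hχs] at hy
    obtain ⟨y', hy', hyy⟩ := hy
    obtain rfl := hg.injective hyy
    exact ⟨hS hy', hχ _ hy'⟩
  · refine ⟨c, hc, fun y hy => ?_⟩
    rw [hχs] at hy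
    obtain ⟨w, hw⟩ := hy
    obtain ⟨hy, hyw⟩ := (hg.eq_iff _ _).1 hw.symm
    exact ⟨hy, by rw [← hw, hχ, hyw]⟩

lemma isConcaveAtlas [T2Space X] (hd : 1 ≤ d) (hg : IsGluing c V V' G K ι j)
    (hA : IsConcaveAtlas A) (hc : c ∈ A) (h : c.IsDevelopment V G) (hcap : IsCap V G V' K) :
    IsConcaveAtlas {χ : HypChart Z d | IsOldChart A ι χ ∨ IsNewChart j χ} := by
  have hdev : ∀ χ : HypChart Z d, IsOldChart A ι χ ∨ IsNewChart j χ →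
      ∃ V G, χ.IsDevelopment V G := by
    rintro χ (⟨_, _, V₁, _, G', _, h', _⟩ | ⟨h', -⟩)
    · exact ⟨V₁, G', h'⟩
    · exact ⟨V', G, h'⟩
  refine ⟨fun z => ?_, fun χ hχ => ?_, fun χ hχ => ?_, fun χ hχ χ' hχ' => ?_⟩
  · rcases hg.mem_range_or h hcap z with hz | ⟨y, hy, rfl⟩
    · obtain ⟨χ, hχ⟩ := hg.exists_isNewChart h hcap
      exact ⟨χ, Or.inr hχ, hχ.2.1 ▸ hz⟩
    · obtain ⟨χ, hχ, hyχ⟩ := hg.exists_isOldChart hA hc h hcap hy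
      exact ⟨χ, Or.inl hχ, hyχ⟩
  · obtain ⟨V₁, G₁, h₁⟩ := hdev χ hχ
    exact h₁.embedding
  · obtain ⟨V₁, G₁, h₁⟩ := hdev χ hχ
    exact h₁.exists_image hd
  · by_cases hnew : IsNewChart j χ ∧ IsNewChart j χ'
    · refine ⟨id, .id, fun z hz => ?_⟩
      obtain ⟨w, rfl⟩ : z ∈ range j := hnew.1.2.1 ▸ hz.1
      rw [hnew.1.2.2, hnew.2.2.2, id]
    have hrange : ∀ z ∈ χ.source ∩ χ'.source, z ∈ range ι := by
      intro z hz
      have hold : ∀ χ : HypChart Z d, IsOldChart A ι χ → z ∈ χ.source → z ∈ range ι := by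
        rintro χ ⟨_, _, _, _, _, _, _, S, _, hχs, _⟩ hz
        rw [hχs] at hz
        exact image_subset_range _ _ hz
      rcases hχ with hχ | hχ
      · exact hold χ hχ hz.1
      · rcases hχ' with hχ' | hχ'
        · exact hold χ' hχ' hz.2
        · exact absurd ⟨hχ, hχ'⟩ hnew
    obtain ⟨c₁, hc₁, h₁⟩ := hg.exists_chart hc hχ
    obtain ⟨c₂, hc₂, h₂⟩ := hg.exists_chart hc hχ'
    obtain ⟨g, hgi, hgc⟩ := hA.compatible c₁ hc₁ c₂ hc₂
    refine ⟨g, hgi, fun z hz => ?_⟩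
    obtain ⟨y, rfl⟩ := hrange z hz
    obtain ⟨hy₁, hyχ⟩ := h₁ y hz.1
    obtain ⟨hy₂, hyχ'⟩ := h₂ y hz.2
    rw [hyχ, hyχ', hgc y ⟨hy₁, hy₂⟩]

variable {A' : Set (HypChart Z d)}

lemma isHypInclusion [T2Space X] (hg : IsGluing c V V' G K ι j) (hA : IsConcaveAtlas A)
    (hc : c ∈ A) (h : c.IsDevelopment V G) (hcap : IsCap V G V' K) (hA' : IsConcaveAtlas A')
    (hAA' : {χ : HypChart Z d | IsOldChart A ι χ ∨ IsNewChart j χ} ⊆ A') :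
    IsHypInclusion A A' ι := by
  refine ⟨hg.isEmbedding h hcap, fun c₁ hc₁ c' hc' x hx hx' => ?_⟩
  obtain ⟨χ, hχ, hxχ⟩ : ∃ χ : HypChart Z d, (IsOldChart A ι χ ∨ IsNewChart j χ) ∧
      ι x ∈ χ.source := by
    by_cases hxc : x ∈ c.source
    · obtain ⟨χ, hχ⟩ := hg.exists_isNewChart h hcap
      obtain ⟨hw, hxw⟩ := hg.map_eq h hcap hxc
      exact ⟨χ, Or.inr hχ, hχ.2.1 ▸ hxw ▸ mem_range_self _⟩
    · obtain ⟨χ, hχ, hyχ⟩ := hg.exists_isOldChart hA hc h hcap hxc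
      exact ⟨χ, Or.inl hχ, hyχ⟩
  obtain ⟨c₂, hc₂, h₂⟩ := hg.exists_chart hc hχ
  obtain ⟨g, hgi, hgc⟩ := hA.compatible c₁ hc₁ c₂ hc₂
  obtain ⟨g', hgi', hgc'⟩ := hA'.compatible χ (hAA' hχ) c' hc'
  refine ⟨g' ∘ g, hgi'.comp hgi, ?_⟩
  filter_upwards [c₁.isOpen_source.mem_nhds hx, hg.continuous.continuousAt.eventually
    ((χ.isOpen_source.inter c'.isOpen_source).mem_nhds ⟨hxχ, hx'⟩)] with y hy hy'
  obtain ⟨hy₂, hyχ⟩ := h₂ y hy'.1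
  rw [hgc' _ hy', hyχ, hgc y ⟨hy, hy₂⟩, Function.comp_apply]

lemma pleatedBoundary_nonempty (hg : IsGluing c V V' G K ι j) (h : c.IsDevelopment V G)
    (hcap : IsCap V G V' K) (hA' : IsConcaveAtlas A')
    (hAA' : {χ : HypChart Z d | IsOldChart A ι χ ∨ IsNewChart j χ} ⊆ A')
    (hK : K.Nonempty) : (pleatedBoundary A').Nonempty := by
  obtain ⟨χ, hχ⟩ := hg.exists_isNewChart h hcap
  obtain ⟨p, hp⟩ := hK
  obtain ⟨hpV, q, hqG, hq⟩ := hcap.subset_development h.isOpen hp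
  have hqV := hq.mem_frontier hcap.isOpen hpV
  have hqW : q ∈ development V' G := self_mem_development hcap.isOpen ⟨hqG, hqV⟩
  refine ⟨j ⟨q, hqW⟩, (hA'.mem_pleatedBoundary_iff (hAA' (Or.inr hχ)) hχ.1
    (hχ.2.1 ▸ mem_range_self _)).2 ?_⟩
  rw [hχ.2.2]
  exact frontier_subset_closure hqV

/-- The new boundary is closed and contained in the union of the images of the old boundary and of
`K`. -/
lemma isCompact_pleatedBoundary [T2Space X] (hg : IsGluing c V V' G K ι j)
    (hA : IsConcaveAtlas A) (hc : c ∈ A) (h : c.IsDevelopment V G) (hcap : IsCap V G V' K)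
    (hA' : IsConcaveAtlas A')
    (hAA' : {χ : HypChart Z d | IsOldChart A ι χ ∨ IsNewChart j χ} ⊆ A')
    (hcompact : IsCompact (pleatedBoundary A)) : IsCompact (pleatedBoundary A') := by
  have hKW := hcap.subset_development h.isOpen
  have : CompactSpace K := isCompact_iff_compactSpace.1 hcap.isCompact
  have h1 : IsCompact (range fun k : K => j ⟨k.1, hKW k.2⟩) :=
    isCompact_range (hg.isOpenEmbedding.continuous.comp (continuous_subtype_val.subtype_mk _))
  refine ((hcompact.image hg.continuous).union h1).of_isClosed_subset
    hA'.isClosed_pleatedBoundary fun z hz => ?_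
  rcases hg.mem_range_or h hcap z with ⟨w, rfl⟩ | ⟨y, hy, rfl⟩
  · obtain ⟨χ, hχ⟩ := hg.exists_isNewChart h hcap
    have hw := (hA'.mem_pleatedBoundary_iff (hAA' (Or.inr hχ)) hχ.1
      (hχ.2.1 ▸ mem_range_self _)).1 hz
    rw [hχ.2.2] at hw
    by_cases hwV : w.1 ∈ V
    · exact Or.inr ⟨⟨w.1, hcap.sdiff_subset ⟨hwV, w.2.1⟩⟩, rfl⟩
    · rcases hg.cover (j w) with ⟨y, hyw⟩ | ⟨w', hw', hww⟩
      · obtain ⟨hy, hyw'⟩ := (hg.eq_iff _ _).1 hyw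
        refine Or.inl ⟨y, (hA.mem_pleatedBoundary_iff hc h hy).2 ?_, hyw⟩
        rw [hyw']
        exact closure_mono hcap.subset hw
      · exact absurd (hg.isOpenEmbedding.injective hww ▸ hw') hwV
  · obtain ⟨χ, hχ, hyχ⟩ := hg.exists_isOldChart hA hc h hcap hy
    have hχ' := hχ
    obtain ⟨c', hc', V₁, G₁, G', h₁, h₁', S, hS, hχs, hχv⟩ := hχ'
    rw [hχs] at hyχ
    obtain ⟨y', hy', hyy⟩ := hyχ
    obtain rfl := hg.injective hyy
    have h2 := (hA'.mem_pleatedBoundary_iff (hAA' (Or.inl hχ)) h₁'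
      (hχs ▸ mem_image_of_mem ι hy')).1 hz
    rw [hχv _ hy'] at h2
    exact Or.inl ⟨y', (hA.mem_pleatedBoundary_iff hc' h₁ (hS hy')).2 h2, rfl⟩

end IsGluing

/-- Maximality forces the boundary of an end to be ruled. -/
lemma IsHypEnd.isInnerPoint (hd : 1 ≤ d) (hE : IsHypEnd A) (hc : c ∈ A)
    (h : c.IsDevelopment V G) {x : X} (hx : x ∈ pleatedBoundary A) (hxc : x ∈ c.source) :
    IsInnerPoint V (c.toFun x) := by
  by_contra hin
  have hM := hE.bounded.manifold
  have hA := hM.maximal_atlas.prop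
  have := hM.connected
  have := hM.t2
  have := hM.secondCountable
  have hcl := (hA.mem_pleatedBoundary_iff hc h hxc).1 hx
  have hfr : c.toFun x ∈ frontier V := by
    rw [h.isOpen.frontier_eq]
    exact ⟨hcl, (h.map_mem hxc).1⟩
  obtain ⟨V', K, hcap, hxK⟩ := exists_isCap h.isOpen h.convex h.isOpen_base hfr
    (mem_of_mem_development (h.map_mem hxc) hcl) hin
  obtain ⟨Z, tZ, ι, j, hg⟩ := exists_isGluing h hcap
  obtain ⟨A', hAA', hmax⟩ := (hg.isConcaveAtlas hd hA hc h hcap).exists_maximal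
  have hA' := hmax.prop
  have hbounded : IsCompactlyBounded A' :=
    ⟨⟨hg.connectedSpace h hcap hxc hxK, hg.t2Space h hcap, hg.secondCountableTopology h hcap,
      hmax⟩, hg.pleatedBoundary_nonempty h hcap hA' hAA' ⟨_, hxK⟩,
      hg.isCompact_pleatedBoundary hA hc h hcap hA' hAA' hE.bounded.compact⟩
  have hsurj := hE.maximal Z A' hbounded ι (hg.isHypInclusion hA hc h hcap hA' hAA')
  -- A point of the cap is not in the image of the end: otherwise the chart `c` would take a value
  -- in `V`.
  obtain ⟨r, hr⟩ := hcap.sdiff_nonempty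
  have hrW : r ∈ development V' G := by
    rw [hcap.development_eq]
    exact Or.inr hr
  obtain ⟨y, hy⟩ := hsurj (j ⟨r, hrW⟩)
  obtain ⟨hys, hyr⟩ := (hg.eq_iff _ _).1 hy
  exact (h.map_mem hys).1 (hyr ▸ hr.1)

end Extension

end

theorem mainTheorem7 {d : ℕ} (hd : 1 ≤ d) {E : Type u} [TopologicalSpace E]
    (A : Set (HypChart E d)) (hE : IsHypEnd A) :
    ∃ (O : OrientedLipschitzAtlas (pleatedBoundary A) d)
      (B : Set (HypChart (pleatedBoundary A) d)),
      IsHypEmbeddingStructure O B ∧ IsConvexRuled O B ∧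
        ∀ c ∈ A, c.restrictTo (pleatedBoundary A) ∈ B :=
  hE.bounded.manifold.maximal_atlas.prop.exists_convexRuled hd
    fun _ hc _ _ h _ hx hxc => hE.isInnerPoint hd hc h hx hxc
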